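/- Let $r>1$ and $b>0$. For a delay $h\ge 0$ consider in $\mathbb R^n$ the delayed Belousov--Zhabotinsky system $$u_t(t,x)=\Delta u(t,x)+u(t,x)\bigl(1-u(t,x)-r\,v(t-h,x)\bigr),\qquad v_t(t,x)=\Delta v(t,x)-b\,u(t,x)\,v(t,x).$$ A positive monotone wavefront of it with velocity $c\in\mathbb R$, connecting $(0,1)$ with $(1,0)$, is a classical solution on $\mathbb R\times\mathbb R^n$ of the form $(u,v)(t,x)=(\phi,\theta)(\nu\cdot x+ct)$ with $|\nu|=1$, $\phi>0$, $\theta>0$, $\phi$ non-decreasing, $\theta$ non-increasing, $(\phi,\theta)(-\infty)=(0,1)$ and $(\phi,\theta)(+\infty)=(1,0)$. Then: (a) For each $h\ge 0$ there is at most one positive monotone wavefront: any two of them have the same velocity $c$, and their profiles $(\phi,\theta)$ coincide up to a translation, whatever their directions $\nu$ are. If $h=0$, such a wavefront exists for every direction $\nu$ (so it is unique). When a wavefront exists, denote its (unique) velocity by $c_\star(r,b,h)$. (b) For each $h\ge0$, the equation $c=2\max\Bigl\{\Re\sqrt{1-r},\ \sqrt{b'}/\sqrt{1+b'}\Bigr\}$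 with $b'=b\,e^{-c^2h/2}$ has a unique positive root $c=c_\#(r,b,h)$, and the equation $$c^2\Bigl(\frac{\omega_*}{8r}+\frac h2\Bigr)+\ln\frac{c^2}{4br}-\frac{\omega_*}{2}\,\frac{1-r}{r}=0$$ has a unique positive root $c=c_o(r,b,h)$, where $\omega_*=8.21093\dots$ is the greatest positive root of $\omega=4+2\ln\omega$. If a positive monotone wavefront exists for the delay $h$, then $c_\star(r,b,h)\le\min\{c_\#(r,b,h),\,c_o(r,b,h)\}$. (c) $c_\star(r,b,h)$ is non-increasing in $h$: if $0\le h_1\le h_2$ and positive monotone wavefronts exist for both delays, then $c_\star(r,b,h_2)\le c_\star(r,b,h_1)$. -/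

import Mathlib

open Filter Topology

/-- `(u, v)`, with `u t x`, `v t x` for `t ∈ ℝ` and `x ∈ ℝⁿ`, is an entire classical solution of the
delayed Belousov-Zhabotinsky system
`u_t(t, x) = Δu(t, x) + u(t, x) (1 - u(t, x) - r v(t - h, x))`,
`v_t(t, x) = Δv(t, x) - b u(t, x) v(t, x)`. -/
structure IsBZSolution {n : ℕ} (r b h : ℝ) (u v : ℝ → EuclideanSpace ℝ (Fin n) → ℝ) : Prop where
  contDiff_u : ∀ t, ContDiff ℝ 2 (u t)
  contDiff_v : ∀ t, ContDiff ℝ 2 (v t)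
  differentiable_u : ∀ x, Differentiable ℝ (fun t => u t x)
  differentiable_v : ∀ x, Differentiable ℝ (fun t => v t x)
  eq_u : ∀ t x, deriv (fun s => u s x) t =
    Laplacian.laplacian (u t) x + u t x * (1 - u t x - r * v (t - h) x)
  eq_v : ∀ t x, deriv (fun s => v s x) t =
    Laplacian.laplacian (v t) x - b * u t x * v t x

/-- `(u, v)(t, x) = (φ, θ)(ν · x + c t)` is a positive monotone wavefront of the delayed
Belousov-Zhabotinsky system which moves at the velocity `c` and connects `(0, 1)` with `(1, 0)`. -/
structure IsMonotoneWavefront {n : ℕ} (r b h : ℝ) (ν : EuclideanSpace ℝ (Fin n)) (c : ℝ)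
    (φ θ : ℝ → ℝ) : Prop where
  norm_direction : ‖ν‖ = 1
  solution : IsBZSolution r b h (fun t x => φ (inner ℝ ν x + c * t))
    (fun t x => θ (inner ℝ ν x + c * t))
  pos_φ : ∀ s, 0 < φ s
  pos_θ : ∀ s, 0 < θ s
  monotone_φ : Monotone φ
  antitone_θ : Antitone θ
  tendsto_φ_atBot : Tendsto φ atBot (𝓝 0)
  tendsto_θ_atBot : Tendsto θ atBot (𝓝 1)
  tendsto_φ_atTop : Tendsto φ atTop (𝓝 1)
  tendsto_θ_atTop : Tendsto θ atTop (𝓝 0)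

/-- `b' = b exp(-c² h / 2)`. -/
noncomputable def bPrime (b h c : ℝ) : ℝ := b * Real.exp (-(c ^ 2 * h / 2))

/-- `c` is a positive root of `c = 2 max {Re √(1 - r), √b' / √(1 + b')}`, `b' = b exp(-c² h / 2)`.
(`Real.sqrt (1 - r)` is the real part of the complex root, since both vanish for `r ≥ 1`.) -/
def IsCSharp (r b h c : ℝ) : Prop :=
  0 < c ∧ c = 2 * max (Real.sqrt (1 - r))
    (Real.sqrt (bPrime b h c) / Real.sqrt (1 + bPrime b h c))

/-- `ω` is the greatest positive root of the equation `ω = 4 + 2 ln ω`. -/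
def IsOmegaStar (ω : ℝ) : Prop :=
  IsGreatest {w : ℝ | 0 < w ∧ w = 4 + 2 * Real.log w} ω

/-- The function `f(y, r, b, h)` with `y = c²` and with `ω` in the place of `ω_*`. -/
noncomputable def fBZ (ω y r b h : ℝ) : ℝ :=
  y * (ω / (8 * r) + h / 2) + Real.log (y / (4 * b * r)) - ω / 2 * ((1 - r) / r)

/-- `c` is a positive root of `f(c², r, b, h) = 0`. -/
def IsCO (r b h c : ℝ) : Prop :=
  ∃ ω, IsOmegaStar ω ∧ 0 < c ∧ fBZ ω (c ^ 2) r b h = 0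

/-! ### One-variable calculus and maximum principles on intervals. -/

section Calculus

/-! With ψ = 1 - θ the profile equations become cooperative: each source is non-decreasing in the
other component as long as the values stay in [0, 1]. Hence maximum principles and the sliding
method apply, and the whole proof rests on them.

Uniqueness and dependence on h. Since φ', ψ' ≥ 0 and ψ is non-decreasing, a profile with a larger
speed and a larger delay is a sub-solution of the problem with the smaller ones
(`IsProfile.isSubprofile`). Take the smallest shift at which the solution still dominates this
sub-solution. The delicate end is -∞, where every state (0, k) is an equilibrium. There φ decays
faster than e^{cx}, while ψ behaves exactly like A e^{cx}; a strict order of the leading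
coefficients leaves room for a further shift, and equal coefficients force contact
(`exists_touch_of_tendsto`). So the ordered pair touches, the strong maximum principle makes it
coincide (`exists_shift_eq`), and the equations then give equal speeds. Both (a) and (c) follow from
`IsProfile.eq_shift_of_le`.

Bounds of the speed. A super-solution of speed c, slid until it touches a profile of speed c₂ > c,
gives a contradiction at the contact point, through the term (c₂ - c) times a positive derivative
(`IsSupersolution.speed_le`). For c_# the super-solution is a pair of exponentials with exponent
c/2. For c_o its second component is 1 - exp(-e^{cs/2}), and its first is one exponential, or the
minimum of two with exponents 3c/4 and c/2; what remains are elementary inequalities, for which ω_*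
≤ 8.22 is precise enough.

Existence for h = 0. On [0, ℓ] a monotone iteration solves the Dirichlet problem
(`exists_isDirichletSolution`). Sliding shows that the solutions are increasing and that φ is
unique, so φ depends continuously on c. At a suitable point φ exceeds 1/4 for c = 0 and is at most
1/4 for c = 2, so some c in between gives exactly 1/4. Centre the solution there and let ℓ → ∞: a
subsequence converges to a solution on the line, of positive speed. Its limits are equilibria; that
ψ vanishes at -∞ needs the separate flux estimates `flux_nonneg` and `ψ_le_of_φ_le`. -/

/-- Integrating factor: a function with `Q' ≤ l Q` has `Q e^{-l x}` non-increasing. -/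
lemma antitoneOn_mul_exp_of_deriv_le {D : Set ℝ} (hD : Convex ℝ D) {Q q : ℝ → ℝ} {l : ℝ}
    (hQ : ∀ x ∈ D, HasDerivAt Q (q x) x) (hq : ∀ x ∈ D, q x ≤ l * Q x) :
    AntitoneOn (fun x => Q x * Real.exp (-(l * x))) D := by
  have hd : ∀ x ∈ D, HasDerivAt (fun x => Q x * Real.exp (-(l * x)))
      ((q x - l * Q x) * Real.exp (-(l * x))) x := by
    intro x hx
    have h1 : HasDerivAt (fun x : ℝ => -(l * x)) (-(l * 1)) x :=
      ((hasDerivAt_id x).const_mul l).neg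
    exact ((hQ x hx).mul h1.exp).congr_deriv (by ring)
  refine antitoneOn_of_hasDerivWithinAt_nonpos hD
    (fun x hx => (hd x hx).continuousAt.continuousWithinAt)
    (fun x hx => (hd x (interior_subset hx)).hasDerivWithinAt) (fun x hx => ?_)
  have := hq x (interior_subset hx)
  exact mul_nonpos_of_nonpos_of_nonneg (by linarith) (Real.exp_pos _).le

lemma monotoneOn_mul_exp_of_le_deriv {D : Set ℝ} (hD : Convex ℝ D) {Q q : ℝ → ℝ} {l : ℝ}
    (hQ : ∀ x ∈ D, HasDerivAt Q (q x) x) (hq : ∀ x ∈ D, l * Q x ≤ q x) :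
    MonotoneOn (fun x => Q x * Real.exp (-(l * x))) D := by
  have := antitoneOn_mul_exp_of_deriv_le hD (Q := fun x => -Q x) (q := fun x => -q x) (l := l)
    (fun x hx => (hQ x hx).neg) (fun x hx => by have := hq x hx; linarith)
  intro x hx y hy hxy
  have := this hx hy hxy
  simp only at this ⊢
  linarith

lemma monotoneOn_of_hasDerivAt_nonneg {D : Set ℝ} (hD : Convex ℝ D) {f f' : ℝ → ℝ}
    (hf : ∀ x ∈ D, HasDerivAt f (f' x) x) (h : ∀ x ∈ D, 0 ≤ f' x) : MonotoneOn f D :=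
  monotoneOn_of_hasDerivWithinAt_nonneg hD
    (fun x hx => (hf x hx).continuousAt.continuousWithinAt)
    (fun x hx => (hf x (interior_subset hx)).hasDerivWithinAt)
    (fun x hx => h x (interior_subset hx))

lemma antitoneOn_of_hasDerivAt_nonpos {D : Set ℝ} (hD : Convex ℝ D) {f f' : ℝ → ℝ}
    (hf : ∀ x ∈ D, HasDerivAt f (f' x) x) (h : ∀ x ∈ D, f' x ≤ 0) : AntitoneOn f D :=
  antitoneOn_of_hasDerivWithinAt_nonpos hD
    (fun x hx => (hf x hx).continuousAt.continuousWithinAt)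
    (fun x hx => (hf x (interior_subset hx)).hasDerivWithinAt)
    (fun x hx => h x (interior_subset hx))

/-- The necessary second order condition at a local minimum. -/
lemma IsLocalMin.second_order {f f' : ℝ → ℝ} {x f'' : ℝ} (hmin : IsLocalMin f x)
    (hf : ∀ᶠ y in 𝓝 x, HasDerivAt f (f' y) y) (hf' : HasDerivAt f' f'' x) :
    f' x = 0 ∧ 0 ≤ f'' := by
  have h0 : f' x = 0 := hmin.hasDerivAt_eq_zero hf.self_of_nhds
  refine ⟨h0, ?_⟩
  by_contra hneg
  push Not at hneg
  have hd : deriv f =ᶠ[𝓝 x] f' := hf.mono fun y hy => hy.deriv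
  have hdd : deriv (deriv f) x = f'' := by rw [hd.deriv_eq]; exact hf'.deriv
  -- A negative second derivative would make x a local maximum too; then f is locally constant and
  -- its second derivative is 0.
  have hmax : IsLocalMax f x :=
    isLocalMax_of_deriv_deriv_neg (by rw [hdd]; exact hneg) (by rw [hd.self_of_nhds, h0])
      hf.self_of_nhds.continuousAt
  have hc : f =ᶠ[𝓝 x] fun _ => f x := by
    filter_upwards [hmin, hmax] with y h1 h2 using le_antisymm h2 h1
  have : deriv f =ᶠ[𝓝 x] fun _ => 0 := by
    have := hc.deriv
    simpa using this
  have h2 : deriv (deriv f) x = 0 := by rw [this.deriv_eq]; simp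
  linarith

/-- The strong maximum principle for `P'' - c P' - k P ≤ 0`, `P ≥ 0`. -/
lemma eqOn_zero_of_nonneg_of_touch {D : Set ℝ} (hDo : IsOpen D) (hD : Convex ℝ D) {c k : ℝ}
    (hk : 0 ≤ k) {P P₁ P₂ : ℝ → ℝ} (h1 : ∀ x ∈ D, HasDerivAt P (P₁ x) x)
    (h2 : ∀ x ∈ D, HasDerivAt P₁ (P₂ x) x) (hP : ∀ x ∈ D, 0 ≤ P x)
    (hineq : ∀ x ∈ D, P₂ x - c * P₁ x - k * P x ≤ 0) {x₀ : ℝ} (hx₀ : x₀ ∈ D) (h0 : P x₀ = 0) :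
    ∀ x ∈ D, P x = 0 := by
  have hP1 : P₁ x₀ = 0 := by
    have hmin : IsLocalMin P x₀ := by
      filter_upwards [hDo.mem_nhds hx₀] with y hy
      rw [h0]; exact hP y hy
    exact hmin.hasDerivAt_eq_zero (h1 x₀ hx₀)
  -- `l₁` and `l₂` are the roots of l² - c l - k, so the operator factors as (D - l₁)(D - l₂). Two
  -- first-order inequalities are integrated from x₀ in turn, with the order of the factors
  -- depending on the side of x₀.
  set w := Real.sqrt (c ^ 2 + 4 * k) with hw
  have hw2 : w ^ 2 = c ^ 2 + 4 * k := Real.sq_sqrt (by positivity)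
  set l₁ := (c + w) / 2
  set l₂ := (c - w) / 2
  have hsum : l₁ + l₂ = c := by simp only [l₁, l₂]; ring
  have hprod : l₁ * l₂ = -k := by simp only [l₁, l₂]; nlinarith
  have key : ∀ l m : ℝ, l + m = c → l * m = -k →
      AntitoneOn (fun x => (P₁ x - m * P x) * Real.exp (-(l * x))) D := by
    intro l m hs hp
    refine antitoneOn_mul_exp_of_deriv_le hD (q := fun x => P₂ x - m * P₁ x)
      (fun x hx => (h2 x hx).sub ((h1 x hx).const_mul m)) (fun x hx => ?_)
    have := hineq x hx
    have e : l * (P₁ x - m * P x) = l * P₁ x + k * P x := by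
      have : k = -(l * m) := by linarith
      rw [this]; ring
    rw [e, ← sub_nonpos]
    have : c = l + m := hs.symm
    subst this
    linarith
  intro x hx
  refine le_antisymm ?_ (hP x hx)
  rcases le_total x₀ x with hxx | hxx
  · have hsub : D ∩ Set.Ici x₀ ⊆ D := Set.inter_subset_left
    have hanti := antitoneOn_mul_exp_of_deriv_le (hD.inter (convex_Ici x₀)) (Q := P) (q := P₁)
      (l := l₂) (fun y hy => h1 y hy.1) (fun y hy => by
        have := key l₁ l₂ hsum hprod hx₀ hy.1 hy.2
        simp only [h0, hP1, mul_zero, sub_zero, zero_mul] at this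
        have := nonpos_of_mul_nonpos_left this (Real.exp_pos _)
        linarith)
    have := hanti ⟨hx₀, by simp⟩ ⟨hx, hxx⟩ hxx
    simp only [h0, zero_mul] at this
    exact nonpos_of_mul_nonpos_left this (Real.exp_pos _)
  · have hmono := monotoneOn_mul_exp_of_le_deriv (hD.inter (convex_Iic x₀)) (Q := P) (q := P₁)
      (l := l₁) (fun y hy => h1 y hy.1) (fun y hy => by
        have := key l₂ l₁ (by linarith) (by linarith) hy.1 hx₀ hy.2
        simp only [h0, hP1, mul_zero, sub_zero, zero_mul] at this
        have := nonneg_of_mul_nonneg_left this (Real.exp_pos _)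
        linarith)
    have := hmono ⟨hx, hxx⟩ ⟨hx₀, by simp⟩ hxx
    simp only [h0, zero_mul] at this
    exact nonpos_of_mul_nonpos_left this (Real.exp_pos _)

/-- A continuous function on a left half-line which is non-negative at the end and in the limit, and
negative somewhere, has an interior minimum with a negative value. -/
lemma exists_neg_isMinOn_Iic {f : ℝ → ℝ} {M x₀ : ℝ} (hf : ContinuousOn f (Set.Iic M))
    (hlim : Tendsto f atBot (𝓝 0)) (hM : 0 ≤ f M) (hx₀ : x₀ ≤ M) (hneg : f x₀ < 0) :
    ∃ x < M, f x < 0 ∧ ∀ y ≤ M, f x ≤ f y := by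
  obtain ⟨N, hN⟩ := eventually_atBot.1 (hlim.eventually (lt_mem_nhds hneg))
  have hne : (Set.Icc N M).Nonempty ∧ x₀ ∈ Set.Icc N M := by
    have : N ≤ x₀ := by
      by_contra h
      exact lt_irrefl _ (hN x₀ (not_le.1 h).le)
    exact ⟨⟨x₀, this, hx₀⟩, this, hx₀⟩
  obtain ⟨x, hx, hmin⟩ := isCompact_Icc.exists_isMinOn hne.1
    (hf.mono fun y hy => hy.2)
  have hx0 : f x ≤ f x₀ := hmin hne.2
  refine ⟨x, lt_of_le_of_ne hx.2 ?_, lt_of_le_of_lt hx0 hneg, fun y hy => ?_⟩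
  · rintro rfl; linarith
  · rcases le_total N y with h | h
    · exact hmin ⟨h, hy⟩
    · exact hx0.trans (hN y h).le

lemma exists_neg_isMinOn_Ici {f : ℝ → ℝ} {M x₀ : ℝ} (hf : ContinuousOn f (Set.Ici M))
    (hlim : Tendsto f atTop (𝓝 0)) (hM : 0 ≤ f M) (hx₀ : M ≤ x₀) (hneg : f x₀ < 0) :
    ∃ x, M < x ∧ f x < 0 ∧ ∀ y, M ≤ y → f x ≤ f y := by
  obtain ⟨x, h1, h2, h3⟩ := exists_neg_isMinOn_Iic (f := fun x => f (-x)) (M := -M) (x₀ := -x₀)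
    (hf.comp continuousOn_neg fun y hy => by simp only [Set.mem_Iic, Set.mem_Ici] at *; linarith)
    (hlim.comp tendsto_neg_atBot_atTop) (by simpa using hM) (by linarith) (by simpa using hneg)
  refine ⟨-x, by linarith, h2, fun y hy => ?_⟩
  simpa using h3 (-y) (by linarith)

/-- A function whose derivative stays above a positive constant on a left half-line is unbounded
below there. -/
lemma false_of_deriv_ge_atBot {f f' : ℝ → ℝ} {M ε B : ℝ} (hε : 0 < ε)
    (hf : ∀ x ≤ M, HasDerivAt f (f' x) x) (h : ∀ x ≤ M, ε ≤ f' x) (hB : ∀ x ≤ M, B ≤ f x) :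
    False := by
  have hm := monotoneOn_of_hasDerivAt_nonneg (convex_Iic M) (f := fun x => f x - ε * x)
    (f' := fun x => f' x - ε * 1) (fun x hx => (hf x hx).sub ((hasDerivAt_id x).const_mul ε))
    (fun x hx => by have := h x hx; linarith)
  set x := M - (|f M - B| + 1) / ε with hx
  have hpos : 0 < (|f M - B| + 1) / ε := by positivity
  have h1 := hm (a := x) (b := M) (by simp only [Set.mem_Iic]; linarith) (by simp) (by linarith)
  have h2 := hB x (by linarith)
  have h3 : ε * x = ε * M - (|f M - B| + 1) := by rw [hx]; field_simp
  have := le_abs_self (f M - B)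
  simp only at h1
  linarith

lemma false_of_deriv_ge_atTop {f f' : ℝ → ℝ} {M ε B : ℝ} (hε : 0 < ε)
    (hf : ∀ x, M ≤ x → HasDerivAt f (f' x) x) (h : ∀ x, M ≤ x → ε ≤ f' x)
    (hB : ∀ x, M ≤ x → f x ≤ B) : False := by
  refine false_of_deriv_ge_atBot (f := fun x => -f (-x)) (f' := fun x => f' (-x)) (M := -M)
    (B := -B) hε (fun x hx => ?_) (fun x hx => h _ (by linarith))
    (fun x hx => neg_le_neg (hB _ (by linarith)))
  exact ((hf (-x) (by linarith)).comp x (hasDerivAt_neg x)).neg.congr_deriv (by ring)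

end Calculus

/-- `(φ, ψ)` solves the profile equations `φ'' - c φ' + φ (1 - r - φ + r ψ(· - d)) = 0`,
`ψ'' - c ψ' + b φ (1 - ψ) = 0`, where `ψ = 1 - θ` and `d = c h`. -/
structure ProfileEq (r b c d : ℝ) (φ φ' ψ ψ' : ℝ → ℝ) : Prop where
  dφ : ∀ x, HasDerivAt φ (φ' x) x
  dφ' : ∀ x, HasDerivAt φ' (c * φ' x - φ x * (1 - r - φ x + r * ψ (x - d))) x
  dψ : ∀ x, HasDerivAt ψ (ψ' x) x
  dψ' : ∀ x, HasDerivAt ψ' (c * ψ' x - b * φ x * (1 - ψ x)) x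

/-- A positive monotone profile which connects `(0, 0)` with `(1, 1)`. -/
structure IsProfile (r b c d : ℝ) (φ φ' ψ ψ' : ℝ → ℝ) : Prop
    extends ProfileEq r b c d φ φ' ψ ψ' where
  pos_φ : ∀ x, 0 < φ x
  lt_ψ : ∀ x, ψ x < 1
  mono_φ : Monotone φ
  mono_ψ : Monotone ψ
  φ_bot : Tendsto φ atBot (𝓝 0)
  ψ_bot : Tendsto ψ atBot (𝓝 0)
  φ_top : Tendsto φ atTop (𝓝 1)
  ψ_top : Tendsto ψ atTop (𝓝 1)

/-! ### Reduction of the PDE for plane waves to the profile equations, and back. -/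

section PlaneWaves

variable {n : ℕ}

/-- The plane wave is a one-variable function composed with a linear functional; the second
derivatives along an orthonormal basis carry the factors ⟨ν, eᵢ⟩², whose sum is ‖ν‖² = 1. -/
lemma laplacian_planeWave {g g₁ g₂ : ℝ → ℝ} (hg : ContDiff ℝ 2 g)
    (h1 : ∀ s, HasDerivAt g (g₁ s) s) (h2 : ∀ s, HasDerivAt g₁ (g₂ s) s)
    {ν : EuclideanSpace ℝ (Fin n)} (hν : ‖ν‖ = 1) (a : ℝ) (x : EuclideanSpace ℝ (Fin n)) :
    Laplacian.laplacian (fun y => g (inner ℝ ν y + a)) x = g₂ (inner ℝ ν x + a) := by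
  have hG : ContDiff ℝ 2 (fun s => g (s + a)) := hg.comp (contDiff_id.add contDiff_const)
  have e : (fun y : EuclideanSpace ℝ (Fin n) => g (inner ℝ ν y + a)) =
      (fun s => g (s + a)) ∘ (innerSL ℝ ν) := by
    ext y; simp
  have d1 : deriv (fun s => g (s + a)) = fun s => g₁ (s + a) := by
    ext s; exact ((h1 (s + a)).comp_add_const s a).deriv
  have d2 : iteratedDeriv 2 (fun s => g (s + a)) = fun s => g₂ (s + a) := by
    rw [iteratedDeriv_succ, iteratedDeriv_one, d1]
    ext s; exact ((h2 (s + a)).comp_add_const s a).deriv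
  rw [InnerProductSpace.laplacian_eq_iteratedFDeriv_orthonormalBasis _
    (EuclideanSpace.basisFun (Fin n) ℝ), e]
  simp only [ContinuousLinearMap.iteratedFDeriv_comp_right (innerSL ℝ ν) hG x le_rfl,
    ContinuousMultilinearMap.compContinuousLinearMap_apply,
    iteratedFDeriv_apply_eq_iteratedDeriv_mul_prod, d2, Fin.prod_univ_two]
  rw [← Finset.sum_smul]
  have : ∑ i, (innerSL ℝ ν) (![EuclideanSpace.basisFun (Fin n) ℝ i,
      EuclideanSpace.basisFun (Fin n) ℝ i] 0) * (innerSL ℝ ν) (![EuclideanSpace.basisFun (Fin n) ℝ i,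
      EuclideanSpace.basisFun (Fin n) ℝ i] 1) = 1 := by
    have := (EuclideanSpace.basisFun (Fin n) ℝ).sum_sq_norm_inner_left ν
    rw [hν, one_pow] at this
    refine Eq.trans (Finset.sum_congr rfl fun i _ => ?_) this
    simp [sq]
  rw [this]
  simp

/-- On the line s ↦ (s - a) • ν the phase equals s, so restriction to it recovers g. -/
lemma contDiff_two_of_comp_inner {g : ℝ → ℝ} {ν : EuclideanSpace ℝ (Fin n)} (hν : ‖ν‖ = 1) {a : ℝ}
    (h : ContDiff ℝ 2 (fun x : EuclideanSpace ℝ (Fin n) => g (inner ℝ ν x + a))) :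
    ContDiff ℝ 2 g := by
  have : g = (fun x : EuclideanSpace ℝ (Fin n) => g (inner ℝ ν x + a)) ∘
      fun s : ℝ => (s - a) • ν := by
    ext s
    simp [inner_smul_right, hν]
  rw [this]
  exact h.comp ((contDiff_id.sub contDiff_const).smul contDiff_const)

lemma ContDiff.hasDerivAt_two {g : ℝ → ℝ} (hg : ContDiff ℝ 2 g) :
    (∀ s, HasDerivAt g (deriv g s) s) ∧ ∀ s, HasDerivAt (deriv g) (deriv (deriv g) s) s := by
  have h1 : ContDiff ℝ (1 + 1) g := by simpa [one_add_one_eq_two] using hg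
  refine ⟨fun s => (hg.differentiable (by norm_num) s).hasDerivAt, fun s => ?_⟩
  exact ((contDiff_succ_iff_deriv.1 h1).2.2.differentiable (by norm_num) s).hasDerivAt

/-- The equations are read off at time 0 and at the points s • ν; a time delay h shifts the phase by
c h. -/
lemma IsMonotoneWavefront.isProfile {r b h c : ℝ} {ν : EuclideanSpace ℝ (Fin n)} {φ θ : ℝ → ℝ}
    (H : IsMonotoneWavefront r b h ν c φ θ) :
    IsProfile r b c (c * h) φ (deriv φ) (fun x => 1 - θ x) (fun x => -deriv θ x) := by
  have hν := H.norm_direction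
  have cφ := contDiff_two_of_comp_inner hν (H.solution.contDiff_u 0)
  have cθ := contDiff_two_of_comp_inner hν (H.solution.contDiff_v 0)
  obtain ⟨φ1, φ2⟩ := cφ.hasDerivAt_two
  obtain ⟨θ1, θ2⟩ := cθ.hasDerivAt_two
  have hin : ∀ s : ℝ, inner ℝ ν (s • ν) = s := fun s => by simp [inner_smul_right, hν]
  have ht : ∀ (g : ℝ → ℝ) (g' : ℝ) (s : ℝ), HasDerivAt g g' s →
      deriv (fun t => g (s + c * t)) 0 = c * g' := by
    intro g g' s hg
    have h1 : HasDerivAt (fun t : ℝ => s + c * t) (c * 1) 0 :=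
      ((hasDerivAt_id (0 : ℝ)).const_mul c).const_add s
    have h2 : HasDerivAt g g' (s + c * 0) := by simpa using hg
    exact ((h2.comp (0 : ℝ) h1).deriv).trans (by ring)
  have equ : ∀ s, c * deriv φ s = deriv (deriv φ) s + φ s * (1 - φ s - r * θ (s - c * h)) := by
    intro s
    have := H.solution.eq_u 0 (s • ν)
    simp only [hin] at this
    rw [ht φ _ s (φ1 s), laplacian_planeWave cφ φ1 φ2 hν, hin] at this
    simpa [sub_eq_add_neg] using this
  have eqv : ∀ s, c * deriv θ s = deriv (deriv θ) s - b * φ s * θ s := by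
    intro s
    have := H.solution.eq_v 0 (s • ν)
    simp only [hin] at this
    rw [ht θ _ s (θ1 s), laplacian_planeWave cθ θ1 θ2 hν, hin] at this
    simpa using this
  refine ⟨⟨φ1, fun x => (φ2 x).congr_deriv ?_, fun x => (θ1 x).const_sub 1,
    fun x => (θ2 x).neg.congr_deriv ?_⟩, H.pos_φ, fun x => ?_, H.monotone_φ, fun x y hxy => ?_,
    H.tendsto_φ_atBot, ?_, H.tendsto_φ_atTop, ?_⟩
  · have := equ x; linarith
  · have := eqv x; linarith
  · have := H.pos_θ x; linarith
  · have := H.antitone_θ hxy; linarith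
  · simpa using H.tendsto_θ_atBot.const_sub 1
  · simpa using H.tendsto_θ_atTop.const_sub 1

lemma contDiff_two_of_hasDerivAt {g g₁ g₂ : ℝ → ℝ} (h1 : ∀ s, HasDerivAt g (g₁ s) s)
    (h2 : ∀ s, HasDerivAt g₁ (g₂ s) s) (h3 : Continuous g₂) : ContDiff ℝ 2 g := by
  have e1 : deriv g = g₁ := funext fun s => (h1 s).deriv
  have e2 : deriv g₁ = g₂ := funext fun s => (h2 s).deriv
  have c1 : ContDiff ℝ 1 g₁ :=
    contDiff_one_iff_deriv.2 ⟨fun s => (h2 s).differentiableAt, by rwa [e2]⟩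
  have : ContDiff ℝ (1 + 1) g :=
    contDiff_succ_iff_deriv.2 ⟨fun s => (h1 s).differentiableAt, by simp, by rwa [e1]⟩
  simpa [one_add_one_eq_two] using this

lemma IsProfile.isMonotoneWavefront {r b c : ℝ} {φ φ' ψ ψ' : ℝ → ℝ}
    (H : IsProfile r b c 0 φ φ' ψ ψ') {ν : EuclideanSpace ℝ (Fin n)} (hν : ‖ν‖ = 1) :
    IsMonotoneWavefront r b 0 ν c φ (fun x => 1 - ψ x) := by
  have hφ : Continuous φ := continuous_iff_continuousAt.2 fun x => (H.dφ x).continuousAt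
  have hφ' : Continuous φ' := continuous_iff_continuousAt.2 fun x => (H.dφ' x).continuousAt
  have hψ : Continuous ψ := continuous_iff_continuousAt.2 fun x => (H.dψ x).continuousAt
  have hψ' : Continuous ψ' := continuous_iff_continuousAt.2 fun x => (H.dψ' x).continuousAt
  have cφ : ContDiff ℝ 2 φ := contDiff_two_of_hasDerivAt H.dφ H.dφ' (by fun_prop)
  have dθ : ∀ x, HasDerivAt (fun x => 1 - ψ x) (-ψ' x) x := fun x => (H.dψ x).const_sub 1
  have dθ' : ∀ x, HasDerivAt (fun x => -ψ' x) (-(c * ψ' x - b * φ x * (1 - ψ x))) x :=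
    fun x => (H.dψ' x).neg
  have cθ : ContDiff ℝ 2 (fun x => 1 - ψ x) := contDiff_two_of_hasDerivAt dθ dθ' (by fun_prop)
  have hi : ∀ t : ℝ, ContDiff ℝ 2 fun x : EuclideanSpace ℝ (Fin n) => inner ℝ ν x + c * t :=
    fun t => (contDiff_const.inner ℝ contDiff_id).add contDiff_const
  have ht : ∀ a t : ℝ, HasDerivAt (fun t : ℝ => a + c * t) c t := fun a t => by
    simpa using ((hasDerivAt_id t).const_mul c).const_add a
  refine ⟨hν, ⟨fun t => cφ.comp (hi t), fun t => cθ.comp (hi t), ?_, ?_, ?_, ?_⟩, H.pos_φ,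
    fun s => sub_pos.2 (H.lt_ψ s), H.mono_φ, fun x y hxy => sub_le_sub_left (H.mono_ψ hxy) 1,
    H.φ_bot, by simpa using H.ψ_bot.const_sub 1, H.φ_top, by simpa using H.ψ_top.const_sub 1⟩
  · exact fun x t => ((H.dφ _).comp t (ht _ t)).differentiableAt
  · exact fun x t => ((dθ _).comp t (ht _ t)).differentiableAt
  · intro t x
    rw [laplacian_planeWave cφ H.dφ H.dφ' hν (c * t) x]
    refine ((H.dφ _).comp t (ht (inner ℝ ν x) t)).deriv.trans ?_
    simp only [sub_zero]
    ring
  · intro t x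
    rw [laplacian_planeWave cθ dθ dθ' hν (c * t) x]
    refine ((dθ _).comp t (ht (inner ℝ ν x) t)).deriv.trans ?_
    ring

end PlaneWaves

/-! ### Strict bounds, positivity of the speed and asymptotics of profiles. -/

section ProfileProperties

lemma Monotone.hasDerivAt_nonneg {f : ℝ → ℝ} (hf : Monotone f) {f' x : ℝ}
    (h : HasDerivAt f f' x) : 0 ≤ f' := by
  rw [← h.deriv]; exact hf.deriv_nonneg

variable {r b c d : ℝ} {φ φ' ψ ψ' : ℝ → ℝ}

namespace ProfileEq

lemma continuous_φ (H : ProfileEq r b c d φ φ' ψ ψ') : Continuous φ :=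
  continuous_iff_continuousAt.2 fun x => (H.dφ x).continuousAt

lemma continuous_ψ (H : ProfileEq r b c d φ φ' ψ ψ') : Continuous ψ :=
  continuous_iff_continuousAt.2 fun x => (H.dψ x).continuousAt

lemma comp_add_const (H : ProfileEq r b c d φ φ' ψ ψ') (s : ℝ) :
    ProfileEq r b c d (fun x => φ (x + s)) (fun x => φ' (x + s)) (fun x => ψ (x + s))
      (fun x => ψ' (x + s)) where
  dφ x := (H.dφ (x + s)).comp_add_const x s
  dφ' x := ((H.dφ' (x + s)).comp_add_const x s).congr_deriv (by
    rw [show x + s - d = x - d + s by ring])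
  dψ x := (H.dψ (x + s)).comp_add_const x s
  dψ' x := (H.dψ' (x + s)).comp_add_const x s

end ProfileEq

namespace IsProfile

lemma φ'_nonneg (H : IsProfile r b c d φ φ' ψ ψ') (x : ℝ) : 0 ≤ φ' x :=
  H.mono_φ.hasDerivAt_nonneg (H.dφ x)

lemma ψ'_nonneg (H : IsProfile r b c d φ φ' ψ ψ') (x : ℝ) : 0 ≤ ψ' x :=
  H.mono_ψ.hasDerivAt_nonneg (H.dψ x)

lemma φ_le (H : IsProfile r b c d φ φ' ψ ψ') (x : ℝ) : φ x ≤ 1 := H.mono_φ.ge_of_tendsto H.φ_top x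

lemma ψ_nonneg (H : IsProfile r b c d φ φ' ψ ψ') (x : ℝ) : 0 ≤ ψ x :=
  H.mono_ψ.le_of_tendsto H.ψ_bot x

/-- At a maximum with value 1 the equation would give φ'' = r (1 - ψ(x - d)) > 0. -/
lemma φ_lt (hr : 1 < r) (H : IsProfile r b c d φ φ' ψ ψ') (x : ℝ) : φ x < 1 := by
  refine lt_of_le_of_ne (H.φ_le x) fun h => ?_
  have hmin : IsLocalMin (fun y => -φ y) x :=
    Eventually.of_forall fun y => by simpa [h] using H.φ_le y
  obtain ⟨h1, h2⟩ := hmin.second_order (Eventually.of_forall fun y => (H.dφ y).neg) (H.dφ' x).neg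
  rw [h, neg_eq_zero.1 h1] at h2
  have := H.lt_ψ (x - d)
  nlinarith

/-- At a minimum with value 0 the equation would give ψ'' = -b φ < 0. -/
lemma ψ_pos (hb : 0 < b) (H : IsProfile r b c d φ φ' ψ ψ') (x : ℝ) : 0 < ψ x := by
  refine lt_of_le_of_ne (H.ψ_nonneg x) fun h => ?_
  have hmin : IsLocalMin ψ x := Eventually.of_forall fun y => by simpa [← h] using H.ψ_nonneg y
  obtain ⟨h1, h2⟩ := hmin.second_order (Eventually.of_forall fun y => H.dψ y) (H.dψ' x)
  rw [h1, ← h] at h2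
  have := mul_pos hb (H.pos_φ x)
  linarith

/-- For c ≤ 0 the function ψ is concave; being non-decreasing and bounded below on the line, it is
constant, whereas its source b φ (1 - ψ) is positive. -/
lemma speed_pos (hb : 0 < b) (H : IsProfile r b c d φ φ' ψ ψ') : 0 < c := by
  by_contra hc
  push Not at hc
  have hpos : ∀ x, 0 < b * φ x * (1 - ψ x) := fun x =>
    mul_pos (mul_pos hb (H.pos_φ x)) (sub_pos.2 (H.lt_ψ x))
  have hanti := antitoneOn_of_hasDerivAt_nonpos convex_univ (fun x _ => H.dψ' x) (fun x _ => by
    have h1 := H.ψ'_nonneg x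
    have := hpos x
    nlinarith)
  have hz : ∀ x, ψ' x = 0 := by
    intro x
    by_contra hne
    have hx : 0 < ψ' x := lt_of_le_of_ne (H.ψ'_nonneg x) (Ne.symm hne)
    exact false_of_deriv_ge_atBot hx (fun y _ => H.dψ y)
      (fun y hy => hanti (Set.mem_univ y) (Set.mem_univ x) hy) (fun y _ => H.ψ_nonneg y)
  have h0 : HasDerivAt ψ' 0 0 := by
    have : ψ' = fun _ => 0 := funext hz
    rw [this]; exact hasDerivAt_const _ _
  have := (H.dψ' 0).unique h0
  rw [hz] at this
  have := hpos 0
  linarith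

lemma hasDerivAt_flux (H : IsProfile r b c d φ φ' ψ ψ') (x : ℝ) :
    HasDerivAt (fun x => ψ' x - c * ψ x) (-(b * φ x * (1 - ψ x))) x :=
  ((H.dψ' x).sub ((H.dψ x).const_mul c)).congr_deriv (by ring)

lemma antitone_flux (hb : 0 < b) (H : IsProfile r b c d φ φ' ψ ψ') :
    Antitone (fun x => ψ' x - c * ψ x) := by
  rw [← antitoneOn_univ]
  refine antitoneOn_of_hasDerivAt_nonpos convex_univ (fun x _ => H.hasDerivAt_flux x) fun x _ => ?_
  have := mul_pos (mul_pos hb (H.pos_φ x)) (sub_pos.2 (H.lt_ψ x))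
  linarith

/-- A positive value of the non-increasing flux would bound ψ' away from 0 on a whole left
half-line, against ψ ≥ 0. -/
lemma flux_nonpos (hb : 0 < b) (H : IsProfile r b c d φ φ' ψ ψ') (x : ℝ) :
    ψ' x - c * ψ x ≤ 0 := by
  by_contra h
  push Not at h
  refine false_of_deriv_ge_atBot h (fun y _ => H.dψ y) (M := x) (fun y hy => ?_)
    (fun y _ => H.ψ_nonneg y)
  have := H.antitone_flux hb hy
  have h2 := mul_nonneg (H.speed_pos hb).le (H.ψ_nonneg y)
  simp only at this
  linarith

/-- The limit exists by monotonicity and is also the limit of ψ', because ψ → 0; hence it is both ≤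
0 and ≥ 0. -/
lemma tendsto_flux (hb : 0 < b) (H : IsProfile r b c d φ φ' ψ ψ') :
    Tendsto (fun x => ψ' x - c * ψ x) atBot (𝓝 0) := by
  have hl := tendsto_atBot_ciSup (H.antitone_flux hb)
    ⟨0, by rintro _ ⟨x, rfl⟩; exact H.flux_nonpos hb x⟩
  set L := ⨆ x, (ψ' x - c * ψ x)
  have hL0 : L ≤ 0 := ciSup_le fun x => H.flux_nonpos hb x
  have h2 : Tendsto ψ' atBot (𝓝 (L + c * 0)) := by
    refine (hl.add (H.ψ_bot.const_mul c)).congr fun x => by ring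
  have : 0 ≤ L + c * 0 := ge_of_tendsto' h2 H.ψ'_nonneg
  have : L = 0 := by linarith
  rwa [this] at hl

lemma tendsto_ψ' (hb : 0 < b) (H : IsProfile r b c d φ φ' ψ ψ') : Tendsto ψ' atBot (𝓝 0) := by
  have := (H.tendsto_flux hb).add (H.ψ_bot.const_mul c)
  simp only [mul_zero, add_zero] at this
  exact this.congr fun x => by ring

lemma antitone_ψ_mul_exp (hb : 0 < b) (H : IsProfile r b c d φ φ' ψ ψ') :
    Antitone (fun x => ψ x * Real.exp (-(c * x))) := by
  rw [← antitoneOn_univ]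
  refine antitoneOn_mul_exp_of_deriv_le convex_univ (fun x _ => H.dψ x) fun x _ => ?_
  have := H.flux_nonpos hb x
  linarith

/-- The component `φ` decays at `-∞` faster than `e^{c x}`. -/
lemma exists_φ_le_exp (hr : 1 < r) (hb : 0 < b) (H : IsProfile r b c d φ φ' ψ ψ') :
    ∃ l C, c < l ∧ 0 < C ∧ ∀ x, φ x ≤ C * Real.exp (l * x) := by
  have hc := H.speed_pos hb
  have hψ : ∀ᶠ x in atBot, ψ (x - d) < (r - 1) / (2 * r) :=
    (H.ψ_bot.comp (tendsto_atBot_add_const_right _ (-d) tendsto_id)).eventually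
      (gt_mem_nhds (by apply div_pos <;> linarith))
  obtain ⟨M, hM⟩ := eventually_atBot.1 hψ
  -- To the left of M the delayed ψ is so small that φ'' - c φ' ≥ k φ. With l and -m the roots of λ²
  -- - c λ - k, this says (φ' + m φ)' ≥ l (φ' + m φ); and l > c because k > 0.
  set k := (r - 1) / 2 with hk
  have hk0 : 0 < k := by simp only [k]; linarith
  set w := Real.sqrt (c ^ 2 + 4 * k)
  have hw2 : w ^ 2 = c ^ 2 + 4 * k := Real.sq_sqrt (by positivity)
  have hw0 : 0 ≤ w := Real.sqrt_nonneg _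
  have hwc : c < w := by nlinarith
  set l := (c + w) / 2
  set m := (w - c) / 2
  have hm : 0 < m := by simp only [m]; linarith
  have hl : c < l := by simp only [l]; linarith
  have hlm : l * m = k := by simp only [l, m]; nlinarith
  have hlc : l - m = c := by simp only [l, m]; ring
  have hmono := monotoneOn_mul_exp_of_le_deriv (convex_Iic M) (Q := fun x => φ' x + m * φ x)
    (l := l) (fun x _ => (H.dφ' x).add ((H.dφ x).const_mul m)) (fun x hx => by
      have h1 := hM x hx
      have h2 : r * ψ (x - d) ≤ k := by
        have : r * ((r - 1) / (2 * r)) = k := by rw [hk]; field_simp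
        rw [← this]
        exact mul_le_mul_of_nonneg_left h1.le (by linarith)
      have h3 := H.pos_φ x
      have h4 : k * φ x ≤ -(φ x * (1 - r - φ x + r * ψ (x - d))) := by
        have : r - 1 = 2 * k := by rw [hk]; ring
        nlinarith
      have e : l * (φ' x + m * φ x) = l * φ' x + k * φ x := by rw [← hlm]; ring
      rw [e, ← hlc]
      linarith)
  set C := (φ' M + m * φ M) * Real.exp (-(l * M)) / m
  have hC0 : 0 < C := by
    have := H.φ'_nonneg M
    have := H.pos_φ M
    positivity
  have h1 : ∀ x ≤ M, φ x ≤ C * Real.exp (l * x) := by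
    intro x hx
    have h := hmono (a := x) hx (by simp : M ∈ Set.Iic M) hx
    simp only at h
    have h2 : m * φ x * Real.exp (-(l * x)) ≤ m * C := by
      refine le_trans ?_ (h.trans (le_of_eq ?_))
      · exact mul_le_mul_of_nonneg_right (by linarith [H.φ'_nonneg x]) (Real.exp_pos _).le
      · simp only [C]; field_simp
    rw [Real.exp_neg] at h2
    have h3 := Real.exp_pos (l * x)
    rw [mul_assoc] at h2
    have h4 := le_of_mul_le_mul_left h2 hm
    rwa [← div_eq_mul_inv, div_le_iff₀ h3] at h4
  refine ⟨l, max C (Real.exp (-(l * M))), hl, lt_max_of_lt_left hC0, fun x => ?_⟩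
  rcases le_total x M with hx | hx
  · exact (h1 x hx).trans (mul_le_mul_of_nonneg_right (le_max_left _ _) (Real.exp_pos _).le)
  · calc φ x ≤ 1 := H.φ_le x
      _ ≤ Real.exp (-(l * M)) * Real.exp (l * x) := by
        rw [← Real.exp_add]
        apply Real.one_le_exp
        have : 0 < l := hc.trans hl
        nlinarith
      _ ≤ _ := mul_le_mul_of_nonneg_right (le_max_right _ _) (Real.exp_pos _).le

/-- Exact asymptotics of `ψ` at `-∞`. -/
lemma exists_tendsto_ψ_mul_exp (hr : 1 < r) (hb : 0 < b) (H : IsProfile r b c d φ φ' ψ ψ') :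
    ∃ A, 0 < A ∧ Tendsto (fun x => ψ x * Real.exp (-(c * x))) atBot (𝓝 A) ∧
      ∀ x, ψ x ≤ A * Real.exp (c * x) := by
  obtain ⟨l, C, hl, hC, hφ⟩ := H.exists_φ_le_exp hr hb
  have hc := H.speed_pos hb
  have hl0 : 0 < l := hc.trans hl
  have dexp : ∀ a x : ℝ, HasDerivAt (fun x : ℝ => Real.exp (a * x)) (a * Real.exp (a * x)) x :=
    fun a x => (((hasDerivAt_id x).const_mul a).exp).congr_deriv (by simp; ring)
  have hexp0 : ∀ a : ℝ, 0 < a → Tendsto (fun x : ℝ => Real.exp (a * x)) atBot (𝓝 0) := fun a ha =>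
    Real.tendsto_exp_atBot.comp ((tendsto_const_mul_atBot_of_pos ha).2 tendsto_id)
  -- Integrated from -∞, where the flux vanishes, with the source bounded by b φ ≤ b C e^{lx}.
  have hflux : ∀ x, -(b * C / l * Real.exp (l * x)) ≤ ψ' x - c * ψ x := by
    intro x
    have hmono : Monotone fun x => (ψ' x - c * ψ x) + b * C / l * Real.exp (l * x) := by
      rw [← monotoneOn_univ]
      refine monotoneOn_of_hasDerivAt_nonneg convex_univ
        (fun x _ => (H.hasDerivAt_flux x).add ((dexp l x).const_mul _)) fun x _ => ?_
      have h1 : b * C / l * (l * Real.exp (l * x)) = b * (C * Real.exp (l * x)) := by field_simp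
      rw [h1]
      have h2 : b * φ x * (1 - ψ x) ≤ b * φ x := by
        have := mul_nonneg (mul_pos hb (H.pos_φ x)).le (H.ψ_nonneg x)
        linarith
      have := mul_le_mul_of_nonneg_left (hφ x) hb.le
      linarith
    have hlim : Tendsto (fun x => (ψ' x - c * ψ x) + b * C / l * Real.exp (l * x)) atBot (𝓝 0) := by
      simpa using (H.tendsto_flux hb).add ((hexp0 l hl0).const_mul (b * C / l))
    have := hmono.le_of_tendsto hlim x
    linarith
  -- K is the constant for which the correction K e^{(l-c)x} turns ψ e^{-cx} into a non-decreasing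
  -- function. The correction is bounded on the left because l > c, so the non-increasing ψ e^{-cx}
  -- is bounded and has a finite positive limit.
  set K := b * C / l / (l - c) with hK
  have hlc : 0 < l - c := by linarith
  have hmono : Monotone fun x => ψ x * Real.exp (-(c * x)) + K * Real.exp ((l - c) * x) := by
    rw [← monotoneOn_univ]
    have dz : ∀ x, HasDerivAt (fun x => ψ x * Real.exp (-(c * x)))
        ((ψ' x - c * ψ x) * Real.exp (-(c * x))) x := fun x => by
      have h1 : HasDerivAt (fun x : ℝ => -(c * x)) (-(c * 1)) x :=
        ((hasDerivAt_id x).const_mul c).neg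
      exact ((H.dψ x).mul h1.exp).congr_deriv (by ring)
    refine monotoneOn_of_hasDerivAt_nonneg convex_univ
      (fun x _ => (dz x).add ((dexp (l - c) x).const_mul _)) fun x _ => ?_
    have h1 : K * ((l - c) * Real.exp ((l - c) * x)) =
        b * C / l * Real.exp (l * x) * Real.exp (-(c * x)) := by
      rw [mul_assoc (b * C / l), ← Real.exp_add, show l * x + -(c * x) = (l - c) * x by ring, hK]
      field_simp
    rw [h1, ← add_mul]
    exact mul_nonneg (by linarith [hflux x]) (Real.exp_pos _).le
  have hbdd : BddAbove (Set.range fun x => ψ x * Real.exp (-(c * x))) := by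
    refine ⟨ψ 0 + K, ?_⟩
    rintro _ ⟨x, rfl⟩
    have hKpos : 0 ≤ K * Real.exp ((l - c) * x) := by positivity
    rcases le_total x 0 with hx | hx
    · have := hmono hx
      simp at this
      linarith
    · have := H.antitone_ψ_mul_exp hb hx
      simp at this
      have : 0 ≤ K := by positivity
      linarith
  have hlim := tendsto_atBot_ciSup (H.antitone_ψ_mul_exp hb) hbdd
  have hle : ∀ x, ψ x * Real.exp (-(c * x)) ≤ ⨆ x, ψ x * Real.exp (-(c * x)) := le_ciSup hbdd
  refine ⟨_, lt_of_lt_of_le ?_ (hle 0), hlim, fun x => ?_⟩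
  · simpa using H.ψ_pos hb 0
  · have := hle x
    rwa [Real.exp_neg, ← div_eq_mul_inv, div_le_iff₀ (Real.exp_pos _)] at this

/-- The component `θ = 1 - ψ` decays at most exponentially at `+∞`. -/
lemma exists_exp_le_one_sub_ψ (hb : 0 < b) (H : IsProfile r b c d φ φ' ψ ψ') :
    ∃ m C, 0 < C ∧ ∀ x, 0 ≤ x → C * Real.exp (-(m * x)) ≤ 1 - ψ x := by
  have hc := H.speed_pos hb
  set w := Real.sqrt (c ^ 2 + 4 * b)
  have hw2 : w ^ 2 = c ^ 2 + 4 * b := Real.sq_sqrt (by positivity)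
  have hw0 : 0 ≤ w := Real.sqrt_nonneg _
  set l := (c + w) / 2
  set m := (w - c) / 2
  have hl : 0 < l := by simp only [l]; linarith
  have hlm : l * m = b := by simp only [l, m]; nlinarith
  have hlc : l - m = c := by simp only [l, m]; ring
  -- For θ = 1 - ψ one has θ'' - c θ' ≤ b θ, as φ ≤ 1. The numbers l and -m are the roots of λ² - c
  -- λ - b, whence (θ' + m θ)' ≤ l (θ' + m θ).
  have hanti := antitoneOn_mul_exp_of_deriv_le convex_univ
    (Q := fun x => -ψ' x + m * (1 - ψ x)) (l := l)
    (fun x _ => (H.dψ' x).neg.add (((H.dψ x).const_sub 1).const_mul m)) (fun x _ => by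
      have h1 : b * φ x * (1 - ψ x) ≤ b * (1 - ψ x) := by
        have := mul_nonneg (mul_nonneg hb.le (sub_nonneg.2 (H.lt_ψ x).le))
          (sub_nonneg.2 (H.φ_le x))
        nlinarith
      have e : l * (-ψ' x + m * (1 - ψ x)) = -(l * ψ' x) + b * (1 - ψ x) := by rw [← hlm]; ring
      rw [e, ← hlc]
      linarith)
  -- A negative value -q would persist to the right of x₀, and then ψ' ≥ q there, so that ψ could
  -- not stay below 1.
  have hQ : ∀ x, 0 ≤ -ψ' x + m * (1 - ψ x) := by
    intro x₀
    by_contra hneg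
    push Not at hneg
    set q := -(-ψ' x₀ + m * (1 - ψ x₀)) with hq
    have hq0 : 0 < q := by linarith
    refine false_of_deriv_ge_atTop (f := ψ) (M := x₀) hq0 (fun x _ => H.dψ x) (fun x hx => ?_)
      (fun x _ => (H.lt_ψ x).le)
    have h1 := hanti (Set.mem_univ x₀) (Set.mem_univ x) hx
    simp only at h1
    have h2 : (-ψ' x + m * (1 - ψ x)) ≤ -q := by
      by_contra h
      push Not at h
      have e1 : Real.exp (-(l * x)) ≤ Real.exp (-(l * x₀)) := by
        apply Real.exp_le_exp.2
        nlinarith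
      have e2 := Real.exp_pos (-(l * x))
      have : -q * Real.exp (-(l * x)) < -q * Real.exp (-(l * x₀)) := by
        calc _ < (-ψ' x + m * (1 - ψ x)) * Real.exp (-(l * x)) := mul_lt_mul_of_pos_right h e2
          _ ≤ _ := by rw [hq]; simpa using h1
      nlinarith
    have h3 : 0 ≤ m * (1 - ψ x) :=
      mul_nonneg (by simp only [m]; nlinarith) (sub_nonneg.2 (H.lt_ψ x).le)
    linarith
  have hmono := monotoneOn_mul_exp_of_le_deriv convex_univ (Q := fun x => 1 - ψ x) (l := -m)
    (fun x _ => (H.dψ x).const_sub 1) (fun x _ => by have := hQ x; linarith)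
  refine ⟨m, 1 - ψ 0, sub_pos.2 (H.lt_ψ 0), fun x hx => ?_⟩
  have := hmono (Set.mem_univ 0) (Set.mem_univ x) hx
  simp at this
  rw [Real.exp_neg, ← div_eq_mul_inv, div_le_iff₀ (Real.exp_pos _)]
  linarith

end IsProfile

end ProfileProperties

/-! ### Comparison of a profile with a sub-solution by sliding. -/

section Sliding

variable {r b c d : ℝ} {φ φ' ψ ψ' : ℝ → ℝ}

lemma IsProfile.comp_add_const (H : IsProfile r b c d φ φ' ψ ψ') (s : ℝ) :
    IsProfile r b c d (fun x => φ (x + s)) (fun x => φ' (x + s)) (fun x => ψ (x + s))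
      (fun x => ψ' (x + s)) where
  toProfileEq := H.toProfileEq.comp_add_const s
  pos_φ x := H.pos_φ _
  lt_ψ x := H.lt_ψ _
  mono_φ x y h := H.mono_φ (by linarith)
  mono_ψ x y h := H.mono_ψ (by linarith)
  φ_bot := H.φ_bot.comp (tendsto_atBot_add_const_right _ s tendsto_id)
  ψ_bot := H.ψ_bot.comp (tendsto_atBot_add_const_right _ s tendsto_id)
  φ_top := H.φ_top.comp (tendsto_atTop_add_const_right _ s tendsto_id)
  ψ_top := H.ψ_top.comp (tendsto_atTop_add_const_right _ s tendsto_id)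

/-- A monotone sub-solution of the profile equations which connects `(0, 0)` with `(1, 1)`, together
with its decay at `-∞`. -/
structure IsSubprofile (r b c d : ℝ) (φ φ' φ'' ψ ψ' ψ'' : ℝ → ℝ) : Prop where
  dφ : ∀ x, HasDerivAt φ (φ' x) x
  dφ' : ∀ x, HasDerivAt φ' (φ'' x) x
  dψ : ∀ x, HasDerivAt ψ (ψ' x) x
  dψ' : ∀ x, HasDerivAt ψ' (ψ'' x) x
  le_φ'' : ∀ x, c * φ' x - φ x * (1 - r - φ x + r * ψ (x - d)) ≤ φ'' x
  le_ψ'' : ∀ x, c * ψ' x - b * φ x * (1 - ψ x) ≤ ψ'' x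
  pos_φ : ∀ x, 0 < φ x
  lt_φ : ∀ x, φ x < 1
  lt_ψ : ∀ x, ψ x < 1
  mono_φ : Monotone φ
  mono_ψ : Monotone ψ
  φ_bot : Tendsto φ atBot (𝓝 0)
  ψ_bot : Tendsto ψ atBot (𝓝 0)
  φ_top : Tendsto φ atTop (𝓝 1)
  ψ_top : Tendsto ψ atTop (𝓝 1)
  ψ'_bot : Tendsto ψ' atBot (𝓝 0)
  φ_decay : ∃ l C, c < l ∧ 0 < C ∧ ∀ x, φ x ≤ C * Real.exp (l * x)
  ψ_decay : ∃ B, 0 < B ∧ ∀ x, ψ x ≤ B * Real.exp (c * x)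
  -- The value A = 0 occurs when the sub-solution is a profile of a strictly larger speed.
  ψ_asymp : ∃ A, 0 ≤ A ∧ Tendsto (fun x => ψ x * Real.exp (-(c * x))) atBot (𝓝 A)

variable {φ₁ φ₁' ψ₁ ψ₁' φ₂ φ₂' φ₂'' ψ₂ ψ₂' ψ₂'' : ℝ → ℝ}

namespace IsSubprofile

lemma continuous_φ (W : IsSubprofile r b c d φ₂ φ₂' φ₂'' ψ₂ ψ₂' ψ₂'') : Continuous φ₂ :=
  continuous_iff_continuousAt.2 fun x => (W.dφ x).continuousAt

lemma continuous_ψ (W : IsSubprofile r b c d φ₂ φ₂' φ₂'' ψ₂ ψ₂' ψ₂'') : Continuous ψ₂ :=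
  continuous_iff_continuousAt.2 fun x => (W.dψ x).continuousAt

/-- The first equation for the difference of a solution and a sub-solution. -/
lemma diff_φ (W : IsSubprofile r b c d φ₂ φ₂' φ₂'' ψ₂ ψ₂' ψ₂'') (φ₁ φ₁' ψ₁ : ℝ → ℝ) (x : ℝ) :
    (c * φ₁' x - φ₁ x * (1 - r - φ₁ x + r * ψ₁ (x - d)) - φ₂'' x) - c * (φ₁' x - φ₂' x)
      + (φ₁ x - φ₂ x) * (1 - r - φ₁ x - φ₂ x + r * ψ₁ (x - d))
      + r * φ₂ x * (ψ₁ (x - d) - ψ₂ (x - d)) ≤ 0 := by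
  have := W.le_φ'' x
  nlinarith

/-- The second equation for the difference of a solution and a sub-solution. -/
lemma diff_ψ (W : IsSubprofile r b c d φ₂ φ₂' φ₂'' ψ₂ ψ₂' ψ₂'') (φ₁ ψ₁ ψ₁' : ℝ → ℝ) (x : ℝ) :
    (c * ψ₁' x - b * φ₁ x * (1 - ψ₁ x) - ψ₂'' x) - c * (ψ₁' x - ψ₂' x)
      + b * (φ₁ x - φ₂ x) * (1 - ψ₁ x) - b * φ₂ x * (ψ₁ x - ψ₂ x) ≤ 0 := by
  have := W.le_ψ'' x
  nlinarith

/-- If an ordered pair of a solution and a sub-solution touches somewhere, it coincides. -/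
lemma eq_of_touch (hr : 1 < r) (hb : 0 < b) (H : IsProfile r b c d φ₁ φ₁' ψ₁ ψ₁')
    (W : IsSubprofile r b c d φ₂ φ₂' φ₂'' ψ₂ ψ₂' ψ₂'') (hφ : ∀ x, φ₂ x ≤ φ₁ x)
    (hψ : ∀ x, ψ₂ x ≤ ψ₁ x) {x₀ : ℝ} (h0 : φ₁ x₀ = φ₂ x₀ ∨ ψ₁ x₀ = ψ₂ x₀) (x : ℝ) :
    φ₂ x = φ₁ x ∧ ψ₂ x = ψ₁ x := by
  have derivs_zero : ∀ {f f' f'' : ℝ → ℝ}, (∀ x, HasDerivAt f (f' x) x) →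
      (∀ x, HasDerivAt f' (f'' x) x) → (∀ x, f x = 0) → ∀ x, f' x = 0 ∧ f'' x = 0 := by
    intro f f' f'' h1 h2 hf
    have e : f = fun _ => 0 := funext hf
    have e1 : f' = fun _ => 0 := by
      ext y
      have := h1 y
      rw [e] at this
      exact this.unique (hasDerivAt_const y 0)
    intro y
    refine ⟨by rw [e1], ?_⟩
    have := h2 y
    rw [e1] at this
    exact this.unique (hasDerivAt_const y 0)
  have dP : ∀ x, HasDerivAt (fun x => φ₁ x - φ₂ x) (φ₁' x - φ₂' x) x :=
    fun x => (H.dφ x).sub (W.dφ x)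
  have dP' : ∀ x, HasDerivAt (fun x => φ₁' x - φ₂' x)
      (c * φ₁' x - φ₁ x * (1 - r - φ₁ x + r * ψ₁ (x - d)) - φ₂'' x) x :=
    fun x => (H.dφ' x).sub (W.dφ' x)
  have dQ : ∀ x, HasDerivAt (fun x => ψ₁ x - ψ₂ x) (ψ₁' x - ψ₂' x) x :=
    fun x => (H.dψ x).sub (W.dψ x)
  have dQ' : ∀ x, HasDerivAt (fun x => ψ₁' x - ψ₂' x)
      (c * ψ₁' x - b * φ₁ x * (1 - ψ₁ x) - ψ₂'' x) x := fun x => (H.dψ' x).sub (W.dψ' x)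
  have hψ0 := H.ψ_nonneg
  rcases h0 with h0 | h0
  · have hz := eqOn_zero_of_nonneg_of_touch isOpen_univ convex_univ (c := c) (k := r + 1)
      (by linarith) (fun x _ => dP x) (fun x _ => dP' x) (fun x _ => sub_nonneg.2 (hφ x))
      (fun x _ => by
        have h1 := W.diff_φ φ₁ φ₁' ψ₁ x
        have h2 := mul_nonneg (mul_nonneg (by linarith : (0 : ℝ) ≤ r) (W.pos_φ x).le)
          (sub_nonneg.2 (hψ (x - d)))
        have h3 : 0 ≤ (φ₁ x - φ₂ x) * (1 - r - φ₁ x - φ₂ x + r * ψ₁ (x - d) + (r + 1)) := by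
          refine mul_nonneg (sub_nonneg.2 (hφ x)) ?_
          have := mul_nonneg (by linarith : (0 : ℝ) ≤ r) (hψ0 (x - d))
          linarith [H.φ_le x, W.lt_φ x]
        linarith) (Set.mem_univ x₀) (sub_eq_zero.2 h0)
    have hP : ∀ x, φ₁ x - φ₂ x = 0 := fun x => hz x trivial
    -- Once the first components agree, only the coupling term remains in their equation; at x + d
    -- its delayed argument is x.
    have hQ : ∀ x, ψ₁ x - ψ₂ x = 0 := fun x => by
      have h1 := W.diff_φ φ₁ φ₁' ψ₁ (x + d)
      obtain ⟨h2, h3⟩ := derivs_zero dP dP' hP (x + d)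
      rw [h2, h3, hP] at h1
      simp only [add_sub_cancel_right] at h1
      have h4 : 0 < r * φ₂ (x + d) := mul_pos (by linarith) (W.pos_φ _)
      have h5 := sub_nonneg.2 (hψ x)
      nlinarith
    exact ⟨by linarith [hP x], by linarith [hQ x]⟩
  · have hz := eqOn_zero_of_nonneg_of_touch isOpen_univ convex_univ (c := c) (k := b)
      hb.le (fun x _ => dQ x) (fun x _ => dQ' x) (fun x _ => sub_nonneg.2 (hψ x))
      (fun x _ => by
        have h1 := W.diff_ψ φ₁ ψ₁ ψ₁' x
        have h2 : 0 ≤ b * (φ₁ x - φ₂ x) * (1 - ψ₁ x) :=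
          mul_nonneg (mul_nonneg hb.le (sub_nonneg.2 (hφ x))) (sub_nonneg.2 (H.lt_ψ x).le)
        have h3 : 0 ≤ b * (1 - φ₂ x) * (ψ₁ x - ψ₂ x) :=
          mul_nonneg (mul_nonneg hb.le (sub_nonneg.2 (W.lt_φ x).le)) (sub_nonneg.2 (hψ x))
        linarith) (Set.mem_univ x₀) (sub_eq_zero.2 h0)
    have hQ : ∀ x, ψ₁ x - ψ₂ x = 0 := fun x => hz x trivial
    have hP : φ₁ x - φ₂ x = 0 := by
      have h1 := W.diff_ψ φ₁ ψ₁ ψ₁' x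
      obtain ⟨h2, h3⟩ := derivs_zero dQ dQ' hQ x
      rw [h2, h3, hQ] at h1
      have h4 : 0 < b * (1 - ψ₁ x) := mul_pos hb (sub_pos.2 (H.lt_ψ x))
      have h5 := sub_nonneg.2 (hφ x)
      nlinarith
    exact ⟨by linarith, by linarith [hQ x]⟩

/-- The order of a solution and a sub-solution on a bounded interval, and of their second components
to the left of it, extends to the whole line. -/
lemma le_of_le_middle (hr : 1 < r) (hb : 0 < b) (H : IsProfile r b c d φ₁ φ₁' ψ₁ ψ₁')
    (W : IsSubprofile r b c d φ₂ φ₂' φ₂'' ψ₂ ψ₂' ψ₂'') (hd : 0 ≤ d) {M M' : ℝ} (hMM : M ≤ M')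
    (hM : r * ψ₂ M < r - 1) (hQ : ∀ x ≤ M, ψ₂ x ≤ ψ₁ x)
    (hmid : ∀ x ∈ Set.Icc M M', φ₂ x ≤ φ₁ x ∧ ψ₂ x ≤ ψ₁ x)
    (h₂ : 7 / 8 ≤ φ₂ M') (h₁ : 7 / 8 ≤ φ₁ M') (h₃ : 4 * r * (1 - ψ₁ M') ≤ 1) (x : ℝ) :
    φ₂ x ≤ φ₁ x ∧ ψ₂ x ≤ ψ₁ x := by
  have hr0 : 0 < r := by linarith
  have dP : ∀ x, HasDerivAt (fun x => φ₁ x - φ₂ x) (φ₁' x - φ₂' x) x :=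
    fun x => (H.dφ x).sub (W.dφ x)
  have dP' : ∀ x, HasDerivAt (fun x => φ₁' x - φ₂' x)
      (c * φ₁' x - φ₁ x * (1 - r - φ₁ x + r * ψ₁ (x - d)) - φ₂'' x) x :=
    fun x => (H.dφ' x).sub (W.dφ' x)
  have dQ : ∀ x, HasDerivAt (fun x => ψ₁ x - ψ₂ x) (ψ₁' x - ψ₂' x) x :=
    fun x => (H.dψ x).sub (W.dψ x)
  have dQ' : ∀ x, HasDerivAt (fun x => ψ₁' x - ψ₂' x)
      (c * ψ₁' x - b * φ₁ x * (1 - ψ₁ x) - ψ₂'' x) x := fun x => (H.dψ' x).sub (W.dψ' x)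
  have cP : Continuous fun x => φ₁ x - φ₂ x := H.continuous_φ.sub W.continuous_φ
  have cQ : Continuous fun x => ψ₁ x - ψ₂ x := H.continuous_ψ.sub W.continuous_ψ
  -- At a negative minimum z of φ₁ - φ₂ the zero-order coefficient is negative because r ψ₂ < r - 1
  -- to the left of M; the coupling has a good sign because z - d ≤ M, which is where d ≥ 0 enters.
  have hleft : ∀ x ≤ M, φ₂ x ≤ φ₁ x := by
    intro y hy
    by_contra hneg
    push Not at hneg
    obtain ⟨z, hz, hzneg, hzmin⟩ := exists_neg_isMinOn_Iic cP.continuousOn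
      (by simpa using H.φ_bot.sub W.φ_bot) (sub_nonneg.2 (hmid M ⟨le_rfl, hMM⟩).1) hy
      (sub_neg.2 hneg)
    have hloc : IsLocalMin (fun x => φ₁ x - φ₂ x) z := by
      filter_upwards [Iio_mem_nhds hz] with w hw using hzmin w (le_of_lt hw)
    obtain ⟨e1, e2⟩ := hloc.second_order (Eventually.of_forall dP) (dP' z)
    have h1 := W.diff_φ φ₁ φ₁' ψ₁ z
    rw [e1] at h1
    have h2 : r * ψ₂ (z - d) < r - 1 :=
      lt_of_le_of_lt (mul_le_mul_of_nonneg_left (W.mono_ψ (by linarith)) hr0.le) hM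
    have h3 : 0 ≤ r * φ₁ z * (ψ₁ (z - d) - ψ₂ (z - d)) :=
      mul_nonneg (mul_nonneg hr0.le (H.pos_φ z).le) (sub_nonneg.2 (hQ _ (by linarith)))
    have h4 : 0 < (φ₁ z - φ₂ z) * (1 - r - φ₁ z - φ₂ z + r * ψ₂ (z - d)) :=
      mul_pos_of_neg_of_neg hzneg (by linarith [H.pos_φ z, W.pos_φ z])
    nlinarith
  -- The weight 2r makes the linearisation near (1, 1) diagonally dominant. If the first entry
  -- attains the minimum, the coupling costs at most φ₂/2, and φ₁ + φ₂/2 ≥ 21/16 > 1; if the second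
  -- does, it costs 2r(1 - ψ₁) ≤ 1/2 < φ₂.
  have hright : ∀ x, M' ≤ x → 0 ≤ min (φ₁ x - φ₂ x) (2 * r * (ψ₁ x - ψ₂ x)) := by
    intro y hy
    by_contra hneg
    push Not at hneg
    have hM'm := hmid M' ⟨hMM, le_rfl⟩
    obtain ⟨z, hz, hzneg, hzmin⟩ := exists_neg_isMinOn_Ici
      (f := fun x => min (φ₁ x - φ₂ x) (2 * r * (ψ₁ x - ψ₂ x)))
      (cP.min (cQ.const_mul (2 * r))).continuousOn
      (by simpa using (H.φ_top.sub W.φ_top).min ((H.ψ_top.sub W.ψ_top).const_mul (2 * r)))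
      (le_min (sub_nonneg.2 hM'm.1) (mul_nonneg (by linarith) (sub_nonneg.2 hM'm.2))) hy hneg
    set m := min (φ₁ z - φ₂ z) (2 * r * (ψ₁ z - ψ₂ z)) with hm
    have hPz : m ≤ φ₁ z - φ₂ z := min_le_left _ _
    -- Needed on the whole line, since the delayed point z - d may lie to the left of M'.
    have hQm : ∀ w, m ≤ 2 * r * (ψ₁ w - ψ₂ w) := by
      intro w
      rcases le_total M' w with hw | hw
      · exact (hzmin w hw).trans (min_le_right _ _)
      · have : ψ₂ w ≤ ψ₁ w := by
          rcases le_total w M with hw' | hw'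
          · exact hQ w hw'
          · exact (hmid w ⟨hw', hw⟩).2
        exact hzneg.le.trans (mul_nonneg (by linarith) (sub_nonneg.2 this))
    have h7 : 7 / 8 ≤ φ₂ z := h₂.trans (W.mono_φ hz.le)
    have h8 : 7 / 8 ≤ φ₁ z := h₁.trans (H.mono_φ hz.le)
    rcases min_choice (φ₁ z - φ₂ z) (2 * r * (ψ₁ z - ψ₂ z)) with hch | hch
    · have hloc : IsLocalMin (fun x => φ₁ x - φ₂ x) z := by
        filter_upwards [Ioi_mem_nhds hz] with w hw
        rw [← hch]
        exact (hzmin w (le_of_lt hw)).trans (min_le_left _ _)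
      obtain ⟨e1, e2⟩ := hloc.second_order (Eventually.of_forall dP) (dP' z)
      have h1 := W.diff_φ φ₁ φ₁' ψ₁ z
      rw [e1] at h1
      rw [← hm] at hch
      rw [← hch] at h1
      have h2 := hQm (z - d)
      have h3 : φ₂ z / 2 * m ≤ r * φ₂ z * (ψ₁ (z - d) - ψ₂ (z - d)) := by
        have := mul_le_mul_of_nonneg_left h2 (half_pos (W.pos_φ z)).le
        linarith
      have h4 : 0 < m * (1 - r - φ₁ z - φ₂ z + r * ψ₁ (z - d) + φ₂ z / 2) :=
        mul_pos_of_neg_of_neg hzneg (by nlinarith [H.lt_ψ (z - d)])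
      nlinarith
    · have hloc : IsLocalMin (fun x => ψ₁ x - ψ₂ x) z := by
        filter_upwards [Ioi_mem_nhds hz] with w hw
        have : min (φ₁ z - φ₂ z) (2 * r * (ψ₁ z - ψ₂ z)) ≤ 2 * r * (ψ₁ w - ψ₂ w) :=
          (hzmin w (le_of_lt hw)).trans (min_le_right _ _)
        rw [hch] at this
        exact le_of_mul_le_mul_left this (by linarith)
      obtain ⟨e1, e2⟩ := hloc.second_order (Eventually.of_forall dQ) (dQ' z)
      have h1 := W.diff_ψ φ₁ ψ₁ ψ₁' z
      rw [e1] at h1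
      rw [← hm] at hch
      have h9 : 4 * r * (1 - ψ₁ z) ≤ 1 :=
        le_trans (mul_le_mul_of_nonneg_left (by linarith [H.mono_ψ hz.le]) (by linarith)) h₃
      have h10 : b * (1 - ψ₁ z) * m ≤ b * (φ₁ z - φ₂ z) * (1 - ψ₁ z) := by
        have := mul_le_mul_of_nonneg_left hPz (mul_nonneg hb.le (sub_nonneg.2 (H.lt_ψ z).le))
        linarith
      set q := ψ₁ z - ψ₂ z with hq
      have hqneg : q < 0 := by
        by_contra hcon
        push Not at hcon
        have : 0 ≤ m := by rw [hch]; positivity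
        linarith
      have h11 : 0 < b * q * (2 * r * (1 - ψ₁ z) - φ₂ z) :=
        mul_pos_of_neg_of_neg (mul_neg_of_pos_of_neg hb hqneg) (by linarith)
      rw [hch] at h10
      nlinarith
  rcases le_total x M with hx | hx
  · exact ⟨hleft x hx, hQ x hx⟩
  rcases le_total x M' with hx' | hx'
  · exact hmid x ⟨hx, hx'⟩
  · have := le_min_iff.1 (hright x hx')
    exact ⟨sub_nonneg.1 this.1, sub_nonneg.1 (nonneg_of_mul_nonneg_right this.2 (by linarith))⟩

/-- If an ordered pair of a solution and a sub-solution has the same leading term at `-∞`, it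
touches. -/
lemma exists_touch_of_tendsto (hb : 0 < b) (H : IsProfile r b c d φ₁ φ₁' ψ₁ ψ₁')
    (W : IsSubprofile r b c d φ₂ φ₂' φ₂'' ψ₂ ψ₂' ψ₂'') (hφ : ∀ x, φ₂ x ≤ φ₁ x)
    (hψ : ∀ x, ψ₂ x ≤ ψ₁ x) {A : ℝ} (hA : ∀ x, ψ₁ x ≤ A * Real.exp (c * x))
    (h0 : Tendsto (fun x => (ψ₁ x - ψ₂ x) * Real.exp (-(c * x))) atBot (𝓝 0)) :
    ∃ x, ψ₁ x = ψ₂ x := by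
  obtain ⟨l, C, hl, hC, hφ₂⟩ := W.φ_decay
  have hc := H.speed_pos hb
  have hl0 : 0 < l := hc.trans hl
  have dexp : ∀ a x : ℝ, HasDerivAt (fun x : ℝ => Real.exp (a * x)) (a * Real.exp (a * x)) x :=
    fun a x => (((hasDerivAt_id x).const_mul a).exp).congr_deriv (by simp; ring)
  have hexp0 : ∀ a : ℝ, 0 < a → Tendsto (fun x : ℝ => Real.exp (a * x)) atBot (𝓝 0) := fun a ha =>
    Real.tendsto_exp_atBot.comp ((tendsto_const_mul_atBot_of_pos ha).2 tendsto_id)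
  have le_zero : ∀ {f f' : ℝ → ℝ} {X : ℝ}, (∀ x ≤ X, HasDerivAt f (f' x) x) →
      (∀ x ≤ X, f' x ≤ 0) → Tendsto f atBot (𝓝 0) → ∀ x ≤ X, f x ≤ 0 := by
    intro f f' X h1 h2 h3 x hx
    have hanti := antitoneOn_of_hasDerivAt_nonpos (convex_Iic X) h1 h2
    refine ge_of_tendsto h3 ?_
    filter_upwards [eventually_le_atBot x] with y hy
    exact hanti (hy.trans hx) hx hy
  -- A contraction argument on (-∞, X]. If B is the supremum of y = (ψ₁ - ψ₂) e^{-cx}, then φ₂ ≤ C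
  -- e^{lx} bounds the remaining source by b C B e^{(l+c)x}; two integrations from -∞ return y ≤ B/2
  -- once X is far enough to the left, so B = 0.
  have hX := (hexp0 l hl0).const_mul (b * C / (l + c) / l)
  rw [mul_zero] at hX
  obtain ⟨X, hX⟩ := (hX.eventually (gt_mem_nhds (by norm_num : (0 : ℝ) < 1 / 2))).exists
  set y := fun x => (ψ₁ x - ψ₂ x) * Real.exp (-(c * x)) with hy
  have hy0 : ∀ x, 0 ≤ y x := fun x => mul_nonneg (sub_nonneg.2 (hψ x)) (Real.exp_pos _).le
  have hψ₂0 : ∀ x, 0 ≤ ψ₂ x := W.mono_ψ.le_of_tendsto W.ψ_bot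
  have hbdd : BddAbove (y '' Set.Iic X) := by
    refine ⟨A, ?_⟩
    rintro _ ⟨x, -, rfl⟩
    simp only [hy]
    rw [Real.exp_neg, ← div_eq_mul_inv, div_le_iff₀ (Real.exp_pos _)]
    linarith [hA x, hψ₂0 x]
  set B := sSup (y '' Set.Iic X) with hB
  have hyB : ∀ x ≤ X, y x ≤ B := fun x hx => le_csSup hbdd ⟨x, hx, rfl⟩
  have hB0 : 0 ≤ B := (hy0 X).trans (hyB X le_rfl)
  have hQ : ∀ x ≤ X, ψ₁ x - ψ₂ x ≤ B * Real.exp (c * x) := fun x hx => by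
    have := hyB x hx
    simp only [hy] at this
    rwa [Real.exp_neg, ← div_eq_mul_inv, div_le_iff₀ (Real.exp_pos _)] at this
  have hflux : ∀ x ≤ X, (ψ₁' x - ψ₂' x) - c * (ψ₁ x - ψ₂ x)
      - b * C * B / (l + c) * Real.exp ((l + c) * x) ≤ 0 := by
    refine le_zero (f' := fun x => (c * ψ₁' x - b * φ₁ x * (1 - ψ₁ x) - ψ₂'' x)
      - c * (ψ₁' x - ψ₂' x) - b * C * B / (l + c) * ((l + c) * Real.exp ((l + c) * x)))
      (fun x _ => (((H.dψ' x).sub (W.dψ' x)).sub (((H.dψ x).sub (W.dψ x)).const_mul c)).sub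
        ((dexp (l + c) x).const_mul _)) (fun x hx => ?_) ?_
    · have h1 := W.diff_ψ φ₁ ψ₁ ψ₁' x
      have h2 : 0 ≤ b * (φ₁ x - φ₂ x) * (1 - ψ₁ x) :=
        mul_nonneg (mul_nonneg hb.le (sub_nonneg.2 (hφ x))) (sub_nonneg.2 (H.lt_ψ x).le)
      have h3 : b * φ₂ x * (ψ₁ x - ψ₂ x) ≤ b * ((C * Real.exp (l * x)) * (B * Real.exp (c * x))) := by
        rw [mul_assoc]
        refine mul_le_mul_of_nonneg_left ?_ hb.le
        exact mul_le_mul (hφ₂ x) (hQ x hx) (sub_nonneg.2 (hψ x)) (by positivity)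
      have h4 : b * C * B / (l + c) * ((l + c) * Real.exp ((l + c) * x)) =
          b * ((C * Real.exp (l * x)) * (B * Real.exp (c * x))) := by
        rw [add_mul l c x, Real.exp_add]
        have : l + c ≠ 0 := by linarith
        field_simp
      rw [h4]
      linarith
    · have h1 := ((H.tendsto_ψ' hb).sub W.ψ'_bot).sub ((H.ψ_bot.sub W.ψ_bot).const_mul c)
      simpa using h1.sub ((hexp0 (l + c) (by linarith)).const_mul (b * C * B / (l + c)))
  have hy2 : ∀ x ≤ X, y x - b * C * B / (l + c) / l * Real.exp (l * x) ≤ 0 := by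
    have dy : ∀ x, HasDerivAt y
        (((ψ₁' x - ψ₂' x) - c * (ψ₁ x - ψ₂ x)) * Real.exp (-(c * x))) x := fun x => by
      have h1 : HasDerivAt (fun x : ℝ => -(c * x)) (-(c * 1)) x :=
        ((hasDerivAt_id x).const_mul c).neg
      exact (((H.dψ x).sub (W.dψ x)).mul h1.exp).congr_deriv (by simp only [Pi.sub_apply]; ring)
    refine le_zero (fun x _ => (dy x).sub ((dexp l x).const_mul _)) (fun x hx => ?_) ?_
    · have h1 := hflux x hx
      have h2 : b * C * B / (l + c) / l * (l * Real.exp (l * x)) =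
          b * C * B / (l + c) * Real.exp ((l + c) * x) * Real.exp (-(c * x)) := by
        rw [mul_assoc (b * C * B / (l + c)) (Real.exp _), ← Real.exp_add,
          show (l + c) * x + -(c * x) = l * x by ring]
        field_simp
      rw [h2, ← sub_mul]
      exact mul_nonpos_of_nonpos_of_nonneg h1 (Real.exp_pos _).le
    · simpa using h0.sub ((hexp0 l hl0).const_mul (b * C * B / (l + c) / l))
  have hBhalf : B ≤ B / 2 := by
    refine csSup_le ⟨_, X, by simp, rfl⟩ ?_
    rintro _ ⟨x, hx, rfl⟩
    have h1 := hy2 x hx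
    have h2 : Real.exp (l * x) ≤ Real.exp (l * X) := Real.exp_le_exp.2 (by
      have : x ≤ X := hx
      nlinarith)
    have h3 : b * C * B / (l + c) / l * Real.exp (l * x) ≤ B * (1 / 2) := by
      calc b * C * B / (l + c) / l * Real.exp (l * x)
          ≤ b * C * B / (l + c) / l * Real.exp (l * X) :=
            mul_le_mul_of_nonneg_left h2 (by positivity)
        _ = B * (b * C / (l + c) / l * Real.exp (l * X)) := by ring
        _ ≤ B * (1 / 2) := mul_le_mul_of_nonneg_left hX.le hB0
    linarith
  refine ⟨X, ?_⟩
  have h1 := hQ X le_rfl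
  have h2 : B = 0 := by linarith
  rw [h2, zero_mul] at h1
  linarith [hψ X]

/-- Sliding: a sub-solution is a shift of the solution. -/
theorem exists_shift_eq (hr : 1 < r) (hb : 0 < b) (H : IsProfile r b c d φ₁ φ₁' ψ₁ ψ₁')
    (W : IsSubprofile r b c d φ₂ φ₂' φ₂'' ψ₂ ψ₂' ψ₂'') (hd : 0 ≤ d) :
    ∃ s, ∀ x, φ₂ x = φ₁ (x + s) ∧ ψ₂ x = ψ₁ (x + s) := by
  have hr0 : 0 < r := by linarith
  have hc := H.speed_pos hb
  have c₁ := H.continuous_φ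
  have c₂ := H.continuous_ψ
  have e₁ := W.continuous_φ
  have e₂ := W.continuous_ψ
  -- The admissible shifts: non-empty by the exponential bounds at -∞, bounded below because φ₁ → 0
  -- at -∞ while φ₂ 0 > 0, and closed. The infimum is the critical shift.
  set S := {s : ℝ | ∀ x, φ₂ x ≤ φ₁ (x + s) ∧ ψ₂ x ≤ ψ₁ (x + s)} with hS
  have shift_top : ∀ a : ℝ, Tendsto (fun s : ℝ => a + s) atTop atTop :=
    fun a => tendsto_atTop_add_const_left _ a tendsto_id
  have evM : ∀ᶠ M in atBot, r * ψ₂ M < r - 1 := by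
    have := W.ψ_bot.const_mul r
    rw [mul_zero] at this
    exact this.eventually (gt_mem_nhds (by linarith))
  have evr : ∀ᶠ y in atTop, 4 * r * (1 - ψ₁ y) < 1 := by
    have : Tendsto (fun y => 4 * r * (1 - ψ₁ y)) atTop (𝓝 0) := by
      simpa using (H.ψ_top.const_sub 1).const_mul (4 * r)
    exact this.eventually (gt_mem_nhds (by norm_num))
  have hne : S.Nonempty := by
    obtain ⟨B, hB, hBψ⟩ := W.ψ_decay
    set κ := ψ₁ 0
    have hκ : 0 < κ := H.ψ_pos hb 0
    have evB : ∀ᶠ M in atBot, B * Real.exp (c * M) < κ := by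
      have : Tendsto (fun M : ℝ => B * Real.exp (c * M)) atBot (𝓝 (B * 0)) :=
        (Real.tendsto_exp_atBot.comp
          ((tendsto_const_mul_atBot_of_pos hc).2 tendsto_id)).const_mul B
      rw [mul_zero] at this
      exact this.eventually (gt_mem_nhds hκ)
    obtain ⟨M, hM1, hM2⟩ := (evM.and evB).exists
    obtain ⟨M', hMM, hM'⟩ := ((eventually_ge_atTop M).and
      (W.φ_top.eventually (lt_mem_nhds (by norm_num : (7 / 8 : ℝ) < 1)))).exists
    have evs : ∀ᶠ s in atTop, B ≤ κ * Real.exp (c * s) :=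
      (Tendsto.const_mul_atTop hκ (Real.tendsto_exp_atTop.comp
        ((tendsto_const_mul_atTop_of_pos hc).2 tendsto_id))).eventually_ge_atTop B
    obtain ⟨s, hs1, hs2, hs3, hs4, hs5⟩ := (evs.and
      (((H.φ_top.comp (shift_top M)).eventually (lt_mem_nhds (W.lt_φ M'))).and
      (((H.ψ_top.comp (shift_top M)).eventually (lt_mem_nhds (W.lt_ψ M'))).and
      (((H.φ_top.comp (shift_top M')).eventually
        (lt_mem_nhds (by norm_num : (7 / 8 : ℝ) < 1))).and
        ((shift_top M').eventually evr))))).exists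
    simp only [Function.comp_apply] at hs2 hs3 hs4
    refine ⟨s, fun x => le_of_le_middle hr hb (H.comp_add_const s) W hd hMM hM1 (fun x hx => ?_)
      (fun x hx => ⟨?_, ?_⟩) hM'.le hs4.le hs5.le x⟩
    -- Left of 0 one has ψ₁(y) ≥ κ e^{cy} by monotonicity of ψ₁ e^{-c·}, and a large s absorbs B;
    -- right of 0 one has ψ₁ ≥ κ, and B e^{cM} < κ suffices.
    · rcases le_total (x + s) 0 with h | h
      · have h1 := H.antitone_ψ_mul_exp hb h
        simp only [mul_zero, neg_zero, Real.exp_zero, mul_one] at h1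
        rw [Real.exp_neg, ← div_eq_mul_inv, le_div_iff₀ (Real.exp_pos _)] at h1
        refine le_trans (hBψ x) (le_trans ?_ h1)
        rw [mul_add, Real.exp_add, mul_comm (Real.exp _), ← mul_assoc]
        exact mul_le_mul_of_nonneg_right hs1 (Real.exp_pos _).le
      · refine (hBψ x).trans (le_trans ?_ (hM2.le.trans (H.mono_ψ h)))
        refine mul_le_mul_of_nonneg_left (Real.exp_le_exp.2 ?_) hB.le
        exact mul_le_mul_of_nonneg_left hx hc.le
    · exact (W.mono_φ hx.2).trans (hs2.le.trans (H.mono_φ (by linarith [hx.1])))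
    · exact (W.mono_ψ hx.2).trans (hs3.le.trans (H.mono_ψ (by linarith [hx.1])))
  have hbdd : BddBelow S := by
    obtain ⟨N, hN⟩ := eventually_atBot.1 (H.φ_bot.eventually (gt_mem_nhds (W.pos_φ 0)))
    refine ⟨N, fun s hs => ?_⟩
    by_contra h
    have h1 := (hs 0).1
    rw [zero_add] at h1
    exact lt_irrefl _ (h1.trans_lt (hN s (not_le.1 h).le))
  have hcl : IsClosed S := by
    simp only [hS, Set.ofPred_forall, Set.ofPred_and]
    exact isClosed_iInter fun x => (isClosed_le continuous_const (by fun_prop)).inter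
      (isClosed_le continuous_const (by fun_prop))
  set σ := sInf S
  have hσ : σ ∈ S := hcl.csInf_mem hne hbdd
  have Hσ := H.comp_add_const σ
  refine ⟨σ, ?_⟩
  suffices h : ∃ x₀, φ₁ (x₀ + σ) = φ₂ x₀ ∨ ψ₁ (x₀ + σ) = ψ₂ x₀ by
    obtain ⟨x₀, h⟩ := h
    exact fun x => eq_of_touch hr hb Hσ W (fun x => (hσ x).1) (fun x => (hσ x).2) h x
  by_contra hno
  push Not at hno
  have hstrict : ∀ x, φ₂ x < φ₁ (x + σ) ∧ ψ₂ x < ψ₁ (x + σ) := fun x =>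
    ⟨lt_of_le_of_ne (hσ x).1 (Ne.symm (hno x).1), lt_of_le_of_ne (hσ x).2 (Ne.symm (hno x).2)⟩
  obtain ⟨A₁, hA₁, hlim₁, -⟩ := H.exists_tendsto_ψ_mul_exp hr hb
  obtain ⟨A₂, hA₂, hlim₂⟩ := W.ψ_asymp
  have hshift : ∀ x s, ψ₁ (x + s) * Real.exp (-(c * x)) =
      ψ₁ (x + s) * Real.exp (-(c * (x + s))) * Real.exp (c * s) := fun x s => by
    rw [mul_assoc, ← Real.exp_add]
    congr 2
    ring
  have hlimσ : Tendsto (fun x => ψ₁ (x + σ) * Real.exp (-(c * (x + σ))) * Real.exp (c * σ)) atBot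
      (𝓝 (A₁ * Real.exp (c * σ))) :=
    (hlim₁.comp (tendsto_atBot_add_const_right _ σ tendsto_id)).mul_const _
  have hAle : A₂ ≤ A₁ * Real.exp (c * σ) := by
    refine le_of_tendsto_of_tendsto' hlim₂ hlimσ fun x => ?_
    rw [← hshift]
    exact mul_le_mul_of_nonneg_right (hσ x).2 (Real.exp_pos _).le
  -- Equal leading coefficients would produce a contact point, which is excluded by assumption.
  have hAlt : A₂ < A₁ * Real.exp (c * σ) := by
    refine lt_of_le_of_ne hAle fun heq => ?_
    obtain ⟨A, -, -, hA⟩ := Hσ.exists_tendsto_ψ_mul_exp hr hb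
    obtain ⟨x, hx⟩ := exists_touch_of_tendsto hb Hσ W (fun x => (hσ x).1) (fun x => (hσ x).2) hA
      (by
        have := hlimσ.sub hlim₂
        rw [heq, sub_self] at this
        refine this.congr fun x => ?_
        rw [← hshift, sub_mul])
    exact (hno x).2 hx
  -- The gap between the coefficients keeps the tails of ψ ordered under a slightly smaller shift;
  -- on the compact middle part strictness does so.
  obtain ⟨A', hA', hA''⟩ := exists_between hAlt
  have evA : ∀ᶠ M in atBot, ∀ x ≤ M, ψ₂ x * Real.exp (-(c * x)) ≤ A' := by
    obtain ⟨N, hN⟩ := eventually_atBot.1 (hlim₂.eventually (gt_mem_nhds hA'))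
    filter_upwards [eventually_le_atBot N] with M hM x hx using (hN x (hx.trans hM)).le
  obtain ⟨M, hM1, hM2, hM3⟩ :=
    (evM.and (evA.and (hlimσ.eventually (lt_mem_nhds hA'')))).exists
  have shift_top' : ∀ a : ℝ, Tendsto (fun s : ℝ => s + a) atTop atTop :=
    fun a => tendsto_atTop_add_const_right _ a tendsto_id
  -- The thresholds are taken at the shift σ - 1, so that by monotonicity they hold for all s in (σ
  -- - 1, σ).
  obtain ⟨M', hMM, hM'1, hM'2, hM'3⟩ := ((eventually_ge_atTop M).and
    ((W.φ_top.eventually (lt_mem_nhds (by norm_num : (7 / 8 : ℝ) < 1))).and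
    (((H.φ_top.comp (shift_top' (σ - 1))).eventually
      (lt_mem_nhds (by norm_num : (7 / 8 : ℝ) < 1))).and
      ((shift_top' (σ - 1)).eventually evr)))).exists
  simp only [Function.comp_apply] at hM'2
  have ev1 : ∀ᶠ s in 𝓝 σ, ∀ x ∈ Set.Icc M M', φ₂ x < φ₁ (x + s) ∧ ψ₂ x < ψ₁ (x + s) := by
    refine isCompact_Icc.eventually_forall_of_forall_eventually fun x _ => ?_
    refine Eventually.and ?_ ?_
    · have h1 : Continuous fun z : ℝ × ℝ => φ₂ z.2 := by fun_prop
      have h2 : Continuous fun z : ℝ × ℝ => φ₁ (z.2 + z.1) := by fun_prop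
      exact (isOpen_lt h1 h2).mem_nhds (hstrict x).1
    · have h1 : Continuous fun z : ℝ × ℝ => ψ₂ z.2 := by fun_prop
      have h2 : Continuous fun z : ℝ × ℝ => ψ₁ (z.2 + z.1) := by fun_prop
      exact (isOpen_lt h1 h2).mem_nhds (hstrict x).2
  have ev2 : ∀ᶠ s in 𝓝 σ, A' < ψ₁ (M + σ) * Real.exp (-(c * (M + σ))) * Real.exp (c * s) := by
    have h1 : Continuous fun s : ℝ =>
        ψ₁ (M + σ) * Real.exp (-(c * (M + σ))) * Real.exp (c * s) := by fun_prop
    exact (isOpen_lt continuous_const h1).mem_nhds hM3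
  have ev3 : ∀ᶠ s in 𝓝 σ, σ - 1 < s := lt_mem_nhds (by linarith)
  obtain ⟨s, ⟨h1, h2, h3⟩, hsσ⟩ := (((ev1.and (ev2.and ev3)).filter_mono
    (nhdsWithin_le_nhds (s := Set.Iio σ))).and self_mem_nhdsWithin).exists
  have hsσ' : s < σ := hsσ
  have hsS : s ∈ S := fun x => by
    refine le_of_le_middle hr hb (H.comp_add_const s) W hd hMM hM1 (fun x hx => ?_)
      (fun x hx => ⟨(h1 x hx).1.le, (h1 x hx).2.le⟩) hM'1.le
      (hM'2.le.trans (H.mono_φ (by linarith))) (le_trans ?_ hM'3.le) x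
    · have h4 : ψ₂ x * Real.exp (-(c * x)) ≤ ψ₁ (x + s) * Real.exp (-(c * x)) := by
        rw [hshift]
        refine (hM2 x hx).trans (h2.le.trans ?_)
        refine mul_le_mul_of_nonneg_right ?_ (Real.exp_pos _).le
        exact H.antitone_ψ_mul_exp hb (by linarith)
      exact le_of_mul_le_mul_right h4 (Real.exp_pos _)
    · refine mul_le_mul_of_nonneg_left ?_ (by linarith)
      have : ψ₁ (M' + (σ - 1)) ≤ ψ₁ (M' + s) := H.mono_ψ (by linarith)
      linarith
  exact absurd (csInf_le hbdd hsS) (not_le.2 hsσ')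

end IsSubprofile

/-- A profile for a larger delay and speed is a sub-solution. -/
lemma IsProfile.isSubprofile {c₁ c₂ d₁ d₂ : ℝ} (hr : 1 < r) (hb : 0 < b)
    (H : IsProfile r b c₂ d₂ φ φ' ψ ψ') (hc0 : 0 < c₁) (hc : c₁ ≤ c₂) (hd : d₁ ≤ d₂) :
    IsSubprofile r b c₁ d₁ φ φ' (fun x => c₂ * φ' x - φ x * (1 - r - φ x + r * ψ (x - d₂))) ψ ψ'
      (fun x => c₂ * ψ' x - b * φ x * (1 - ψ x)) where
  dφ := H.dφ
  dφ' := H.dφ'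
  dψ := H.dψ
  dψ' := H.dψ'
  -- The excess is (c₂ - c₁) φ' plus r φ times the increment of ψ from x - d₂ to x - d₁, both
  -- non-negative.
  le_φ'' x := by
    have h1 := mul_nonneg (sub_nonneg.2 hc) (H.φ'_nonneg x)
    have h2 := mul_nonneg (mul_nonneg (by linarith : (0 : ℝ) ≤ r) (H.pos_φ x).le)
      (sub_nonneg.2 (H.mono_ψ (by linarith : x - d₂ ≤ x - d₁)))
    linarith
  le_ψ'' x := by
    have h1 := mul_nonneg (sub_nonneg.2 hc) (H.ψ'_nonneg x)
    linarith
  pos_φ := H.pos_φ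
  lt_φ := H.φ_lt hr
  lt_ψ := H.lt_ψ
  mono_φ := H.mono_φ
  mono_ψ := H.mono_ψ
  φ_bot := H.φ_bot
  ψ_bot := H.ψ_bot
  φ_top := H.φ_top
  ψ_top := H.ψ_top
  ψ'_bot := H.tendsto_ψ' hb
  φ_decay := by
    obtain ⟨l, C, h1, h2, h3⟩ := H.exists_φ_le_exp hr hb
    exact ⟨l, C, by linarith, h2, h3⟩
  ψ_decay := by
    obtain ⟨A, hA, -, h⟩ := H.exists_tendsto_ψ_mul_exp hr hb
    refine ⟨max A 1, lt_max_of_lt_left hA, fun x => ?_⟩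
    rcases le_total x 0 with hx | hx
    · refine (h x).trans (mul_le_mul (le_max_left _ _) (Real.exp_le_exp.2 ?_) (Real.exp_pos _).le
        (le_max_of_le_left hA.le))
      nlinarith
    · refine (H.lt_ψ x).le.trans ?_
      have h1 : 1 ≤ Real.exp (c₁ * x) := Real.one_le_exp (by positivity)
      have h2 : 1 ≤ max A 1 := le_max_right _ _
      nlinarith
  ψ_asymp := by
    obtain ⟨A, hA, hlim, h⟩ := H.exists_tendsto_ψ_mul_exp hr hb
    rcases hc.eq_or_lt with rfl | hlt
    · exact ⟨A, hA.le, hlim⟩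
    · refine ⟨0, le_rfl, ?_⟩
      have h1 : Tendsto (fun x : ℝ => Real.exp ((c₂ - c₁) * x)) atBot (𝓝 0) :=
        Real.tendsto_exp_atBot.comp ((tendsto_const_mul_atBot_of_pos (sub_pos.2 hlt)).2 tendsto_id)
      have := hlim.mul h1
      rw [mul_zero] at this
      refine this.congr fun x => ?_
      rw [mul_assoc, ← Real.exp_add]
      congr 2
      ring

/-- Comparison of two profiles: if the speed and the delay of the second one are not smaller than
those of the first one, the speeds agree and the profiles coincide up to a shift. -/
theorem IsProfile.eq_shift_of_le {h₁ h₂ c₁ c₂ : ℝ} (hr : 1 < r) (hb : 0 < b)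
    (H₁ : IsProfile r b c₁ (c₁ * h₁) φ₁ φ₁' ψ₁ ψ₁') (H₂ : IsProfile r b c₂ (c₂ * h₂) φ₂ φ₂' ψ₂ ψ₂')
    (hh0 : 0 ≤ h₁) (hh : h₁ ≤ h₂) (hc : c₁ ≤ c₂) :
    c₁ = c₂ ∧ ∃ s, ∀ x, φ₂ x = φ₁ (x + s) ∧ ψ₂ x = ψ₁ (x + s) := by
  have hc0 := H₁.speed_pos hb
  have hd : c₁ * h₁ ≤ c₂ * h₂ := mul_le_mul hc hh hh0 (hc0.le.trans hc)
  obtain ⟨s, hs⟩ := (H₂.isSubprofile hr hb hc0 hc hd).exists_shift_eq hr hb H₁ (by positivity)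
  refine ⟨?_, s, hs⟩
  have Hs := H₁.comp_add_const s
  have eψ : ψ₂ = fun x => ψ₁ (x + s) := funext fun x => (hs x).2
  have eψ' : ψ₂' = fun x => ψ₁' (x + s) := funext fun x => by
    have := H₂.dψ x
    rw [eψ] at this
    exact this.unique (Hs.dψ x)
  -- The same function solves the second equation for both speeds, and it is not constant.
  have key : ∀ x, (c₁ - c₂) * ψ₂' x = 0 := fun x => by
    have h1 := H₂.dψ' x
    have h2 := Hs.dψ' x
    rw [eψ'] at h1
    have h3 := h1.unique h2
    rw [(hs x).1, (hs x).2] at h3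
    rw [eψ']
    linarith
  by_contra hne
  have hz : ∀ x, ψ₂' x = 0 := fun x =>
    (mul_eq_zero.1 (key x)).resolve_left (sub_ne_zero.2 hne)
  have h1 : ψ₂' = fun _ => 0 := funext hz
  have h2 := H₂.dψ' 0
  rw [h1] at h2
  have h3 := h2.unique (hasDerivAt_const 0 0)
  have h4 := mul_pos (mul_pos hb (H₂.pos_φ 0)) (sub_pos.2 (H₂.lt_ψ 0))
  linarith

end Sliding

/-! ### Super-solutions bound the speed from above; the bound by c_#. -/

section Supersolutions

/-- A monotone super-solution of the profile equations; `Φ` may be a minimum of smooth functions. -/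
structure IsSupersolution (r b c d : ℝ) (Φ Ψ : ℝ → ℝ) : Prop where
  cont_Φ : Continuous Φ
  cont_Ψ : Continuous Ψ
  mono_Φ : Monotone Φ
  mono_Ψ : Monotone Ψ
  -- A smooth function touching Φ from above at s replaces Φ in the inequality, which allows
  -- corners. The variable z stands for the delayed ψ; the restriction z ≤ 1 matters where Ψ exceeds
  -- 1.
  upper_Φ : ∀ s, ∃ (f f' : ℝ → ℝ) (f'' : ℝ), (∀ y, HasDerivAt f (f' y) y) ∧ HasDerivAt f' f'' s ∧
    (∀ y, Φ y ≤ f y) ∧ f s = Φ s ∧ 0 < f' s ∧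
    ∀ z ≤ 1, z ≤ Ψ (s - d) → f'' - c * f' s + Φ s * (1 - r - Φ s + r * z) ≤ 0
  upper_Ψ : ∃ (f' f'' : ℝ → ℝ), (∀ y, HasDerivAt Ψ (f' y) y) ∧ (∀ y, HasDerivAt f' (f'' y) y) ∧
    (∀ y, 0 < f' y) ∧ ∀ y, f'' y - c * f' y + b * Φ y * (1 - Ψ y) ≤ 0

variable {r b c d : ℝ} {φ φ' ψ ψ' Φ Ψ : ℝ → ℝ}

/-- The minimal shift at which a profile is dominated by `(Φ, Ψ)`. -/
lemma IsProfile.exists_touch (hr : 1 < r) (H : IsProfile r b c d φ φ' ψ ψ')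
    (cΦ : Continuous Φ) (cΨ : Continuous Ψ) (mΦ : Monotone Φ) (mΨ : Monotone Ψ)
    (hL : ∀ σ, ∀ᶠ s in atBot, φ s < Φ (s + σ) ∧ ψ s < Ψ (s + σ))
    (hR : ∀ σ, ∀ᶠ s in atTop, φ s < Φ (s + σ) ∧ ψ s < Ψ (s + σ))
    (hbot : Tendsto Φ atBot (𝓝 0)) (htop : ∀ y < 1, ∀ᶠ s in atTop, y < Φ s ∧ y < Ψ s) :
    ∃ σ, (∀ s, φ s ≤ Φ (s + σ) ∧ ψ s ≤ Ψ (s + σ)) ∧ ∃ s, φ s = Φ (s + σ) ∨ ψ s = Ψ (s + σ) := by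
  have c₁ := H.continuous_φ
  have c₂ := H.continuous_ψ
  set S := {σ : ℝ | ∀ x, φ x ≤ Φ (x + σ) ∧ ψ x ≤ Ψ (x + σ)} with hS
  -- For all shifts σ ≥ σ₀ at once, membership in S is decided on a compact interval.
  have extend : ∀ σ₀ : ℝ, ∃ A B : ℝ, A ≤ B ∧ ∀ σ, σ₀ ≤ σ →
      (∀ x ∈ Set.Icc A B, φ x ≤ Φ (x + σ) ∧ ψ x ≤ Ψ (x + σ)) → σ ∈ S := by
    intro σ₀
    obtain ⟨A, hA⟩ := eventually_atBot.1 (hL σ₀)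
    obtain ⟨B, hB⟩ := eventually_atTop.1 (hR σ₀)
    refine ⟨min A B, B, min_le_right _ _, fun σ hσ hmid x => ?_⟩
    have up : φ x < Φ (x + σ₀) ∧ ψ x < Ψ (x + σ₀) → φ x ≤ Φ (x + σ) ∧ ψ x ≤ Ψ (x + σ) := fun h =>
      ⟨h.1.le.trans (mΦ (by linarith)), h.2.le.trans (mΨ (by linarith))⟩
    rcases le_total x (min A B) with hx | hx
    · exact up (hA x (hx.trans (min_le_left _ _)))
    rcases le_total x B with hx' | hx'
    · exact hmid x ⟨hx, hx'⟩
    · exact up (hB x hx')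
  have hne : S.Nonempty := by
    obtain ⟨A, B, hAB, h⟩ := extend 0
    have ev : ∀ᶠ σ in atTop, max (φ B) (ψ B) < Φ (A + σ) ∧ max (φ B) (ψ B) < Ψ (A + σ) :=
      (tendsto_atTop_add_const_left _ A tendsto_id).eventually
        (htop _ (max_lt (H.φ_lt hr B) (H.lt_ψ B)))
    obtain ⟨σ, hσ, h1, h2⟩ := ((eventually_ge_atTop 0).and ev).exists
    refine ⟨σ, h σ hσ fun x hx => ⟨?_, ?_⟩⟩
    · exact (H.mono_φ hx.2).trans ((le_max_left _ _).trans (h1.le.trans (mΦ (by linarith [hx.1]))))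
    · exact (H.mono_ψ hx.2).trans ((le_max_right _ _).trans (h2.le.trans (mΨ (by linarith [hx.1]))))
  have hbdd : BddBelow S := by
    obtain ⟨N, hN⟩ := eventually_atBot.1 (hbot.eventually (gt_mem_nhds (H.pos_φ 0)))
    refine ⟨N, fun s hs => ?_⟩
    by_contra h
    have h1 := (hs 0).1
    rw [zero_add] at h1
    exact lt_irrefl _ (h1.trans_lt (hN s (not_le.1 h).le))
  have hcl : IsClosed S := by
    simp only [hS, Set.ofPred_forall, Set.ofPred_and]
    exact isClosed_iInter fun x => (isClosed_le continuous_const (by fun_prop)).inter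
      (isClosed_le continuous_const (by fun_prop))
  set σ := sInf S
  have hσ : σ ∈ S := hcl.csInf_mem hne hbdd
  refine ⟨σ, hσ, ?_⟩
  by_contra hno
  push Not at hno
  have hstrict : ∀ x, φ x < Φ (x + σ) ∧ ψ x < Ψ (x + σ) := fun x =>
    ⟨lt_of_le_of_ne (hσ x).1 (hno x).1, lt_of_le_of_ne (hσ x).2 (hno x).2⟩
  obtain ⟨A, B, -, h⟩ := extend (σ - 1)
  have ev1 : ∀ᶠ s in 𝓝 σ, ∀ x ∈ Set.Icc A B, φ x < Φ (x + s) ∧ ψ x < Ψ (x + s) := by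
    refine isCompact_Icc.eventually_forall_of_forall_eventually fun x _ => ?_
    refine Eventually.and ?_ ?_
    · have h1 : Continuous fun z : ℝ × ℝ => φ z.2 := by fun_prop
      have h2 : Continuous fun z : ℝ × ℝ => Φ (z.2 + z.1) := by fun_prop
      exact (isOpen_lt h1 h2).mem_nhds (hstrict x).1
    · have h1 : Continuous fun z : ℝ × ℝ => ψ z.2 := by fun_prop
      have h2 : Continuous fun z : ℝ × ℝ => Ψ (z.2 + z.1) := by fun_prop
      exact (isOpen_lt h1 h2).mem_nhds (hstrict x).2
  have ev3 : ∀ᶠ s in 𝓝 σ, σ - 1 < s := lt_mem_nhds (by linarith)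
  obtain ⟨s, ⟨h1, h3⟩, hsσ⟩ := (((ev1.and ev3).filter_mono
    (nhdsWithin_le_nhds (s := Set.Iio σ))).and self_mem_nhdsWithin).exists
  have hsσ' : s < σ := hsσ
  exact absurd (csInf_le hbdd (h s h3.le fun x hx => ⟨(h1 x hx).1.le, (h1 x hx).2.le⟩))
    (not_le.2 hsσ')

/-- The speed of a profile does not exceed the speed of a super-solution. -/
theorem IsSupersolution.speed_le {c₂ h : ℝ} (hr : 1 < r) (hb : 0 < b) (hh : 0 ≤ h)
    (W : IsSupersolution r b c (c * h) Φ Ψ) (H : IsProfile r b c₂ (c₂ * h) φ φ' ψ ψ')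
    (hL : c < c₂ → ∀ σ, ∀ᶠ s in atBot, φ s < Φ (s + σ) ∧ ψ s < Ψ (s + σ))
    (hR : ∀ σ, ∀ᶠ s in atTop, φ s < Φ (s + σ) ∧ ψ s < Ψ (s + σ))
    (hbot : Tendsto Φ atBot (𝓝 0)) (htop : ∀ y < 1, ∀ᶠ s in atTop, y < Φ s ∧ y < Ψ s) :
    c₂ ≤ c := by
  by_contra hlt
  push Not at hlt
  -- At the contact point the difference has a minimum, so first derivatives agree and second
  -- derivatives are ordered. Subtracting the relations leaves (c₂ - c) f' > 0 with the wrong sign;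
  -- the longer shift c₂ h of the faster profile only helps.
  obtain ⟨σ, hσ, s₀, hs₀⟩ := H.exists_touch hr W.cont_Φ W.cont_Ψ W.mono_Φ W.mono_Ψ (hL hlt) hR hbot
    htop
  have Hs := H.comp_add_const (-σ)
  have hle : ∀ s, φ (s + -σ) ≤ Φ s ∧ ψ (s + -σ) ≤ Ψ s := fun s => by simpa using hσ (s + -σ)
  obtain ⟨s, hs⟩ : ∃ s, φ (s + -σ) = Φ s ∨ ψ (s + -σ) = Ψ s := ⟨s₀ + σ, by simpa using hs₀⟩
  rcases hs with hs | hs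
  · obtain ⟨f, f', f'', d1, d2, hf, hfs, hpos, hineq⟩ := W.upper_Φ s
    have hmin : IsLocalMin (fun y => f y - φ (y + -σ)) s := Eventually.of_forall fun y => by
      simp only [hfs, hs, sub_self]
      linarith [hf y, (hle y).1]
    obtain ⟨e1, e2⟩ := hmin.second_order (Eventually.of_forall fun y => (d1 y).sub (Hs.dφ y))
      (d2.sub (Hs.dφ' s))
    have hd : c * h ≤ c₂ * h := mul_le_mul_of_nonneg_right hlt.le hh
    have h1 := hineq (ψ (s - c₂ * h + -σ)) (H.lt_ψ _).le
      ((hle _).2.trans (W.mono_Ψ (by linarith)))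
    rw [hs] at e2
    have h2 : 0 < (c₂ - c) * f' s := mul_pos (sub_pos.2 hlt) hpos
    have h3 : f' s = φ' (s + -σ) := by linarith
    rw [← h3] at e2
    linarith
  · obtain ⟨f', f'', d1, d2, hpos, hineq⟩ := W.upper_Ψ
    have hmin : IsLocalMin (fun y => Ψ y - ψ (y + -σ)) s := Eventually.of_forall fun y => by
      simp only [hs, sub_self]
      linarith [(hle y).2]
    obtain ⟨e1, e2⟩ := hmin.second_order (Eventually.of_forall fun y => (d1 y).sub (Hs.dψ y))
      ((d2 s).sub (Hs.dψ' s))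
    have h1 := hineq s
    have h2 : 0 < (c₂ - c) * f' s := mul_pos (sub_pos.2 hlt) (hpos s)
    have h3 : f' s = ψ' (s + -σ) := by linarith
    rw [← h3, hs] at e2
    have h4 : b * φ (s + -σ) * (1 - Ψ s) ≤ b * Φ s * (1 - Ψ s) := by
      have h5 : Ψ s < 1 := hs ▸ H.lt_ψ _
      exact mul_le_mul_of_nonneg_right (mul_le_mul_of_nonneg_left (hle s).1 hb.le)
        (sub_nonneg.2 h5.le)
    linarith

lemma hasDerivAt_exp_mul (a x : ℝ) :
    HasDerivAt (fun x : ℝ => Real.exp (a * x)) (a * Real.exp (a * x)) x :=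
  (((hasDerivAt_id x).const_mul a).exp).congr_deriv (by simp; ring)

lemma eventually_exp_mul_lt_atBot {a l C k : ℝ} (h : a < l) (hk : 0 < k) :
    ∀ᶠ s in atBot, C * Real.exp (l * s) < k * Real.exp (a * s) := by
  have h1 : Tendsto (fun s : ℝ => C * Real.exp ((l - a) * s)) atBot (𝓝 (C * 0)) :=
    (Real.tendsto_exp_atBot.comp
      ((tendsto_const_mul_atBot_of_pos (sub_pos.2 h)).2 tendsto_id)).const_mul C
  rw [mul_zero] at h1
  filter_upwards [h1.eventually (gt_mem_nhds hk)] with s hs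
  have : C * Real.exp (l * s) = C * Real.exp ((l - a) * s) * Real.exp (a * s) := by
    rw [mul_assoc, ← Real.exp_add]; congr 2; ring
  rw [this]
  exact mul_lt_mul_of_pos_right hs (Real.exp_pos _)

lemma tendsto_const_mul_exp_atTop {a k : ℝ} (ha : 0 < a) (hk : 0 < k) :
    Tendsto (fun s : ℝ => k * Real.exp (a * s)) atTop atTop :=
  Tendsto.const_mul_atTop hk
    (Real.tendsto_exp_atTop.comp ((tendsto_const_mul_atTop_of_pos ha).2 tendsto_id))

lemma tendsto_const_mul_exp_atBot {a : ℝ} (k : ℝ) (ha : 0 < a) :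
    Tendsto (fun s : ℝ => k * Real.exp (a * s)) atBot (𝓝 0) := by
  simpa using (Real.tendsto_exp_atBot.comp
    ((tendsto_const_mul_atBot_of_pos ha).2 tendsto_id)).const_mul k

/-- The bound `c²/4 ≤ b'/(1 + b')`. -/
theorem IsProfile.speed_le_of_isCSharp {c₂ h : ℝ} (hr : 1 < r) (hb : 0 < b) (hh : 0 ≤ h)
    (H : IsProfile r b c₂ (c₂ * h) φ φ' ψ ψ') (hc : 0 < c)
    (hcs : c ^ 2 / 4 = bPrime b h c / (1 + bPrime b h c)) : c₂ ≤ c := by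
  set q := Real.exp (-(c ^ 2 * h / 2)) with hq
  have hq0 : 0 < q := Real.exp_pos _
  have hbp : bPrime b h c = b * q := rfl
  -- The super-solution is (K E, E) with E = e^{cs/2}, the exponent at which λ² - cλ takes its
  -- minimum -c²/4. This K gives b K = c²/4, which settles the second equation, and q = K + b K q is
  -- used for the first.
  set K := q / (1 + b * q) with hK
  have hK0 : 0 < K := by positivity
  have hbK : b * K = c ^ 2 / 4 := by rw [hcs, hbp, hK]; ring
  have hqK : q = K + b * K * q := by rw [hK]; field_simp
  have hshift : ∀ k s σ : ℝ, k * Real.exp (c / 2 * (s + σ)) =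
      k * Real.exp (c / 2 * σ) * Real.exp (c / 2 * s) := fun k s σ => by
    rw [mul_assoc, ← Real.exp_add]; congr 2; ring
  have hc2 : 0 < c / 2 := by linarith
  have mexp : ∀ k : ℝ, 0 < k → Monotone fun s => k * Real.exp (c / 2 * s) := fun k hk x y hxy =>
    mul_le_mul_of_nonneg_left (Real.exp_le_exp.2 (by nlinarith)) hk.le
  have dexp : ∀ k y : ℝ, HasDerivAt (fun s => k * Real.exp (c / 2 * s))
      (c / 2 * (k * Real.exp (c / 2 * y))) y := fun k y =>
    ((hasDerivAt_exp_mul (c / 2) y).const_mul k).congr_deriv (by ring)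
  have W : IsSupersolution r b c (c * h) (fun s => K * Real.exp (c / 2 * s))
      (fun s => 1 * Real.exp (c / 2 * s)) := by
    refine ⟨by fun_prop, by fun_prop, mexp K hK0, mexp 1 one_pos, fun s => ?_, ?_⟩
    · refine ⟨_, _, _, dexp K, (dexp K s).const_mul (c / 2), fun y => le_rfl, rfl, by positivity,
        fun z hz1 hz2 => ?_⟩
      set E := Real.exp (c / 2 * s) with hE
      have hE0 : 0 < E := Real.exp_pos _
      have hz2' : z ≤ q * E := by
        refine hz2.trans (le_of_eq ?_)
        rw [one_mul, hq, hE, ← Real.exp_add]; congr 1; ring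
      have key : 1 - r - K * E + r * z ≤ c ^ 2 / 4 := by
        rw [← hbK]
        have h1 : (q - K) * E = b * K * (q * E) := by
          have : q - K = b * K * q := by linarith
          rw [this]; ring
        have hbK0 : 0 < b * K := by positivity
        -- If q E ≤ 1 the bound z ≤ q E is the useful one, with r > 1; otherwise it is z ≤ 1.
        rcases le_total (q * E) 1 with h2 | h2
        · have h3 := mul_le_mul_of_nonneg_left hz2' (by linarith : 0 ≤ r)
          nlinarith
        · have h3 : 1 ≤ K * E + b * K := by
            have : q * (1 - b * K) = K := by linarith
            have h4 : K * E = (q * E) * (1 - b * K) := by linear_combination (-E) * this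
            have h5 : 0 ≤ 1 - b * K := by
              by_contra hcon
              push Not at hcon
              nlinarith
            nlinarith
          nlinarith
      have : c / 2 * (c / 2 * (K * E)) - c * (c / 2 * (K * E)) + K * E * (1 - r - K * E + r * z) =
          (K * E) * ((1 - r - K * E + r * z) - c ^ 2 / 4) := by ring
      rw [this]
      exact mul_nonpos_of_nonneg_of_nonpos (by positivity) (by linarith)
    · refine ⟨_, _, dexp 1, fun y => (dexp 1 y).const_mul (c / 2), fun y => by positivity,
        fun y => ?_⟩
      set E := Real.exp (c / 2 * y) with hE
      have hE0 : 0 < E := Real.exp_pos _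
      have : c / 2 * (c / 2 * (1 * E)) - c * (c / 2 * (1 * E)) + b * (K * E) * (1 - 1 * E) =
          -(b * K * E ^ 2) + E * (b * K - c ^ 2 / 4) := by ring
      rw [this, hbK, sub_self]
      have : 0 ≤ c ^ 2 / 4 * E ^ 2 := by positivity
      linarith
  obtain ⟨l, C, hl, hC, hφ⟩ := H.exists_φ_le_exp hr hb
  obtain ⟨A, hA, -, hψ⟩ := H.exists_tendsto_ψ_mul_exp hr hb
  refine W.speed_le hr hb hh H (fun hlt σ => ?_) (fun σ => ?_)
    (tendsto_const_mul_exp_atBot K hc2) (fun y hy => ?_)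
  · simp only [hshift]
    filter_upwards [eventually_exp_mul_lt_atBot (C := C) (by linarith : c / 2 < l)
      (by positivity : 0 < K * Real.exp (c / 2 * σ)), eventually_exp_mul_lt_atBot (C := A)
      (by linarith : c / 2 < c₂) (by positivity : 0 < 1 * Real.exp (c / 2 * σ))] with s h1 h2
    exact ⟨(hφ s).trans_lt h1, (hψ s).trans_lt h2⟩
  · simp only [hshift]
    filter_upwards [(tendsto_const_mul_exp_atTop hc2
      (by positivity : 0 < K * Real.exp (c / 2 * σ))).eventually_gt_atTop 1,
      (tendsto_const_mul_exp_atTop hc2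
      (by positivity : 0 < 1 * Real.exp (c / 2 * σ))).eventually_gt_atTop 1] with s h1 h2
    exact ⟨(H.φ_le s).trans_lt h1, (H.lt_ψ s).trans h2⟩
  · exact ((tendsto_const_mul_exp_atTop hc2 hK0).eventually_gt_atTop y).and
      ((tendsto_const_mul_exp_atTop hc2 one_pos).eventually_gt_atTop y)

end Supersolutions

/-! ### Elementary inequalities behind the super-solutions for c_o. -/

section NumericalInequalities

/-- Raising to the power q leaves an inequality between rationals, with a decimal upper bound of e
in the place of e. -/
lemma exp_div_le_of_pow {p q : ℕ} {v : ℝ} (hv : 0 ≤ v) (hq : q ≠ 0)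
    (h : (2.7182818286 : ℝ) ^ p ≤ v ^ q) : Real.exp (p / q) ≤ v := by
  refine le_of_pow_le_pow_left₀ hq hv ?_
  rw [← Real.exp_nat_mul, mul_div_cancel₀ _ (Nat.cast_ne_zero.2 hq), ← mul_one (p : ℝ),
    Real.exp_nat_mul]
  exact (pow_le_pow_left₀ (Real.exp_pos _).le Real.exp_one_lt_d9.le p).trans h

lemma div_le_log_of_pow {p q : ℕ} {v : ℝ} (hv : 0 < v) (hq : q ≠ 0)
    (h : (2.7182818286 : ℝ) ^ p ≤ v ^ q) : (p / q : ℝ) ≤ Real.log v :=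
  (Real.le_log_iff_exp_le hv).2 (exp_div_le_of_pow hv.le hq h)

lemma le_exp_neg_div_of_pow {p q : ℕ} {v : ℝ} (hv : 0 < v) (hq : q ≠ 0)
    (h : (2.7182818286 : ℝ) ^ p ≤ (1 / v) ^ q) : v ≤ Real.exp (-(p / q : ℝ)) := by
  have := exp_div_le_of_pow (p := p) (q := q) (one_div_pos.2 hv).le hq h
  rw [Real.exp_neg]
  rw [le_one_div (Real.exp_pos _) hv, one_div] at this
  exact this

/-- The tangent to the convex function `exp (-E)`. -/
lemma tangent_le_exp_neg {a v : ℝ} (hv : v ≤ Real.exp (-a)) {E : ℝ} (hE : E ≤ 1 + a) :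
    v * (1 + a - E) ≤ Real.exp (-E) := by
  have h1 : Real.exp (-E) = Real.exp (-a) * Real.exp (a - E) := by
    rw [← Real.exp_add]; congr 1; ring
  have h2 := Real.add_one_le_exp (a - E)
  rw [h1]
  calc v * (1 + a - E) ≤ Real.exp (-a) * (1 + a - E) :=
        mul_le_mul_of_nonneg_right hv (by linarith)
    _ ≤ _ := mul_le_mul_of_nonneg_left (by linarith) (Real.exp_pos _).le

/-- The tangent, in the variable `1/E`, to the logarithm. -/
lemma tangent_le_log {a E : ℝ} (ha : 0 < a) (hE : 0 < E) :
    Real.log a + (1 - a / E) ≤ Real.log E := by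
  have := Real.log_le_sub_one_of_pos (div_pos ha hE)
  rw [Real.log_div ha.ne' hE.ne'] at this
  linarith

/-- The tangent to `exp (-t η)`, parametrised by its slope. -/
lemma mul_one_sub_log_le_exp {y a : ℝ} (hy : 0 < y) : y * (1 - Real.log y - a) ≤ Real.exp (-a) := by
  have h1 := Real.add_one_le_exp (-a - Real.log y)
  rw [Real.exp_sub, Real.exp_log hy, le_div_iff₀ hy] at h1
  linarith

/-- What remains of the estimate for the c/2 piece after elimination of η. Here 6987/1000 =
(17/10)(411/100) and 289/400 = (17/20)². On each subinterval exp and log are replaced by tangents at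
a point a, and a polynomial inequality in E is left. -/
lemma one_add_log_mul_ge {E : ℝ} (hE : 289 / 400 ≤ E) :
    411 / 100 * (1 - Real.exp (-E)) ≤ 1 + Real.log (6987 / 1000 * E) := by
  have hE0 : 0 < E := by linarith
  have hlog : ∀ a w : ℝ, 0 < a → w ≤ Real.log (6987 / 1000 * a) →
      w + (1 - a / E) ≤ Real.log (6987 / 1000 * E) := by
    intro a w ha hw
    have := tangent_le_log ha hE0
    rw [Real.log_mul (by norm_num) ha.ne'] at hw
    rw [Real.log_mul (by norm_num) hE0.ne']
    linarith
  have key : ∀ a v w : ℝ, 0 < a → v ≤ Real.exp (-a) → w ≤ Real.log (6987 / 1000 * a) → E ≤ 1 + a →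
      411 / 100 * E ≤ (1 + w) * E + (E - a) + 411 / 100 * (v * (1 + a - E)) * E →
      411 / 100 * (1 - Real.exp (-E)) ≤ 1 + Real.log (6987 / 1000 * E) := by
    intro a v w ha hv hw hEa h
    have h1 := hlog a w ha hw
    have h2 := tangent_le_exp_neg hv hEa
    have h3 : 411 / 100 ≤ 1 + w + (1 - a / E) + 411 / 100 * (v * (1 + a - E)) := by
      rw [← mul_le_mul_iff_left₀ hE0]
      have : (1 + w + (1 - a / E) + 411 / 100 * (v * (1 + a - E))) * E =
        (1 + w) * E + (E - a) + 411 / 100 * (v * (1 + a - E)) * E := by field_simp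
      rw [this]; exact h
    linarith
  rcases le_total E (3 / 2) with h1 | h1
  · refine key (6 / 5) (3 / 10) (21 / 10) (by norm_num) ?_ ?_ (by linarith) (by nlinarith)
    · exact_mod_cast le_exp_neg_div_of_pow (p := 6) (q := 5) (v := 3 / 10) (by norm_num)
        (by norm_num) (by norm_num)
    · exact_mod_cast div_le_log_of_pow (p := 21) (q := 10) (v := 6987 / 1000 * (6 / 5))
        (by norm_num) (by norm_num) (by norm_num)
  rcases le_total E (9 / 5) with h2 | h2
  · refine key (8 / 5) (1 / 5) (12 / 5) (by norm_num) ?_ ?_ (by linarith) (by nlinarith)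
    · exact_mod_cast le_exp_neg_div_of_pow (p := 8) (q := 5) (v := 1 / 5) (by norm_num)
        (by norm_num) (by norm_num)
    · exact_mod_cast div_le_log_of_pow (p := 12) (q := 5) (v := 6987 / 1000 * (8 / 5))
        (by norm_num) (by norm_num) (by norm_num)
  rcases le_total E (27 / 10) with h3 | h3
  · refine key (11 / 5) (11 / 100) (68 / 25) (by norm_num) ?_ ?_ (by linarith) (by nlinarith)
    · exact_mod_cast le_exp_neg_div_of_pow (p := 11) (q := 5) (v := 11 / 100) (by norm_num)
        (by norm_num) (by norm_num)
    · exact_mod_cast div_le_log_of_pow (p := 68) (q := 25) (v := 6987 / 1000 * (11 / 5))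
        (by norm_num) (by norm_num) (by norm_num)
  have hw : (25 / 8 : ℝ) ≤ Real.log (6987 / 1000 * (33 / 10)) := by
    exact_mod_cast div_le_log_of_pow (p := 25) (q := 8) (v := 6987 / 1000 * (33 / 10))
        (by norm_num) (by norm_num) (by norm_num)
  rcases le_total E 4 with h4 | h4
  · refine key (33 / 10) (36 / 1000) (25 / 8) (by norm_num) ?_ hw (by linarith) (by nlinarith)
    exact_mod_cast le_exp_neg_div_of_pow (p := 33) (q := 10) (v := 36 / 1000) (by norm_num)
        (by norm_num) (by norm_num)
  · have h5 := hlog (33 / 10) (25 / 8) (by norm_num) hw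
    have h6 : 33 / 10 / E ≤ 33 / 40 := by
      rw [div_le_div_iff₀ hE0 (by norm_num)]; linarith
    have := Real.exp_pos (-E)
    linarith

/-- The analogue for the 3c/4 piece: 137/25 = (4/3)(411/100), and 274/25 is twice that. In terms of
E = u² the tangent method applies again. -/
lemma one_add_log_mul_pow_ge {u : ℝ} (hu : 1 / 2 ≤ u) (hu' : u ≤ 17 / 20) :
    137 / 25 * (1 - Real.exp (-u ^ 2)) ≤ 1 + Real.log (274 / 25 * u ^ 3) := by
  have hu0 : 0 < u := by linarith
  set E := u ^ 2 with hE
  have hE0 : 0 < E := by positivity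
  have hE1 : 1 / 4 ≤ E := by nlinarith
  have hE2 : E ≤ 289 / 400 := by nlinarith
  have hlogE : Real.log (274 / 25 * u ^ 3) = 1 / 2 * Real.log (75076 / 625 * E ^ 3) := by
    have : (75076 / 625 * E ^ 3 : ℝ) = (274 / 25 * u ^ 3) ^ 2 := by rw [hE]; ring
    rw [this, Real.log_pow]; push_cast; ring
  rw [hlogE]
  have key : ∀ a v w : ℝ, 0 < a → v ≤ Real.exp (-a) → w ≤ Real.log (75076 / 625 * a ^ 3) →
      E ≤ 1 + a →
      137 / 25 * E ≤ (1 + w / 2) * E + 3 / 2 * (E - a) + 137 / 25 * (v * (1 + a - E)) * E →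
      137 / 25 * (1 - Real.exp (-E)) ≤ 1 + 1 / 2 * Real.log (75076 / 625 * E ^ 3) := by
    intro a v w ha hv hw hEa h
    have h1 := tangent_le_log ha hE0
    have h2 := tangent_le_exp_neg hv hEa
    rw [Real.log_mul (by norm_num) (by positivity), Real.log_pow] at hw
    rw [Real.log_mul (by norm_num) (by positivity), Real.log_pow]
    push_cast at hw ⊢
    have h3 : 137 / 25 ≤ 1 + w / 2 + 3 / 2 * (1 - a / E) + 137 / 25 * (v * (1 + a - E)) := by
      rw [← mul_le_mul_iff_left₀ hE0]
      have : (1 + w / 2 + 3 / 2 * (1 - a / E) + 137 / 25 * (v * (1 + a - E))) * E =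
        (1 + w / 2) * E + 3 / 2 * (E - a) + 137 / 25 * (v * (1 + a - E)) * E := by field_simp
      rw [this]; exact h
    linarith
  rcases le_total E (3 / 10) with h1 | h1
  · refine key (27 / 100) (76 / 100) (17 / 20) (by norm_num) ?_ ?_ (by linarith) (by nlinarith)
    · exact_mod_cast le_exp_neg_div_of_pow (p := 27) (q := 100) (v := 76 / 100) (by norm_num)
        (by norm_num) (by norm_num)
    · simpa only [Nat.cast_ofNat] using div_le_log_of_pow (p := 17) (q := 20)
        (v := 75076 / 625 * (27 / 100) ^ 3) (by norm_num) (by norm_num) (by norm_num)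
  rcases le_total E (1 / 2) with h2 | h2
  · refine key (2 / 5) (67 / 100) 2 (by norm_num) ?_ ?_ (by linarith) (by nlinarith)
    · exact_mod_cast le_exp_neg_div_of_pow (p := 2) (q := 5) (v := 67 / 100) (by norm_num)
        (by norm_num) (by norm_num)
    · have := div_le_log_of_pow (p := 2) (q := 1) (v := 75076 / 625 * (2 / 5) ^ 3)
        (by norm_num) (by norm_num) (by norm_num)
      simpa using this
  · refine key (33 / 50) (515 / 1000) (7 / 2) (by norm_num) ?_ ?_ (by linarith) (by nlinarith)
    · exact_mod_cast le_exp_neg_div_of_pow (p := 33) (q := 50) (v := 515 / 1000) (by norm_num)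
        (by norm_num) (by norm_num)
    · simpa only [Nat.cast_ofNat] using div_le_log_of_pow (p := 7) (q := 2)
        (v := 75076 / 625 * (33 / 50) ^ 3) (by norm_num) (by norm_num) (by norm_num)

/-- The inequality behind the linear piece of the super-solution. -/
lemma one_sub_le_exp_neg_add {η κ E : ℝ} (hκ : Real.exp (-(411 / 100 * η)) ≤ κ)
    (hE : 289 / 400 ≤ E) : 1 - η ≤ Real.exp (-E) + 17 / 10 * (κ * E) := by
  have hE0 : 0 < E := by linarith
  have hY : 0 < 6987 / 1000 * E := by positivity
  -- The slope is chosen so that the terms linear in η cancel exactly.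
  have h1 := mul_one_sub_log_le_exp (y := (6987 / 1000 * E)⁻¹) (a := 411 / 100 * η)
    (inv_pos.2 hY)
  rw [Real.log_inv] at h1
  have h2 : 17 / 10 * E * ((6987 / 1000 * E)⁻¹ *
      (1 - -Real.log (6987 / 1000 * E) - 411 / 100 * η)) =
      100 / 411 * (1 + Real.log (6987 / 1000 * E)) - η := by
    field_simp; ring
  have h3 := mul_le_mul_of_nonneg_left (h1.trans hκ) (by positivity : 0 ≤ 17 / 10 * E)
  rw [h2] at h3
  have h4 := one_add_log_mul_ge hE
  linarith

/-- The inequality behind the piece of the super-solution with the exponent `3/2`. -/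
lemma one_sub_le_exp_neg_add_pow {η κ u : ℝ} (hη : 23 / 200 ≤ η)
    (hκ : Real.exp (-(411 / 100 * η)) ≤ κ) (hu : 0 ≤ u) (hu' : u ≤ 17 / 20) :
    1 - 3 / 4 * η ≤ Real.exp (-u ^ 2) + 2 * (κ * u ^ 3) := by
  rcases le_total (1 / 2) u with h | h
  · have hu0 : 0 < u := by linarith
    have h1 := mul_one_sub_log_le_exp (y := (274 / 25 * u ^ 3)⁻¹) (a := 411 / 100 * η)
      (inv_pos.2 (by positivity))
    rw [Real.log_inv] at h1
    have h2 : 2 * u ^ 3 * ((274 / 25 * u ^ 3)⁻¹ *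
        (1 - -Real.log (274 / 25 * u ^ 3) - 411 / 100 * η)) =
        25 / 137 * (1 + Real.log (274 / 25 * u ^ 3)) - 3 / 4 * η := by
      field_simp; ring
    have h3 := mul_le_mul_of_nonneg_left (h1.trans hκ) (by positivity : 0 ≤ 2 * u ^ 3)
    rw [h2] at h3
    have h4 := one_add_log_mul_pow_ge h hu'
    linarith
  -- For small u a fixed slope suffices. The difference of the two sides is bounded below by an
  -- expression increasing in η, so η = 23/200 is the worst case; the cubic in u left then has its
  -- minimum near 112/250, whence `h8`.
  · have h1 := mul_one_sub_log_le_exp (y := 62 / 100) (a := 411 / 100 * η) (by norm_num)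
    have h2 : (19 / 40 : ℝ) ≤ -Real.log (62 / 100) := by
      rw [← Real.log_inv]
      exact_mod_cast div_le_log_of_pow (p := 19) (q := 40) (v := (62 / 100)⁻¹) (by norm_num)
        (by norm_num) (by norm_num)
    have h3 : 62 / 100 * (59 / 40 - 411 / 100 * η) ≤ κ := by linarith
    have h4 : (835 / 1000 : ℝ) ≤ Real.exp (-(9 / 50)) := by
      exact_mod_cast le_exp_neg_div_of_pow (p := 9) (q := 50) (v := 835 / 1000) (by norm_num)
        (by norm_num) (by norm_num)
    have h5 := tangent_le_exp_neg h4 (E := u ^ 2) (by nlinarith)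
    have hu3 : 0 ≤ u ^ 3 := by positivity
    have hu3' : u ^ 3 ≤ 1 / 8 := by
      calc u ^ 3 ≤ (1 / 2) ^ 3 := pow_le_pow_left₀ hu h 3
        _ = 1 / 8 := by norm_num
    have h6 := mul_le_mul_of_nonneg_right h3 hu3
    have h7 : 0 ≤ (η - 23 / 200) * (3 / 4 - 2 * (62 / 100 * (411 / 100)) * u ^ 3) :=
      mul_nonneg (by linarith) (by linarith)
    have h8 : 0 ≤ (u + 1) * (u - 112 / 250) ^ 2 := by positivity
    nlinarith

/-- The inequality behind the super-solution for small values of `η`. -/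
lemma one_sub_le_exp_neg_add_of_small {η κ E : ℝ} (hη0 : 0 ≤ η) (hη : η ≤ 23 / 200)
    (hκ : Real.exp (-(411 / 100 * η)) ≤ κ) (hE : 0 ≤ E) : 1 - η ≤ Real.exp (-E) + κ * E := by
  set τ := 411 / 100 * η with hτ
  -- The tangent of slope -e^{-τ} eliminates E, as κ ≥ e^{-τ}, and leaves 1 - η ≤ e^{-τ}(1 + τ);
  -- then (1 - τ/4)⁴ ≤ e^{-τ} makes it polynomial.
  have h1 := mul_one_sub_log_le_exp (y := Real.exp (-τ)) (a := E) (Real.exp_pos _)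
  rw [Real.log_exp] at h1
  have h2 : (1 - τ / 4) ^ 4 ≤ Real.exp (-τ) := by
    have h3 : Real.exp (-τ) = Real.exp (-(τ / 4)) ^ 4 := by
      rw [← Real.exp_nat_mul]; congr 1; push_cast; ring
    rw [h3]
    exact pow_le_pow_left₀ (by linarith) (by linarith [Real.add_one_le_exp (-(τ / 4))]) 4
  have hτ0 : 0 ≤ τ := by linarith
  have hτ1 : τ ≤ 473 / 1000 := by linarith
  have h4 : 1 - η ≤ (1 - τ / 4) ^ 4 * (1 + τ) := by
    have h5 : η = 100 / 411 * τ := by rw [hτ]; ring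
    have h6 : 0 ≤ τ * (100 / 411 - 5 / 8 * τ + 5 / 16 * τ ^ 2 - 15 / 256 * τ ^ 3) := by
      refine mul_nonneg hτ0 ?_
      have h7 : τ ^ 3 ≤ τ * (473 / 1000) ^ 2 := by
        have := pow_le_pow_left₀ hτ0 hτ1 2
        calc τ ^ 3 = τ * τ ^ 2 := by ring
          _ ≤ _ := mul_le_mul_of_nonneg_left this hτ0
      nlinarith
    have h8 : 0 ≤ τ ^ 5 / 256 := by positivity
    rw [h5]
    nlinarith
  have h5 := mul_le_mul_of_nonneg_right h2 (by linarith : 0 ≤ 1 + τ)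
  have h6 := mul_le_mul_of_nonneg_right hκ hE
  nlinarith

end NumericalInequalities

/-! ### The super-solutions with second component 1 - exp(-e^{cs/2}). -/

section SpeedBounds

variable {r b c : ℝ} {φ φ' ψ ψ' Φ Ψ : ℝ → ℝ}

/-- The super-solution with the second component `1 - exp (-e^{c s/2})`. -/
lemma isSupersolution_one_sub_exp {d K : ℝ} (hc : 0 < c) (hbK : b * K = c ^ 2 / 4)
    (hb : 0 < b) {Φ : ℝ → ℝ} (cΦ : Continuous Φ) (mΦ : Monotone Φ)
    (hΦ : ∀ s, Φ s ≤ K * (Real.exp (c / 2 * s) + Real.exp (c / 2 * s) ^ 2))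
    (upper : ∀ s, ∃ (f f' : ℝ → ℝ) (f'' : ℝ), (∀ y, HasDerivAt f (f' y) y) ∧
      HasDerivAt f' f'' s ∧ (∀ y, Φ y ≤ f y) ∧ f s = Φ s ∧ 0 < f' s ∧
      ∀ z ≤ 1, z ≤ 1 - Real.exp (-Real.exp (c / 2 * (s - d))) →
        f'' - c * f' s + Φ s * (1 - r - Φ s + r * z) ≤ 0) :
    IsSupersolution r b c d Φ (fun s => 1 - Real.exp (-Real.exp (c / 2 * s))) := by
  have dξ := hasDerivAt_exp_mul (c / 2)
  have dG : ∀ y, HasDerivAt (fun s => Real.exp (-Real.exp (c / 2 * s)))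
      (-(c / 2 * Real.exp (c / 2 * y)) * Real.exp (-Real.exp (c / 2 * y))) y := fun y =>
    ((dξ y).neg.exp).congr_deriv (by simp only [Pi.neg_apply]; ring)
  have dΨ : ∀ y, HasDerivAt (fun s => 1 - Real.exp (-Real.exp (c / 2 * s)))
      (c / 2 * Real.exp (c / 2 * y) * Real.exp (-Real.exp (c / 2 * y))) y := fun y =>
    ((dG y).const_sub 1).congr_deriv (by ring)
  refine ⟨cΦ, by fun_prop, mΦ, fun x y hxy => ?_, upper, _, fun y => c ^ 2 / 4 *
    (Real.exp (c / 2 * y) - Real.exp (c / 2 * y) ^ 2) * Real.exp (-Real.exp (c / 2 * y)),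
    dΨ, fun y => ?_, fun y => by positivity, fun y => ?_⟩
  · have : Real.exp (c / 2 * x) ≤ Real.exp (c / 2 * y) := Real.exp_le_exp.2 (by nlinarith)
    have := Real.exp_le_exp.2 (neg_le_neg this)
    linarith
  · exact (((dξ y).const_mul (c / 2)).mul (dG y)).congr_deriv (by ring)
  · set ξ := Real.exp (c / 2 * y)
    set G := Real.exp (-ξ)
    have h1 := mul_le_mul_of_nonneg_left (hΦ y) hb.le
    -- This identity is the source of the hypothesis Φ ≤ K (ξ + ξ²).
    have e : c ^ 2 / 4 * (ξ - ξ ^ 2) * G - c * (c / 2 * ξ * G) + b * Φ y * (1 - (1 - G)) =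
        G * (b * Φ y - c ^ 2 / 4 * (ξ + ξ ^ 2)) := by ring
    rw [e, ← hbK]
    exact mul_nonpos_of_nonneg_of_nonpos (Real.exp_pos _).le (by linarith)

/-- Comparison with a super-solution whose second component is `1 - exp (-e^{c s/2})`. -/
lemma IsProfile.speed_le_of_isSupersolution {c₂ h k₁ k₂ : ℝ} (hr : 1 < r) (hb : 0 < b)
    (hh : 0 ≤ h) (H : IsProfile r b c₂ (c₂ * h) φ φ' ψ ψ') (hc : 0 < c)
    (W : IsSupersolution r b c (c * h) Φ (fun s => 1 - Real.exp (-Real.exp (c / 2 * s))))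
    (hk₁ : 0 < k₁) (hk₂ : 0 < k₂)
    (hΦ : ∀ s, min (k₁ * Real.exp (3 * c / 4 * s)) (k₂ * Real.exp (c / 2 * s)) ≤ Φ s)
    (hbot : Tendsto Φ atBot (𝓝 0)) : c₂ ≤ c := by
  have hc2 : 0 < c / 2 := by linarith
  have hc3 : 0 < 3 * c / 4 := by linarith
  have hshift : ∀ a s σ : ℝ, Real.exp (a * (s + σ)) = Real.exp (a * σ) * Real.exp (a * s) :=
    fun a s σ => by rw [← Real.exp_add]; congr 1; ring
  have htop : ∀ σ y : ℝ, ∀ᶠ s in atTop, y < Φ (s + σ) := by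
    intro σ y
    filter_upwards [(tendsto_const_mul_exp_atTop hc3
      (by positivity : 0 < k₁ * Real.exp (3 * c / 4 * σ))).eventually_gt_atTop y,
      (tendsto_const_mul_exp_atTop hc2
      (by positivity : 0 < k₂ * Real.exp (c / 2 * σ))).eventually_gt_atTop y] with s h1 h2
    refine lt_of_lt_of_le (lt_min ?_ ?_) (hΦ (s + σ))
    · rwa [hshift, ← mul_assoc]
    · rwa [hshift, ← mul_assoc]
  obtain ⟨l, C, hl, hC, hφ⟩ := H.exists_φ_le_exp hr hb
  obtain ⟨A, hA, -, hψ⟩ := H.exists_tendsto_ψ_mul_exp hr hb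
  obtain ⟨m, B, hB, hm⟩ := H.exists_exp_le_one_sub_ψ hb
  refine W.speed_le hr hb hh H (fun hlt σ => ?_) (fun σ => ?_) hbot (fun y hy => ?_)
  · have hξ : Tendsto (fun s => Real.exp (c / 2 * (s + σ))) atBot (𝓝 0) :=
      Real.tendsto_exp_atBot.comp ((tendsto_const_mul_atBot_of_pos hc2).2
        (tendsto_atBot_add_const_right _ σ tendsto_id))
    filter_upwards [eventually_exp_mul_lt_atBot (C := C) (by linarith : 3 * c / 4 < l)
      (by positivity : 0 < k₁ * Real.exp (3 * c / 4 * σ)),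
      eventually_exp_mul_lt_atBot (C := C) (by linarith : c / 2 < l)
      (by positivity : 0 < k₂ * Real.exp (c / 2 * σ)),
      eventually_exp_mul_lt_atBot (C := A) (by linarith : c / 2 < c₂)
      (by positivity : 0 < 1 / 2 * Real.exp (c / 2 * σ)),
      hξ.eventually (gt_mem_nhds (one_pos))] with s h1 h2 h3 h4
    constructor
    · refine (hφ s).trans_lt (lt_of_lt_of_le (lt_min ?_ ?_) (hΦ (s + σ)))
      · rwa [hshift, ← mul_assoc]
      · rwa [hshift, ← mul_assoc]
    · refine (hψ s).trans_lt (h3.trans_le ?_)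
      rw [mul_assoc, ← hshift]
      set ξ := Real.exp (c / 2 * (s + σ))
      have hξ0 : 0 < ξ := Real.exp_pos _
      -- For ξ < 1 this yields 1 - e^{-ξ} ≥ ξ/2, which exceeds ψ near -∞ since c/2 < c₂.
      have h5 : Real.exp (-ξ) ≤ 1 / (1 + ξ) := by
        rw [Real.exp_neg, ← one_div]
        exact one_div_le_one_div_of_le (by linarith) (by linarith [Real.add_one_le_exp ξ])
      have h6 : 1 / (1 + ξ) ≤ 1 - 1 / 2 * ξ := by
        rw [div_le_iff₀ (by linarith)]
        nlinarith
      linarith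
  · refine (htop σ 1).and ?_ |>.mono (fun s hs => ⟨(H.φ_le s).trans_lt hs.1, hs.2⟩)
    have h1 : Tendsto (fun s : ℝ => Real.exp s / s ^ 1) atTop atTop :=
      Real.tendsto_exp_div_pow_atTop 1
    have h2 : Tendsto (fun s : ℝ => c / 2 * (s + σ)) atTop atTop :=
      (tendsto_const_mul_atTop_of_pos hc2).2 (tendsto_atTop_add_const_right _ σ tendsto_id)
    have h3 := (h1.comp h2).eventually_gt_atTop (2 * (|m| + 1) / c)
    filter_upwards [h3, eventually_ge_atTop 0, eventually_gt_atTop (-σ),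
      eventually_gt_atTop (-Real.log B + |m| * |σ| + |σ|)] with s hs hs0 hsσ hsB
    have hsσ' : 0 < s + σ := by linarith
    simp only [Function.comp_apply, pow_one] at hs
    rw [lt_div_iff₀ (by positivity)] at hs
    have e : 2 * (|m| + 1) / c * (c / 2 * (s + σ)) = (|m| + 1) * (s + σ) := by
      field_simp
    rw [e] at hs
    -- At +∞ the doubly exponential gap 1 - Ψ is beaten by the at most exponential decay of 1 - ψ.
    have h4 : Real.exp (-Real.exp (c / 2 * (s + σ))) < B * Real.exp (-(m * s)) := by
      rw [← Real.exp_log hB, ← Real.exp_add, Real.exp_lt_exp]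
      have h5 := mul_le_mul_of_nonneg_right (le_abs_self m) hs0
      have h6 := mul_le_mul_of_nonneg_left (neg_abs_le σ) (abs_nonneg m)
      have h7 := neg_abs_le σ
      nlinarith
    linarith [hm s hs0]
  · refine (((htop 0 y).mono fun s hs => by simpa using hs)).and ?_
    have h1 : Tendsto (fun s => 1 - Real.exp (-Real.exp (c / 2 * s))) atTop (𝓝 (1 - 0)) :=
      ((Real.tendsto_exp_neg_atTop_nhds_zero.comp (Real.tendsto_exp_atTop.comp
        ((tendsto_const_mul_atTop_of_pos hc2).2 tendsto_id)))).const_sub 1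
    rw [sub_zero] at h1
    exact h1.eventually (lt_mem_nhds hy)

/-- The bound of the speed by a root of `f(c², r, b, h) = 0`, in exponential form. -/
theorem IsProfile.speed_le_of_eq_exp {c₂ h η κ : ℝ} (hr : 1 < r) (hb : 0 < b) (hh : 0 ≤ h)
    (H : IsProfile r b c₂ (c₂ * h) φ φ' ψ ψ') (hc : 0 < c) (hη : r * η = r - 1 + c ^ 2 / 4)
    (hκ : Real.exp (-(411 / 100 * η)) ≤ κ)
    (hK : c ^ 2 / 4 = b * (r * Real.exp (-(c ^ 2 * h / 2)) * κ)) : c₂ ≤ c := by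
  have hr0 : 0 < r := by linarith
  have hκ0 : 0 < κ := (Real.exp_pos _).trans_le hκ
  set p := Real.exp (-(c ^ 2 * h / 4)) with hp
  have hp0 : 0 < p := Real.exp_pos _
  have hp1 : p ≤ 1 := Real.exp_le_one_iff.2 (by
    have : 0 ≤ c ^ 2 * h / 4 := by positivity
    linarith)
  have hpq : Real.exp (-(c ^ 2 * h / 2)) = p ^ 2 := by
    rw [hp, ← Real.exp_nat_mul]; congr 1; push_cast; ring
  rw [hpq] at hK
  set K := r * p ^ 2 * κ with hKdef
  have hK0 : 0 < K := by positivity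
  have hη0 : 0 ≤ η := by
    have : 0 ≤ r * η := by rw [hη]; have := sq_nonneg c; linarith
    exact nonneg_of_mul_nonneg_right this hr0
  have hx : c ^ 2 / 4 ≤ r * η := by rw [hη]; linarith
  have hc2 : 0 < c / 2 := by linarith
  have hc3 : 0 < 3 * c / 4 := by linarith
  have hdelay : ∀ s, Real.exp (c / 2 * (s - c * h)) = p ^ 2 * Real.exp (c / 2 * s) := fun s => by
    rw [← hpq, ← Real.exp_add]; congr 1; ring
  have mexp : ∀ a k : ℝ, 0 < a → 0 < k → Monotone fun s => k * Real.exp (a * s) :=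
    fun a k ha hk x y hxy => mul_le_mul_of_nonneg_left
      (Real.exp_le_exp.2 (mul_le_mul_of_nonneg_left hxy ha.le)) hk.le
  have dexp : ∀ a k y : ℝ, HasDerivAt (fun s => k * Real.exp (a * s))
      (a * (k * Real.exp (a * y))) y := fun a k y =>
    ((hasDerivAt_exp_mul a y).const_mul k).congr_deriv (by ring)
  have hu : ∀ s, Real.exp (c / 4 * s) ^ 2 = Real.exp (c / 2 * s) := fun s => by
    rw [← Real.exp_nat_mul]; congr 1; push_cast; ring
  have hu3 : ∀ s, Real.exp (c / 4 * s) ^ 3 = Real.exp (3 * c / 4 * s) := fun s => by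
    rw [← Real.exp_nat_mul]; congr 1; push_cast; ring
  -- With 1 - r - c²/4 = -r η and z ≤ 1 - e^{-E}, a multiple F = r m κ E of e^{cs/2} is admissible
  -- as soon as 1 - η ≤ e^{-E} + m κ E.
  have linear_piece : ∀ m E z F : ℝ, 0 ≤ F → 1 - η ≤ Real.exp (-E) + m * (κ * E) →
      F = r * (m * (κ * E)) → z ≤ 1 - Real.exp (-E) →
      c / 2 * (c / 2 * F) - c * (c / 2 * F) + F * (1 - r - F + r * z) ≤ 0 := by
    intro m E z F hF h1 h2 h3
    have h4 := mul_le_mul_of_nonneg_left h3 hr0.le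
    have h5 := mul_le_mul_of_nonneg_left h1 hr0.le
    have e : c / 2 * (c / 2 * F) - c * (c / 2 * F) + F * (1 - r - F + r * z) =
        F * (1 - r - F + r * z - c ^ 2 / 4) := by ring
    rw [e]
    exact mul_nonpos_of_nonneg_of_nonpos hF (by nlinarith)
  rcases le_total η (23 / 200) with hsmall | hlarge
  · have W := isSupersolution_one_sub_exp (r := r) (d := c * h) hc hK.symm hb
      (Φ := fun s => K * Real.exp (c / 2 * s)) (by fun_prop) (mexp _ _ hc2 hK0) (fun s => by
        refine mul_le_mul_of_nonneg_left ?_ hK0.le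
        have := sq_nonneg (Real.exp (c / 2 * s))
        linarith) (fun s => by
        refine ⟨_, _, _, dexp _ K, (dexp _ K s).const_mul (c / 2), fun y => le_rfl, rfl,
          by positivity, fun z _ hz => ?_⟩
        rw [hdelay] at hz
        refine linear_piece 1 (p ^ 2 * Real.exp (c / 2 * s)) z _ (by positivity) ?_
          (by rw [hKdef]; ring) hz
        rw [one_mul]
        exact one_sub_le_exp_neg_add_of_small hη0 hsmall hκ (by positivity))
    exact H.speed_le_of_isSupersolution hr hb hh hc W one_pos hK0 (fun s => min_le_right _ _)
      (tendsto_const_mul_exp_atBot K hc2)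
  -- For larger η two pieces are needed. In terms of u = p e^{cs/4} they are proportional to 2u³ and
  -- (17/10)u², so they cross at u = 17/20.
  · set f₁ := fun s : ℝ => 2 * K * p * Real.exp (3 * c / 4 * s) with hf₁
    set f₂ := fun s : ℝ => 17 / 10 * K * Real.exp (c / 2 * s) with hf₂
    have W := isSupersolution_one_sub_exp (r := r) (d := c * h) hc hK.symm hb
      (Φ := fun s => min (f₁ s) (f₂ s)) (by fun_prop)
      ((mexp _ _ hc3 (by positivity)).min (mexp _ _ hc2 (by positivity))) (fun s => by
        refine (min_le_left _ _).trans ?_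
        simp only [hf₁]
        rw [← hu3, ← hu]
        set u := Real.exp (c / 4 * s)
        have hu0 : 0 < u := Real.exp_pos _
        have h1 : 2 * K * p * u ^ 3 ≤ 2 * K * 1 * u ^ 3 := by gcongr
        -- 2u³ ≤ u² + u⁴: this is how the exponent 3c/4 meets the bound K (ξ + ξ²).
        have h2 : 0 ≤ K * (u * (u - 1)) ^ 2 := by positivity
        nlinarith) (fun s => by
        set u := p * Real.exp (c / 4 * s) with hudef
        have hu0 : 0 < u := by positivity
        have hE : p ^ 2 * Real.exp (c / 2 * s) = u ^ 2 := by rw [hudef, ← hu]; ring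
        have e1 : f₁ s = 2 * (r * (κ * u ^ 3)) := by
          simp only [hf₁]; rw [hudef, hKdef, ← hu3]; ring
        have e2 : f₂ s = r * (17 / 10 * (κ * u ^ 2)) := by
          simp only [hf₂]; rw [hudef, hKdef, ← hu]; ring
        have hcmp : f₁ s ≤ f₂ s ↔ u ≤ 17 / 20 := by
          have e3 : f₂ s - f₁ s = 2 * (r * (κ * u ^ 2)) * (17 / 20 - u) := by rw [e1, e2]; ring
          rw [← sub_nonneg, e3, mul_nonneg_iff_of_pos_left (by positivity), sub_nonneg]
        rcases le_total (f₁ s) (f₂ s) with hle | hle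
        · have hmin : min (f₁ s) (f₂ s) = f₁ s := min_eq_left hle
          refine ⟨f₁, _, _, dexp _ _, (dexp _ _ s).const_mul (3 * c / 4),
            fun y => min_le_left _ _, hmin.symm, by positivity, fun z _ hz => ?_⟩
          simp only [hmin]
          rw [hdelay, hE] at hz
          have h1 := one_sub_le_exp_neg_add_pow hlarge hκ hu0.le (hcmp.1 hle)
          have h4 := mul_le_mul_of_nonneg_left hz hr0.le
          have h5 := mul_le_mul_of_nonneg_left h1 hr0.le
          -- The exponent λ = 3c/4 has λ² - cλ = -(3/4)(c²/4), which explains the 3/4 in front of η.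
          have e : 3 * c / 4 * (3 * c / 4 * (2 * K * p * Real.exp (3 * c / 4 * s))) -
              c * (3 * c / 4 * (2 * K * p * Real.exp (3 * c / 4 * s))) +
              f₁ s * (1 - r - f₁ s + r * z) =
              f₁ s * (1 - r - f₁ s + r * z - 3 / 4 * (c ^ 2 / 4)) := by
            simp only [hf₁]; ring
          rw [e]
          refine mul_nonpos_of_nonneg_of_nonpos (by simp only [hf₁]; positivity) ?_
          have h6 : f₁ s = 2 * (r * (κ * u ^ 3)) := e1
          nlinarith
        · have hmin : min (f₁ s) (f₂ s) = f₂ s := min_eq_right hle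
          refine ⟨f₂, _, _, dexp _ _, (dexp _ _ s).const_mul (c / 2),
            fun y => min_le_right _ _, hmin.symm, by positivity, fun z _ hz => ?_⟩
          simp only [hmin]
          rw [hdelay, hE] at hz
          have h1 : 17 / 20 ≤ u := by
            by_contra hcon
            push Not at hcon
            have e3 : f₂ s - f₁ s = 2 * (r * (κ * u ^ 2)) * (17 / 20 - u) := by rw [e1, e2]; ring
            have : 0 < 2 * (r * (κ * u ^ 2)) * (17 / 20 - u) :=
              mul_pos (by positivity) (by linarith)
            linarith
          exact linear_piece (17 / 10) (u ^ 2) z (f₂ s) (by simp only [hf₂]; positivity)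
            (one_sub_le_exp_neg_add hκ (by nlinarith)) e2 hz)
    exact H.speed_le_of_isSupersolution hr hb hh hc W (by positivity : 0 < 2 * K * p)
      (by positivity : 0 < 17 / 10 * K) (fun s => le_rfl)
      (by simpa using (tendsto_const_mul_exp_atBot _ hc3).min (tendsto_const_mul_exp_atBot _ hc2))

end SpeedBounds

/-! ### Unique solvability of the equations for c_# and c_o. -/

section SpeedBoundRoots

variable {r b h c : ℝ}

lemma bPrime_pos (hb : 0 < b) (h c : ℝ) : 0 < bPrime b h c := mul_pos hb (Real.exp_pos _)

/-- For r > 1 the first entry of the maximum is zero, and squaring the rest loses nothing for c > 0.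
-/
lemma isCSharp_iff (hr : 1 < r) (hb : 0 < b) :
    IsCSharp r b h c ↔ 0 < c ∧ c ^ 2 / 4 = bPrime b h c / (1 + bPrime b h c) := by
  have hB := bPrime_pos hb h c
  set B := bPrime b h c with hBdef
  have hs : Real.sqrt (1 - r) = 0 := Real.sqrt_eq_zero'.2 (by linarith)
  have hq : 0 ≤ B / (1 + B) := by positivity
  rw [IsCSharp, hs, ← hBdef, ← Real.sqrt_div hB.le, max_eq_right (Real.sqrt_nonneg _)]
  refine and_congr_right fun hc => ⟨fun e => ?_, fun e => ?_⟩
  · rw [e, mul_pow, Real.sq_sqrt hq]; ring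
  · rw [← e, show c ^ 2 / 4 = (c / 2) ^ 2 by ring, Real.sqrt_sq (by linarith)]; ring

lemma div_one_add_le_div_one_add {x y : ℝ} (hx : 0 < x) (hxy : x ≤ y) :
    x / (1 + x) ≤ y / (1 + y) := by
  rw [div_le_div_iff₀ (by linarith) (by linarith)]
  nlinarith

/-- On c > 0 the function c²/4 is strictly increasing and b'/(1 + b') is non-increasing; their
difference changes sign between 0 and 2. -/
lemma existsUnique_isCSharp (hr : 1 < r) (hb : 0 < b) (hh : 0 ≤ h) :
    ∃ cs, ∀ x, IsCSharp r b h x ↔ x = cs := by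
  set F := fun c : ℝ => c ^ 2 / 4 - bPrime b h c / (1 + bPrime b h c) with hF
  have cB : Continuous fun c => bPrime b h c := by unfold bPrime; fun_prop
  have cF : Continuous F := by
    refine Continuous.sub (by fun_prop) (cB.div (by fun_prop) fun x => ?_)
    have := bPrime_pos hb h x
    positivity
  have mF : ∀ x y, 0 < x → x < y → F x < F y := by
    intro x y hx hxy
    have h1 : bPrime b h y ≤ bPrime b h x := by
      refine mul_le_mul_of_nonneg_left (Real.exp_le_exp.2 ?_) hb.le
      have : x ^ 2 ≤ y ^ 2 := by gcongr
      nlinarith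
    have h2 := div_one_add_le_div_one_add (bPrime_pos hb h y) h1
    have h3 : x ^ 2 < y ^ 2 := by gcongr
    simp only [hF]
    linarith
  have h0 : F 0 < 0 := by
    have := bPrime_pos hb h 0
    have : 0 < bPrime b h 0 / (1 + bPrime b h 0) := by positivity
    simp only [hF]
    linarith
  have h2 : 0 ≤ F 2 := by
    have := bPrime_pos hb h 2
    have : bPrime b h 2 / (1 + bPrime b h 2) ≤ 1 := by
      rw [div_le_one (by linarith)]; linarith
    simp only [hF]
    linarith
  obtain ⟨c, hc, e⟩ := intermediate_value_Icc zero_le_two cF.continuousOn ⟨h0.le, h2⟩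
  have hc0 : 0 < c := lt_of_le_of_ne hc.1 fun hcon => by rw [← hcon] at e; linarith
  refine ⟨c, fun x => ?_⟩
  rw [isCSharp_iff hr hb]
  constructor
  · rintro ⟨hx, hxe⟩
    have hx' : F x = 0 := sub_eq_zero.2 hxe
    rcases lt_trichotomy x c with hlt | heq | hlt
    · linarith [mF x c hx hlt]
    · exact heq
    · linarith [mF c x hc0 hlt]
  · rintro rfl
    exact ⟨hc0, sub_eq_zero.1 e⟩

/-- The upper bound is the source of the constant 411/100. The root found is the greatest one
because beyond it w - 4 - 2 log w increases, by the tangent to the logarithm at ω ≥ 8. -/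
lemma exists_isOmegaStar : ∃ ω, IsOmegaStar ω ∧ 8 ≤ ω ∧ ω ≤ 822 / 100 := by
  have cg : ContinuousOn (fun w : ℝ => w - 4 - 2 * Real.log w) (Set.Icc 8 (822 / 100)) :=
    ContinuousOn.sub (by fun_prop) (ContinuousOn.mul continuousOn_const
      (Real.continuousOn_log.mono fun x hx => by
        simp only [Set.mem_compl_iff, Set.mem_singleton_iff]
        have := hx.1
        linarith))
  have l8 : Real.log 8 = 3 * Real.log 2 := by
    rw [show (8 : ℝ) = 2 ^ 3 by norm_num, Real.log_pow]; norm_num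
  have h8 : (8 : ℝ) - 4 - 2 * Real.log 8 ≤ 0 := by
    rw [l8]; linarith [Real.log_two_gt_d9]
  have h9 : (0 : ℝ) ≤ 822 / 100 - 4 - 2 * Real.log (822 / 100) := by
    have h1 : Real.log (822 / 100) = Real.log 8 + Real.log (822 / 800) := by
      rw [← Real.log_mul (by norm_num) (by norm_num)]; norm_num
    have h2 := Real.log_le_sub_one_of_pos (show (0 : ℝ) < 822 / 800 by norm_num)
    rw [h1, l8]
    linarith [Real.log_two_lt_d9]
  obtain ⟨ω, hω, e⟩ := intermediate_value_Icc (by norm_num) cg ⟨h8, h9⟩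
  simp only at e
  have hω8 := hω.1
  refine ⟨ω, ⟨⟨by linarith, by linarith⟩, ?_⟩, hω.1, hω.2⟩
  rintro w ⟨hw, hwe⟩
  by_contra hcon
  push Not at hcon
  have h1 := Real.log_le_sub_one_of_pos (show 0 < w / ω by positivity)
  rw [Real.log_div hw.ne' (by linarith)] at h1
  have h2 : w / ω - 1 ≤ (w - ω) / 8 := by
    rw [div_sub_one (by linarith)]
    exact div_le_div_of_nonneg_left (by linarith) (by norm_num) hω8
  linarith

lemma existsUnique_isCO (hr : 1 < r) (hb : 0 < b) (hh : 0 ≤ h) :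
    ∃ co, ∀ x, IsCO r b h x ↔ x = co := by
  obtain ⟨ω, hω, hω8, -⟩ := exists_isOmegaStar
  set A := ω / (8 * r) + h / 2 with hA
  set D := -(ω / 2 * ((1 - r) / r)) with hD
  have hr0 : 0 < r := by linarith
  have hA0 : 0 < A := by positivity
  have hD0 : 0 ≤ D := by
    have : (1 - r) / r ≤ 0 := div_nonpos_of_nonpos_of_nonneg (by linarith) hr0.le
    rw [hD, ← mul_neg]
    exact mul_nonneg (by linarith) (by linarith)
  set F := fun y : ℝ => fBZ ω y r b h with hF
  have eF : ∀ y, F y = y * A + Real.log (y / (4 * b * r)) + D := fun y => by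
    simp only [hF, fBZ]; ring
  have hbr : 0 < 4 * b * r := by positivity
  have mF : ∀ x y, 0 < x → x < y → F x < F y := by
    intro x y hx hxy
    rw [eF, eF]
    have h1 : Real.log (x / (4 * b * r)) < Real.log (y / (4 * b * r)) :=
      Real.log_lt_log (by positivity) (by gcongr)
    have h2 : x * A < y * A := by gcongr
    linarith
  -- At this point the logarithm cancels D and the largest possible value 4 b r A of the linear
  -- term, so F(y₁) ≤ 0.
  set y₁ := 4 * b * r * Real.exp (-(4 * b * r * A + D)) with hy₁
  have hy₁0 : 0 < y₁ := by positivity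
  have hy₁1 : y₁ ≤ 4 * b * r := by
    have h1 : Real.exp (-(4 * b * r * A + D)) ≤ 1 := Real.exp_le_one_iff.2 (by
      have : 0 ≤ 4 * b * r * A := by positivity
      linarith)
    exact mul_le_of_le_one_right hbr.le h1
  have cF : ContinuousOn F (Set.Icc y₁ (4 * b * r)) := by
    rw [show F = fun y => y * A + Real.log (y / (4 * b * r)) + D from funext eF]
    refine ((by fun_prop : ContinuousOn (fun y => y * A) _).add
      (ContinuousOn.log (by fun_prop) fun x hx => ?_)).add continuousOn_const
    have : 0 < x := hy₁0.trans_le hx.1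
    positivity
  have h1 : F y₁ ≤ 0 := by
    have : y₁ / (4 * b * r) = Real.exp (-(4 * b * r * A + D)) := by
      rw [hy₁]; field_simp
    rw [eF, this, Real.log_exp]
    have := mul_le_mul_of_nonneg_right hy₁1 hA0.le
    linarith
  have h2 : 0 ≤ F (4 * b * r) := by
    rw [eF, div_self hbr.ne', Real.log_one]
    positivity
  obtain ⟨y, hy, e⟩ := intermediate_value_Icc hy₁1 cF ⟨h1, h2⟩
  have hy0 : 0 < y := hy₁0.trans_le hy.1
  refine ⟨Real.sqrt y, fun x => ?_⟩
  constructor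
  · rintro ⟨ω', hω', hx, hxe⟩
    rw [hω'.unique hω] at hxe
    have hx' : F (x ^ 2) = 0 := hxe
    have : x ^ 2 = y := by
      rcases lt_trichotomy (x ^ 2) y with hlt | heq | hlt
      · linarith [mF _ y (by positivity) hlt]
      · exact heq
      · linarith [mF y _ hy0 hlt]
    rw [← this, Real.sqrt_sq hx.le]
  · rintro rfl
    exact ⟨ω, hω, Real.sqrt_pos.2 hy0, by rw [Real.sq_sqrt hy0.le]; exact e⟩

/-- The speed is at most any positive root of `f(c², r, b, h) = 0`. -/
theorem IsProfile.speed_le_of_isCO {c₂ : ℝ} {φ φ' ψ ψ' : ℝ → ℝ} (hr : 1 < r) (hb : 0 < b)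
    (hh : 0 ≤ h) (H : IsProfile r b c₂ (c₂ * h) φ φ' ψ ψ') (hco : IsCO r b h c) : c₂ ≤ c := by
  obtain ⟨ω', hω', hc, e⟩ := hco
  obtain ⟨ω, hω, -, hω2⟩ := exists_isOmegaStar
  obtain rfl := hω'.unique hω
  have hr0 : 0 < r := by linarith
  -- In terms of η the equation f = 0 exponentiates to c²/4 = b r e^{-c²h/2} e^{-ωη/2}.
  set η := (r - 1 + c ^ 2 / 4) / r with hη
  have hη0 : 0 ≤ η := div_nonneg (by have := sq_nonneg c; linarith) hr0.le
  refine H.speed_le_of_eq_exp hr hb hh hc (η := η) (κ := Real.exp (-(ω' / 2 * η)))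
    (by rw [hη]; field_simp) (Real.exp_le_exp.2 (by nlinarith)) ?_
  have h1 : Real.log (c ^ 2 / (4 * b * r)) = -(c ^ 2 * h / 2) + -(ω' / 2 * η) := by
    have h2 : c ^ 2 * (ω' / (8 * r)) - ω' / 2 * ((1 - r) / r) = ω' / 2 * η := by
      rw [hη]; field_simp; ring
    rw [fBZ] at e
    linarith
  have h3 : c ^ 2 / (4 * b * r) = Real.exp (-(c ^ 2 * h / 2)) * Real.exp (-(ω' / 2 * η)) := by
    rw [← Real.exp_add, ← h1, Real.exp_log (by positivity)]
  rw [div_eq_iff (by positivity)] at h3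
  linear_combination h3 / 4

end SpeedBoundRoots

/-! ### The linear Dirichlet problem on an interval. -/

section LinearDirichlet

open MeasureTheory

/-- The solution of `v' = a v + g`, `v 0 = 0`. -/
noncomputable def expConv (a : ℝ) (g : ℝ → ℝ) (x : ℝ) : ℝ :=
  Real.exp (a * x) * ∫ y in (0 : ℝ)..x, Real.exp (-(a * y)) * g y

variable {a M l₁ l₂ ℓ : ℝ} {g : ℝ → ℝ}

lemma expConv_zero : expConv a g 0 = 0 := by simp [expConv]

lemma hasDerivAt_expConv (hg : Continuous g) (x : ℝ) :
    HasDerivAt (expConv a g) (a * expConv a g x + g x) x := by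
  have hc : Continuous fun y => Real.exp (-(a * y)) * g y := by fun_prop
  have h1 := hc.integral_hasStrictDerivAt 0 x |>.hasDerivAt
  have h2 : HasDerivAt (fun x : ℝ => a * x) (a * 1) x := (hasDerivAt_id x).const_mul a
  refine (h2.exp.mul h1).congr_deriv ?_
  have h3 : Real.exp (a * x) * Real.exp (-(a * x)) = 1 := by rw [← Real.exp_add]; simp
  simp only [expConv]
  linear_combination g x * h3

lemma intervalIntegrable_exp_mul (hg : Measurable g) (hM : ∀ y, |g y| ≤ M) (x z : ℝ) :
    IntervalIntegrable (fun y => Real.exp (-(a * y)) * g y) volume x z := by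
  have h1 : IntervalIntegrable (fun y => M * Real.exp (-(a * y))) volume x z :=
    Continuous.intervalIntegrable (by fun_prop) _ _
  refine h1.mono_fun ?_ (Eventually.of_forall fun y => ?_)
  · exact (Measurable.mul (by fun_prop) hg).aestronglyMeasurable
  · have h0 : 0 ≤ M := (abs_nonneg _).trans (hM y)
    simp only [Real.norm_eq_abs, abs_mul, abs_of_pos (Real.exp_pos _), abs_of_nonneg h0]
    rw [mul_comm]
    exact mul_le_mul_of_nonneg_right (hM y) (Real.exp_pos _).le

/-- Only measurability is assumed because g will be a pointwise limit of the iteration, not known to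
be continuous beforehand. -/
lemma continuous_expConv (hg : Measurable g) (hM : ∀ y, |g y| ≤ M) : Continuous (expConv a g) := by
  have h1 := intervalIntegral.continuous_primitive
    (fun x z => intervalIntegrable_exp_mul (a := a) hg hM x z) 0
  unfold expConv
  fun_prop

lemma tendsto_expConv {G : ℕ → ℝ → ℝ} (hG : ∀ n, Measurable (G n)) (hM : ∀ n y, |G n y| ≤ M)
    (hlim : ∀ y, Tendsto (fun n => G n y) atTop (𝓝 (g y))) (x : ℝ) :
    Tendsto (fun n => expConv a (G n) x) atTop (𝓝 (expConv a g x)) := by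
  refine Tendsto.const_mul _ ?_
  refine intervalIntegral.tendsto_integral_filter_of_dominated_convergence
    (fun y => M * Real.exp (-(a * y))) (Eventually.of_forall fun n => ?_)
    (Eventually.of_forall fun n => Eventually.of_forall fun y _ => ?_)
    (Continuous.intervalIntegrable (by fun_prop) _ _) (Eventually.of_forall fun y _ => ?_)
  · exact (Measurable.mul (by fun_prop) (hG n)).aestronglyMeasurable
  · simp only [Real.norm_eq_abs, abs_mul, abs_of_pos (Real.exp_pos _)]
    rw [mul_comm]
    exact mul_le_mul_of_nonneg_right (hM n y) (Real.exp_pos _).le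
  · exact (hlim y).const_mul _

/-- The solution of `N'' - (l₁ + l₂) N' + l₁ l₂ N = g`, `N 0 = N' 0 = 0`. -/
noncomputable def secondOrderConv (l₁ l₂ : ℝ) (g : ℝ → ℝ) (x : ℝ) : ℝ :=
  (expConv l₁ g x - expConv l₂ g x) / (l₁ - l₂)

/-- The solution of `v'' - (l₁ + l₂) v' + l₁ l₂ v = -g`, `v 0 = 0`, `v ℓ = 1`. -/
noncomputable def dirichletSol (l₁ l₂ ℓ : ℝ) (g : ℝ → ℝ) (x : ℝ) : ℝ :=
  (Real.exp (l₁ * x) - Real.exp (l₂ * x)) / (Real.exp (l₁ * ℓ) - Real.exp (l₂ * ℓ)) *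
    (1 + secondOrderConv l₁ l₂ g ℓ) - secondOrderConv l₁ l₂ g x

/-- The derivative of `dirichletSol`. -/
noncomputable def dirichletSolDeriv (l₁ l₂ ℓ : ℝ) (g : ℝ → ℝ) (x : ℝ) : ℝ :=
  (l₁ * Real.exp (l₁ * x) - l₂ * Real.exp (l₂ * x)) / (Real.exp (l₁ * ℓ) - Real.exp (l₂ * ℓ)) *
    (1 + secondOrderConv l₁ l₂ g ℓ) - (l₁ * expConv l₁ g x - l₂ * expConv l₂ g x) / (l₁ - l₂)

lemma dirichletSol_zero : dirichletSol l₁ l₂ ℓ g 0 = 0 := by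
  simp [dirichletSol, secondOrderConv, expConv_zero]

lemma dirichletSol_right (hl : l₂ < l₁) (hℓ : 0 < ℓ) : dirichletSol l₁ l₂ ℓ g ℓ = 1 := by
  have h : Real.exp (l₂ * ℓ) < Real.exp (l₁ * ℓ) := Real.exp_lt_exp.2 (by gcongr)
  rw [dirichletSol, div_self (by linarith)]
  ring

lemma hasDerivAt_dirichletSol (hl : l₂ < l₁) (hg : Continuous g) (x : ℝ) :
    HasDerivAt (dirichletSol l₁ l₂ ℓ g) (dirichletSolDeriv l₁ l₂ ℓ g x) x := by
  have e : ∀ a : ℝ, HasDerivAt (fun x : ℝ => Real.exp (a * x)) (a * Real.exp (a * x)) x := fun a =>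
    (((hasDerivAt_id x).const_mul a).exp).congr_deriv (by simp; ring)
  have hne : l₁ - l₂ ≠ 0 := by linarith
  refine (((((e l₁).sub (e l₂)).div_const _).mul_const _).sub
    (((hasDerivAt_expConv (a := l₁) hg x).sub
      (hasDerivAt_expConv (a := l₂) hg x)).div_const _)).congr_deriv ?_
  rw [dirichletSolDeriv]
  congr 1
  congr 1
  ring

lemma hasDerivAt_dirichletSolDeriv (hl : l₂ < l₁) (hg : Continuous g) (x : ℝ) :
    HasDerivAt (dirichletSolDeriv l₁ l₂ ℓ g) ((l₁ + l₂) * dirichletSolDeriv l₁ l₂ ℓ g x -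
      l₁ * l₂ * dirichletSol l₁ l₂ ℓ g x - g x) x := by
  have e : ∀ a : ℝ, HasDerivAt (fun x : ℝ => a * Real.exp (a * x))
      (a * (a * Real.exp (a * x))) x := fun a =>
    ((((hasDerivAt_id x).const_mul a).exp).const_mul a).congr_deriv (by simp only [id_eq]; ring)
  have hne : l₁ - l₂ ≠ 0 := by linarith
  refine (((((e l₁).sub (e l₂)).div_const _).mul_const _).sub
    ((((hasDerivAt_expConv (a := l₁) hg x).const_mul l₁).sub
      ((hasDerivAt_expConv (a := l₂) hg x).const_mul l₂)).div_const _)).congr_deriv ?_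
  rw [dirichletSolDeriv, dirichletSol, secondOrderConv, secondOrderConv]
  generalize (1 + (expConv l₁ g ℓ - expConv l₂ g ℓ) / (l₁ - l₂)) = A
  generalize Real.exp (l₁ * ℓ) - Real.exp (l₂ * ℓ) = B
  simp only [div_eq_mul_inv]
  have h3 : (l₁ - l₂) * (l₁ - l₂)⁻¹ = 1 := mul_inv_cancel₀ hne
  linear_combination (-g x) * h3

lemma continuous_dirichletSol (hg : Measurable g) (hM : ∀ y, |g y| ≤ M) :
    Continuous (dirichletSol l₁ l₂ ℓ g) := by
  have h1 := continuous_expConv (a := l₁) hg hM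
  have h2 := continuous_expConv (a := l₂) hg hM
  unfold dirichletSol secondOrderConv
  fun_prop

lemma tendsto_dirichletSol {G : ℕ → ℝ → ℝ} (hG : ∀ n, Measurable (G n))
    (hM : ∀ n y, |G n y| ≤ M) (hlim : ∀ y, Tendsto (fun n => G n y) atTop (𝓝 (g y))) (x : ℝ) :
    Tendsto (fun n => dirichletSol l₁ l₂ ℓ (G n) x) atTop (𝓝 (dirichletSol l₁ l₂ ℓ g x)) := by
  have h : ∀ x, Tendsto (fun n => secondOrderConv l₁ l₂ (G n) x) atTop
      (𝓝 (secondOrderConv l₁ l₂ g x)) := fun x =>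
    ((tendsto_expConv hG hM hlim x).sub (tendsto_expConv hG hM hlim x)).div_const _
  exact (((h ℓ).const_add 1).const_mul _).sub (h x)

/-- The weak maximum principle. -/
lemma nonneg_of_deriv_deriv_le {c k : ℝ} (hk : 0 < k) {v v' v'' : ℝ → ℝ}
    (hv : ContinuousOn v (Set.Icc 0 ℓ)) (h1 : ∀ x ∈ Set.Ioo 0 ℓ, HasDerivAt v (v' x) x)
    (h2 : ∀ x ∈ Set.Ioo 0 ℓ, HasDerivAt v' (v'' x) x)
    (h : ∀ x ∈ Set.Ioo 0 ℓ, v'' x - c * v' x - k * v x ≤ 0) (h0 : 0 ≤ v 0) (hℓ : 0 ≤ v ℓ) :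
    ∀ x ∈ Set.Icc 0 ℓ, 0 ≤ v x := by
  intro x hx
  by_contra hneg
  push Not at hneg
  obtain ⟨z, hz, hmin⟩ := isCompact_Icc.exists_isMinOn ⟨x, hx⟩ hv
  have hz' : v z < 0 := (hmin hx).trans_lt hneg
  have hz2 : z ∈ Set.Ioo 0 ℓ := by
    refine ⟨lt_of_le_of_ne hz.1 fun e => ?_, lt_of_le_of_ne hz.2 fun e => ?_⟩
    · rw [← e] at hz'; linarith
    · rw [e] at hz'; linarith
  have hm : IsLocalMin v z := hmin.isLocalMin (Icc_mem_nhds hz2.1 hz2.2)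
  have h3 := hm.second_order (by
    filter_upwards [Ioo_mem_nhds hz2.1 hz2.2] with y hy using h1 y hy) (h2 z hz2)
  have h4 := h z hz2
  rw [h3.1] at h4
  nlinarith

lemma dirichletSol_le (hl : l₂ < l₁) (hl' : l₁ * l₂ < 0) (hℓ : 0 < ℓ) {g₁ g₂ : ℝ → ℝ}
    (hg₁ : Continuous g₁) (hg₂ : Continuous g₂) (h : ∀ x ∈ Set.Icc 0 ℓ, g₁ x ≤ g₂ x) :
    ∀ x ∈ Set.Icc 0 ℓ, dirichletSol l₁ l₂ ℓ g₁ x ≤ dirichletSol l₁ l₂ ℓ g₂ x := by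
  intro x hx
  have d : ∀ x, HasDerivAt (fun x => dirichletSol l₁ l₂ ℓ g₂ x - dirichletSol l₁ l₂ ℓ g₁ x) _ x :=
    fun x => (hasDerivAt_dirichletSol hl hg₂ x).sub (hasDerivAt_dirichletSol hl hg₁ x)
  have := nonneg_of_deriv_deriv_le (k := -(l₁ * l₂)) (c := l₁ + l₂) (ℓ := ℓ) (by linarith)
    (fun x _ => (d x).continuousAt.continuousWithinAt) (fun x _ => d x)
    (fun x _ => (hasDerivAt_dirichletSolDeriv hl hg₂ x).sub (hasDerivAt_dirichletSolDeriv hl hg₁ x))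
    (fun x hx => by have := h x (Set.Ioo_subset_Icc_self hx); linarith)
    (by simp [dirichletSol_zero]) (by simp [dirichletSol_right hl hℓ]) x hx
  linarith

lemma dirichletSol_nonneg (hl : l₂ < l₁) (hl' : l₁ * l₂ < 0) (hℓ : 0 < ℓ)
    (hg : Continuous g) (h : ∀ x ∈ Set.Icc 0 ℓ, 0 ≤ g x) :
    ∀ x ∈ Set.Icc 0 ℓ, 0 ≤ dirichletSol l₁ l₂ ℓ g x :=
  nonneg_of_deriv_deriv_le (k := -(l₁ * l₂)) (c := l₁ + l₂) (by linarith)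
    (fun x _ => (hasDerivAt_dirichletSol hl hg x).continuousAt.continuousWithinAt)
    (fun x _ => hasDerivAt_dirichletSol hl hg x)
    (fun x _ => hasDerivAt_dirichletSolDeriv hl hg x)
    (fun x hx => by have := h x (Set.Ioo_subset_Icc_self hx); linarith)
    dirichletSol_zero.ge (by rw [dirichletSol_right hl hℓ]; exact zero_le_one)

lemma dirichletSol_le_one (hl : l₂ < l₁) (hl' : l₁ * l₂ < 0) (hℓ : 0 < ℓ)
    (hg : Continuous g) (h : ∀ x ∈ Set.Icc 0 ℓ, g x ≤ -(l₁ * l₂)) :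
    ∀ x ∈ Set.Icc 0 ℓ, dirichletSol l₁ l₂ ℓ g x ≤ 1 := by
  intro x hx
  have d : ∀ x, HasDerivAt (fun x => 1 - dirichletSol l₁ l₂ ℓ g x) _ x :=
    fun x => (hasDerivAt_dirichletSol hl hg x).const_sub 1
  have := nonneg_of_deriv_deriv_le (k := -(l₁ * l₂)) (c := l₁ + l₂) (ℓ := ℓ) (by linarith)
    (fun x _ => (d x).continuousAt.continuousWithinAt) (fun x _ => d x)
    (fun x _ => (hasDerivAt_dirichletSolDeriv hl hg x).neg)
    (fun x hx => by have := h x (Set.Ioo_subset_Icc_self hx); linarith)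
    (by simp [dirichletSol_zero]) (by simp [dirichletSol_right hl hℓ]) x hx
  linarith

end LinearDirichlet

/-! ### Monotone iteration for the Dirichlet problem without delay. -/

section DirichletProblem

/-- A solution with values in `[0, 1]` of the profile equations without delay on `[0, ℓ]`, which
connects `(0, 0)` with `(1, 1)`. -/
structure IsDirichletSolution (r b c ℓ : ℝ) (φ φ' ψ ψ' : ℝ → ℝ) : Prop where
  cont_φ : ContinuousOn φ (Set.Icc 0 ℓ)
  cont_ψ : ContinuousOn ψ (Set.Icc 0 ℓ)
  dφ : ∀ x ∈ Set.Ioo 0 ℓ, HasDerivAt φ (φ' x) x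
  dφ' : ∀ x ∈ Set.Ioo 0 ℓ, HasDerivAt φ' (c * φ' x - φ x * (1 - r - φ x + r * ψ x)) x
  dψ : ∀ x ∈ Set.Ioo 0 ℓ, HasDerivAt ψ (ψ' x) x
  dψ' : ∀ x ∈ Set.Ioo 0 ℓ, HasDerivAt ψ' (c * ψ' x - b * φ x * (1 - ψ x)) x
  φ_zero : φ 0 = 0
  ψ_zero : ψ 0 = 0
  φ_right : φ ℓ = 1
  ψ_right : ψ ℓ = 1
  mem_φ : ∀ x ∈ Set.Icc 0 ℓ, φ x ∈ Set.Icc 0 1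
  mem_ψ : ∀ x ∈ Set.Icc 0 ℓ, ψ x ∈ Set.Icc 0 1

/-- The first component of the right-hand side of the monotone iteration. -/
def iterRhsFst (r k : ℝ) (p : ℝ × ℝ) : ℝ := k * p.1 + p.1 * (1 - r - p.1 + r * p.2)

/-- The second component of the right-hand side of the monotone iteration. -/
def iterRhsSnd (b k : ℝ) (p : ℝ × ℝ) : ℝ := k * p.2 + b * p.1 * (1 - p.2)

variable {r b c k l₁ l₂ ℓ : ℝ}

lemma continuous_iterRhsFst : Continuous (iterRhsFst r k) := by unfold iterRhsFst; fun_prop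

lemma continuous_iterRhsSnd : Continuous (iterRhsSnd b k) := by unfold iterRhsSnd; fun_prop

/-- Adding k times the unknown to the source makes it monotone in the component itself; monotonicity
in the other one is cooperativity. -/
lemma iterRhsFst_mono (hr : 0 ≤ r) (hk : r + 1 ≤ k) {p q : ℝ × ℝ} (hp : 0 ≤ p) (hq : q ≤ 1)
    (hpq : p ≤ q) : iterRhsFst r k p ≤ iterRhsFst r k q := by
  obtain ⟨p₁, p₂⟩ := p
  obtain ⟨q₁, q₂⟩ := q
  simp only [Prod.le_def, Prod.fst_zero, Prod.snd_zero, Prod.fst_one, Prod.snd_one] at hp hq hpq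
  obtain ⟨⟨a1, a2⟩, ⟨a3, a4⟩, a5, a6⟩ := And.intro hp (And.intro hq hpq)
  have e : iterRhsFst r k (q₁, q₂) - iterRhsFst r k (p₁, p₂) =
      (q₁ - p₁) * (k - (r + 1) + (1 - q₁) + (1 - p₁) + r * p₂) + q₁ * (r * (q₂ - p₂)) := by
    simp only [iterRhsFst]; ring
  have h1 : 0 ≤ (q₁ - p₁) * (k - (r + 1) + (1 - q₁) + (1 - p₁) + r * p₂) :=
    mul_nonneg (by linarith) (by have := mul_nonneg hr a2; linarith)
  have h2 : 0 ≤ q₁ * (r * (q₂ - p₂)) :=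
    mul_nonneg (by linarith) (mul_nonneg hr (by linarith))
  linarith

lemma iterRhsSnd_mono (hb : 0 ≤ b) (hk : b ≤ k) {p q : ℝ × ℝ} (hp : 0 ≤ p) (hq : q ≤ 1)
    (hpq : p ≤ q) : iterRhsSnd b k p ≤ iterRhsSnd b k q := by
  obtain ⟨p₁, p₂⟩ := p
  obtain ⟨q₁, q₂⟩ := q
  simp only [Prod.le_def, Prod.fst_zero, Prod.snd_zero, Prod.fst_one, Prod.snd_one] at hp hq hpq
  obtain ⟨⟨a1, a2⟩, ⟨a3, a4⟩, a5, a6⟩ := And.intro hp (And.intro hq hpq)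
  have e : iterRhsSnd b k (q₁, q₂) - iterRhsSnd b k (p₁, p₂) =
      (q₂ - p₂) * (k - b + b * (1 - p₁)) + b * (q₁ - p₁) * (1 - q₂) := by
    simp only [iterRhsSnd]; ring
  have h1 : 0 ≤ (q₂ - p₂) * (k - b + b * (1 - p₁)) :=
    mul_nonneg (by linarith) (by have := mul_nonneg hb (by linarith : 0 ≤ 1 - p₁); linarith)
  have h2 : 0 ≤ b * (q₁ - p₁) * (1 - q₂) :=
    mul_nonneg (mul_nonneg hb (by linarith)) (by linarith)
  linarith

/-- The projection to `[0, ℓ]`. -/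
noncomputable def clampTo (ℓ x : ℝ) : ℝ := max 0 (min x ℓ)

lemma continuous_clampTo : Continuous (clampTo ℓ) := by unfold clampTo; fun_prop

lemma clampTo_mem (hℓ : 0 ≤ ℓ) (x : ℝ) : clampTo ℓ x ∈ Set.Icc 0 ℓ :=
  ⟨le_max_left _ _, max_le hℓ (min_le_right _ _)⟩

lemma clampTo_of_mem {x : ℝ} (hx : x ∈ Set.Icc 0 ℓ) : clampTo ℓ x = x := by
  rw [clampTo, min_eq_left hx.2, max_eq_right hx.1]

/-- A step of the monotone iteration. -/
noncomputable def dirichletStep (r b k l₁ l₂ ℓ : ℝ) (w : ℝ → ℝ × ℝ) (x : ℝ) : ℝ × ℝ :=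
  (dirichletSol l₁ l₂ ℓ (fun y => iterRhsFst r k (w (clampTo ℓ y))) x,
    dirichletSol l₁ l₂ ℓ (fun y => iterRhsSnd b k (w (clampTo ℓ y))) x)

/-- The iterates started at the upper solution (1, 1) decrease and stay non-negative, so they
converge pointwise. Dominated convergence in the solution formula makes the limit a fixed point, and
the formula restores its continuity. -/
lemma exists_fixed_dirichletStep (hr : 0 ≤ r) (hb : 0 ≤ b) (hk : r + 1 + b ≤ k) (hl : l₂ < l₁)
    (hlk : l₁ * l₂ = -k) (hℓ : 0 < ℓ) :
    ∃ w : ℝ → ℝ × ℝ, Continuous w ∧ (∀ x ∈ Set.Icc 0 ℓ, 0 ≤ w x ∧ w x ≤ 1) ∧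
      dirichletStep r b k l₁ l₂ ℓ w = w := by
  have hl' : l₁ * l₂ < 0 := by linarith
  set T := dirichletStep r b k l₁ l₂ ℓ with hT
  have c₁ : ∀ w : ℝ → ℝ × ℝ, Continuous w →
      Continuous fun y => iterRhsFst r k (w (clampTo ℓ y)) := fun w hw =>
    continuous_iterRhsFst.comp (hw.comp continuous_clampTo)
  have c₂ : ∀ w : ℝ → ℝ × ℝ, Continuous w →
      Continuous fun y => iterRhsSnd b k (w (clampTo ℓ y)) := fun w hw =>
    continuous_iterRhsSnd.comp (hw.comp continuous_clampTo)
  have cT : ∀ w, Continuous w → Continuous (T w) := fun w hw =>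
    (continuous_iff_continuousAt.2 fun x =>
      (hasDerivAt_dirichletSol hl (c₁ w hw) x).continuousAt).prodMk
    (continuous_iff_continuousAt.2 fun x =>
      (hasDerivAt_dirichletSol hl (c₂ w hw) x).continuousAt)
  have z₁ : iterRhsFst r k 0 = 0 := by simp [iterRhsFst]
  have z₂ : iterRhsSnd b k 0 = 0 := by simp [iterRhsSnd]
  have o₁ : iterRhsFst r k 1 = k := by simp [iterRhsFst]
  have o₂ : iterRhsSnd b k 1 = k := by simp [iterRhsSnd]
  have bd : ∀ p : ℝ × ℝ, 0 ≤ p → p ≤ 1 → (0 ≤ iterRhsFst r k p ∧ iterRhsFst r k p ≤ k) ∧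
      0 ≤ iterRhsSnd b k p ∧ iterRhsSnd b k p ≤ k := by
    intro p h0 h1
    refine ⟨⟨?_, ?_⟩, ?_, ?_⟩
    · rw [← z₁]; exact iterRhsFst_mono hr (by linarith) le_rfl h1 h0
    · exact (iterRhsFst_mono hr (by linarith) h0 le_rfl h1).trans_eq o₁
    · rw [← z₂]; exact iterRhsSnd_mono hb (by linarith) le_rfl h1 h0
    · exact (iterRhsSnd_mono hb (by linarith) h0 le_rfl h1).trans_eq o₂
  have hcl := clampTo_mem (ℓ := ℓ) hℓ.le
  have bT : ∀ w, Continuous w → (∀ x ∈ Set.Icc 0 ℓ, 0 ≤ w x ∧ w x ≤ 1) →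
      ∀ x ∈ Set.Icc 0 ℓ, 0 ≤ T w x ∧ T w x ≤ 1 := by
    intro w hw hb x hx
    have hb' := fun y => bd _ (hb _ (hcl y)).1 (hb _ (hcl y)).2
    refine ⟨⟨?_, ?_⟩, ⟨?_, ?_⟩⟩
    · exact dirichletSol_nonneg hl hl' hℓ (c₁ w hw) (fun y _ => (hb' y).1.1) x hx
    · exact dirichletSol_nonneg hl hl' hℓ (c₂ w hw) (fun y _ => (hb' y).2.1) x hx
    · exact dirichletSol_le_one hl hl' hℓ (c₁ w hw)
        (fun y _ => (hb' y).1.2.trans (by linarith)) x hx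
    · exact dirichletSol_le_one hl hl' hℓ (c₂ w hw)
        (fun y _ => (hb' y).2.2.trans (by linarith)) x hx
  have mT : ∀ v w, Continuous v → Continuous w → (∀ x ∈ Set.Icc 0 ℓ, 0 ≤ v x ∧ v x ≤ 1) →
      (∀ x ∈ Set.Icc 0 ℓ, 0 ≤ w x ∧ w x ≤ 1) → (∀ x ∈ Set.Icc 0 ℓ, v x ≤ w x) →
      ∀ x ∈ Set.Icc 0 ℓ, T v x ≤ T w x := by
    intro v w hv hw bv bw hvw x hx
    exact ⟨dirichletSol_le hl hl' hℓ (c₁ v hv) (c₁ w hw) (fun y _ =>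
      iterRhsFst_mono hr (by linarith) (bv _ (hcl y)).1 (bw _ (hcl y)).2 (hvw _ (hcl y))) x hx,
      dirichletSol_le hl hl' hℓ (c₂ v hv) (c₂ w hw) (fun y _ =>
      iterRhsSnd_mono hb (by linarith) (bv _ (hcl y)).1 (bw _ (hcl y)).2 (hvw _ (hcl y))) x hx⟩
  set w : ℕ → ℝ → ℝ × ℝ := fun n => T^[n] (fun _ => 1) with hw
  have ws : ∀ n, w (n + 1) = T (w n) := fun n => Function.iterate_succ_apply' T n _
  have cw : ∀ n, Continuous (w n) := by
    intro n
    induction n with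
    | zero => exact continuous_const
    | succ n ih => rw [ws]; exact cT _ ih
  have bw : ∀ n, ∀ x ∈ Set.Icc 0 ℓ, 0 ≤ w n x ∧ w n x ≤ 1 := by
    intro n
    induction n with
    | zero => exact fun x _ => ⟨zero_le_one, le_rfl⟩
    | succ n ih => rw [ws]; exact bT _ (cw n) ih
  have mw : ∀ n, ∀ x ∈ Set.Icc 0 ℓ, w (n + 1) x ≤ w n x := by
    intro n
    induction n with
    | zero => exact fun x hx => (bw 1 x hx).2
    | succ n ih =>
      rw [ws (n + 1), ws n]
      exact ws n ▸ mT _ _ (cw _) (cw _) (bw _) (bw _) ih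
  have hlim : ∀ y, ∃ p, Tendsto (fun n => w n (clampTo ℓ y)) atTop (𝓝 p) := by
    intro y
    have ha := antitone_nat_of_succ_le (f := fun n => w n (clampTo ℓ y)) fun n => mw n _ (hcl y)
    have h1 := tendsto_atTop_ciInf (f := fun n => (w n (clampTo ℓ y)).1)
      (fun i j hij => (ha hij).1) ⟨0, by rintro _ ⟨n, rfl⟩; exact (bw n _ (hcl y)).1.1⟩
    have h2 := tendsto_atTop_ciInf (f := fun n => (w n (clampTo ℓ y)).2)
      (fun i j hij => (ha hij).2) ⟨0, by rintro _ ⟨n, rfl⟩; exact (bw n _ (hcl y)).1.2⟩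
    exact ⟨_, h1.prodMk_nhds h2⟩
  choose p hp using hlim
  have bp : ∀ y, 0 ≤ p y ∧ p y ≤ 1 := fun y =>
    ⟨ge_of_tendsto' (hp y) fun n => (bw n _ (hcl y)).1,
      le_of_tendsto' (hp y) fun n => (bw n _ (hcl y)).2⟩
  have l₁' : ∀ y, Tendsto (fun n => iterRhsFst r k (w n (clampTo ℓ y))) atTop
      (𝓝 (iterRhsFst r k (p y))) := fun y => (continuous_iterRhsFst.tendsto _).comp (hp y)
  have l₂' : ∀ y, Tendsto (fun n => iterRhsSnd b k (w n (clampTo ℓ y))) atTop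
      (𝓝 (iterRhsSnd b k (p y))) := fun y => (continuous_iterRhsSnd.tendsto _).comp (hp y)
  have m₁ : Measurable fun y => iterRhsFst r k (p y) :=
    measurable_of_tendsto_metrizable (fun n => (c₁ _ (cw n)).measurable) (tendsto_pi_nhds.2 l₁')
  have m₂ : Measurable fun y => iterRhsSnd b k (p y) :=
    measurable_of_tendsto_metrizable (fun n => (c₂ _ (cw n)).measurable) (tendsto_pi_nhds.2 l₂')
  have habs : ∀ {z : ℝ}, 0 ≤ z → z ≤ k → |z| ≤ k := fun h0 h1 => by rwa [abs_of_nonneg h0]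
  have b₁ : ∀ n y, |iterRhsFst r k (w n (clampTo ℓ y))| ≤ k := fun n y =>
    have := bd _ (bw n _ (hcl y)).1 (bw n _ (hcl y)).2
    habs this.1.1 this.1.2
  have b₂ : ∀ n y, |iterRhsSnd b k (w n (clampTo ℓ y))| ≤ k := fun n y =>
    have := bd _ (bw n _ (hcl y)).1 (bw n _ (hcl y)).2
    habs this.2.1 this.2.2
  set W : ℝ → ℝ × ℝ := fun x => (dirichletSol l₁ l₂ ℓ (fun y => iterRhsFst r k (p y)) x,
    dirichletSol l₁ l₂ ℓ (fun y => iterRhsSnd b k (p y)) x) with hW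
  have hWlim : ∀ x, Tendsto (fun n => w (n + 1) x) atTop (𝓝 (W x)) := by
    intro x
    simp only [ws]
    exact (tendsto_dirichletSol (fun n => (c₁ _ (cw n)).measurable) b₁ l₁' x).prodMk_nhds
      (tendsto_dirichletSol (fun n => (c₂ _ (cw n)).measurable) b₂ l₂' x)
  have hWp : ∀ y, W (clampTo ℓ y) = p y := fun y =>
    tendsto_nhds_unique (hWlim _) ((tendsto_add_atTop_iff_nat 1).2 (hp y))
  refine ⟨W, ?_, fun x hx => ?_, ?_⟩
  · refine (continuous_dirichletSol m₁ (M := k) fun y => ?_).prodMk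
      (continuous_dirichletSol m₂ (M := k) fun y => ?_)
    · exact habs (bd _ (bp y).1 (bp y).2).1.1 (bd _ (bp y).1 (bp y).2).1.2
    · exact habs (bd _ (bp y).1 (bp y).2).2.1 (bd _ (bp y).1 (bp y).2).2.2
  · have := hWp x
    rw [clampTo_of_mem hx] at this
    rw [this]
    exact bp x
  · funext x
    simp only [hT, dirichletStep, hWp]
    rfl

theorem exists_isDirichletSolution (hr : 0 ≤ r) (hb : 0 ≤ b) (c : ℝ) (hℓ : 0 < ℓ) :
    ∃ φ φ' ψ ψ', IsDirichletSolution r b c ℓ φ φ' ψ ψ' := by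
  set k := r + 1 + b with hk
  set D := Real.sqrt (c ^ 2 + 4 * k) with hD
  have hD2 : D ^ 2 = c ^ 2 + 4 * k := Real.sq_sqrt (by positivity)
  have hD0 : 0 < D := Real.sqrt_pos.2 (by positivity)
  set l₁ := (c + D) / 2 with hl₁
  set l₂ := (c - D) / 2 with hl₂
  have hl : l₂ < l₁ := by linarith
  have hlk : l₁ * l₂ = -k := by
    have : l₁ * l₂ = (c ^ 2 - D ^ 2) / 4 := by rw [hl₁, hl₂]; ring
    rw [this, hD2]; ring
  have hlc : l₁ + l₂ = c := by rw [hl₁, hl₂]; ring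
  obtain ⟨w, cw, bw, hw⟩ := exists_fixed_dirichletStep hr hb hk.ge hl hlk hℓ
  set g₁ := fun y => iterRhsFst r k (w (clampTo ℓ y)) with hg₁
  set g₂ := fun y => iterRhsSnd b k (w (clampTo ℓ y)) with hg₂
  have c₁ : Continuous g₁ := continuous_iterRhsFst.comp (cw.comp continuous_clampTo)
  have c₂ : Continuous g₂ := continuous_iterRhsSnd.comp (cw.comp continuous_clampTo)
  have e₁ : ∀ x, (w x).1 = dirichletSol l₁ l₂ ℓ g₁ x := fun x => by
    conv_lhs => rw [← hw]
    rfl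
  have e₂ : ∀ x, (w x).2 = dirichletSol l₁ l₂ ℓ g₂ x := fun x => by
    conv_lhs => rw [← hw]
    rfl
  refine ⟨dirichletSol l₁ l₂ ℓ g₁, dirichletSolDeriv l₁ l₂ ℓ g₁, dirichletSol l₁ l₂ ℓ g₂,
    dirichletSolDeriv l₁ l₂ ℓ g₂, ?_⟩
  refine ⟨fun x _ => (hasDerivAt_dirichletSol hl c₁ x).continuousAt.continuousWithinAt,
    fun x _ => (hasDerivAt_dirichletSol hl c₂ x).continuousAt.continuousWithinAt,
    fun x _ => hasDerivAt_dirichletSol hl c₁ x, fun x hx => ?_,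
    fun x _ => hasDerivAt_dirichletSol hl c₂ x, fun x hx => ?_, dirichletSol_zero,
    dirichletSol_zero, dirichletSol_right hl hℓ, dirichletSol_right hl hℓ, fun x hx => ?_,
    fun x hx => ?_⟩
  · refine (hasDerivAt_dirichletSolDeriv hl c₁ x).congr_deriv ?_
    have : g₁ x = iterRhsFst r k (w x) := by
      rw [hg₁]; simp only [clampTo_of_mem (Set.Ioo_subset_Icc_self hx)]
    rw [this, hlk, hlc, ← e₁, ← e₂, iterRhsFst]
    ring
  · refine (hasDerivAt_dirichletSolDeriv hl c₂ x).congr_deriv ?_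
    have : g₂ x = iterRhsSnd b k (w x) := by
      rw [hg₂]; simp only [clampTo_of_mem (Set.Ioo_subset_Icc_self hx)]
    rw [this, hlk, hlc, ← e₁, ← e₂, iterRhsSnd]
    ring
  · rw [← e₁]; exact ⟨(bw x hx).1.1, (bw x hx).2.1⟩
  · rw [← e₂]; exact ⟨(bw x hx).1.2, (bw x hx).2.2⟩

end DirichletProblem

/-! ### Strict bounds, monotonicity and uniqueness for the Dirichlet problem. -/

section DirichletProperties

lemma eqOn_Icc_of_eqOn_Ioo {f g : ℝ → ℝ} {a b : ℝ} (hab : a < b)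
    (hf : ContinuousOn f (Set.Icc a b)) (hg : ContinuousOn g (Set.Icc a b))
    (h : ∀ x ∈ Set.Ioo a b, f x = g x) : ∀ x ∈ Set.Icc a b, f x = g x := by
  have := Set.EqOn.of_subset_closure h hf hg Set.Ioo_subset_Icc_self
    (by rw [closure_Ioo hab.ne])
  exact this

namespace IsDirichletSolution

variable {r b c ℓ : ℝ} {φ φ' ψ ψ' φ₁ φ₁' ψ₁ ψ₁' φ₂ φ₂' ψ₂ ψ₂' : ℝ → ℝ}

/-- An interior zero would spread over the interval by the strong maximum principle and contradict
the boundary value at ℓ. -/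
lemma pos_φ (H : IsDirichletSolution r b c ℓ φ φ' ψ ψ') (hr : 0 ≤ r) (hℓ : 0 < ℓ) :
    ∀ x ∈ Set.Ioc 0 ℓ, 0 < φ x := by
  intro x hx
  rcases hx.2.eq_or_lt with rfl | hlt
  · rw [H.φ_right]; exact one_pos
  refine lt_of_le_of_ne (H.mem_φ x ⟨hx.1.le, hx.2⟩).1 fun e => ?_
  have := eqOn_zero_of_nonneg_of_touch isOpen_Ioo (convex_Ioo 0 ℓ) (k := r) (c := c) hr H.dφ H.dφ'
    (fun y hy => (H.mem_φ y (Set.Ioo_subset_Icc_self hy)).1) (fun y hy => by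
      have h1 := H.mem_φ y (Set.Ioo_subset_Icc_self hy)
      have h2 := H.mem_ψ y (Set.Ioo_subset_Icc_self hy)
      have h3 : 0 ≤ φ y * (1 - φ y + r * ψ y) := mul_nonneg h1.1 (by
        have := mul_nonneg hr h2.1
        linarith [h1.2])
      linarith) ⟨hx.1, hlt⟩ e.symm
  have h := eqOn_Icc_of_eqOn_Ioo hℓ H.cont_φ (continuousOn_const (c := 0)) this ℓ ⟨hℓ.le, le_rfl⟩
  rw [H.φ_right] at h
  exact one_ne_zero h

lemma pos_ψ (H : IsDirichletSolution r b c ℓ φ φ' ψ ψ') (hb : 0 ≤ b) (hℓ : 0 < ℓ) :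
    ∀ x ∈ Set.Ioc 0 ℓ, 0 < ψ x := by
  intro x hx
  rcases hx.2.eq_or_lt with rfl | hlt
  · rw [H.ψ_right]; exact one_pos
  refine lt_of_le_of_ne (H.mem_ψ x ⟨hx.1.le, hx.2⟩).1 fun e => ?_
  have := eqOn_zero_of_nonneg_of_touch isOpen_Ioo (convex_Ioo 0 ℓ) (k := 0) (c := c) le_rfl
    H.dψ H.dψ' (fun y hy => (H.mem_ψ y (Set.Ioo_subset_Icc_self hy)).1) (fun y hy => by
      have h1 := H.mem_φ y (Set.Ioo_subset_Icc_self hy)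
      have h2 := H.mem_ψ y (Set.Ioo_subset_Icc_self hy)
      have h3 : 0 ≤ b * φ y * (1 - ψ y) := mul_nonneg (mul_nonneg hb h1.1) (by linarith [h2.2])
      linarith) ⟨hx.1, hlt⟩ e.symm
  have h := eqOn_Icc_of_eqOn_Ioo hℓ H.cont_ψ (continuousOn_const (c := 0)) this ℓ ⟨hℓ.le, le_rfl⟩
  rw [H.ψ_right] at h
  exact one_ne_zero h

lemma φ_lt_one (H : IsDirichletSolution r b c ℓ φ φ' ψ ψ') (hr : 0 ≤ r) (hℓ : 0 < ℓ) :
    ∀ x ∈ Set.Ico 0 ℓ, φ x < 1 := by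
  intro x hx
  rcases hx.1.eq_or_lt with rfl | hlt
  · rw [H.φ_zero]; exact one_pos
  refine lt_of_le_of_ne (H.mem_φ x ⟨hx.1, hx.2.le⟩).2 fun e => ?_
  have := eqOn_zero_of_nonneg_of_touch isOpen_Ioo (convex_Ioo 0 ℓ) (k := 1) (c := c) zero_le_one
    (fun y hy => (H.dφ y hy).const_sub 1) (fun y hy => (H.dφ' y hy).neg)
    (fun y hy => sub_nonneg.2 (H.mem_φ y (Set.Ioo_subset_Icc_self hy)).2) (fun y hy => by
      have h1 := H.mem_φ y (Set.Ioo_subset_Icc_self hy)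
      have h2 := H.mem_ψ y (Set.Ioo_subset_Icc_self hy)
      have h3 : 0 ≤ φ y * (r * (1 - ψ y)) :=
        mul_nonneg h1.1 (mul_nonneg hr (by linarith [h2.2]))
      nlinarith [h1.1, h1.2]) ⟨hlt, hx.2⟩ (by rw [e]; ring)
  have h := eqOn_Icc_of_eqOn_Ioo hℓ (continuousOn_const.sub H.cont_φ) (continuousOn_const (c := 0)) this 0
    ⟨le_rfl, hℓ.le⟩
  simp [H.φ_zero] at h

lemma ψ_lt_one (H : IsDirichletSolution r b c ℓ φ φ' ψ ψ') (hb : 0 ≤ b) (hℓ : 0 < ℓ) :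
    ∀ x ∈ Set.Ico 0 ℓ, ψ x < 1 := by
  intro x hx
  rcases hx.1.eq_or_lt with rfl | hlt
  · rw [H.ψ_zero]; exact one_pos
  refine lt_of_le_of_ne (H.mem_ψ x ⟨hx.1, hx.2.le⟩).2 fun e => ?_
  have := eqOn_zero_of_nonneg_of_touch isOpen_Ioo (convex_Ioo 0 ℓ) (k := b) (c := c) hb
    (fun y hy => (H.dψ y hy).const_sub 1) (fun y hy => (H.dψ' y hy).neg)
    (fun y hy => sub_nonneg.2 (H.mem_ψ y (Set.Ioo_subset_Icc_self hy)).2) (fun y hy => by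
      have h1 := H.mem_φ y (Set.Ioo_subset_Icc_self hy)
      have h2 := H.mem_ψ y (Set.Ioo_subset_Icc_self hy)
      have h3 : 0 ≤ b * (1 - φ y) * (1 - ψ y) :=
        mul_nonneg (mul_nonneg hb (by linarith [h1.2])) (by linarith [h2.2])
      linarith) ⟨hlt, hx.2⟩ (by rw [e]; ring)
  have h := eqOn_Icc_of_eqOn_Ioo hℓ (continuousOn_const.sub H.cont_ψ) (continuousOn_const (c := 0)) this 0
    ⟨le_rfl, hℓ.le⟩
  simp [H.ψ_zero] at h

/-- The sliding method: any shift of a solution to the left lies above any other solution. -/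
theorem le_shift (H₁ : IsDirichletSolution r b c ℓ φ₁ φ₁' ψ₁ ψ₁')
    (H₂ : IsDirichletSolution r b c ℓ φ₂ φ₂' ψ₂ ψ₂') (hr : 0 ≤ r) (hb : 0 ≤ b) (hℓ : 0 < ℓ)
    {s x : ℝ} (hs : 0 < s) (hx : 0 ≤ x) (hxs : x + s ≤ ℓ) :
    φ₂ x ≤ φ₁ (x + s) ∧ ψ₂ x ≤ ψ₁ (x + s) := by
  by_contra hcon
  set R : Set (ℝ × ℝ) := {q | s ≤ q.1 ∧ 0 ≤ q.2 ∧ q.2 + q.1 ≤ ℓ} with hR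
  have cR : IsCompact R := by
    have hcl : IsClosed R :=
      (isClosed_le continuous_const continuous_fst).inter
        ((isClosed_le continuous_const continuous_snd).inter
          (isClosed_le (continuous_snd.add continuous_fst) continuous_const))
    refine (isCompact_Icc (a := ((0, 0) : ℝ × ℝ)) (b := (ℓ, ℓ))).of_isClosed_subset hcl ?_
    rintro ⟨q₁, q₂⟩ ⟨h1, h2, h3⟩
    simp only at h1 h2 h3
    exact ⟨⟨by simp only; linarith, h2⟩, ⟨by simp only; linarith, by simp only; linarith⟩⟩
  set F : ℝ × ℝ → ℝ := fun q => min (φ₁ (q.2 + q.1) - φ₂ q.2) (ψ₁ (q.2 + q.1) - ψ₂ q.2) with hF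
  have m1 : Set.MapsTo (fun q : ℝ × ℝ => q.2 + q.1) R (Set.Icc 0 ℓ) := by
    rintro ⟨q₁, q₂⟩ ⟨h1, h2, h3⟩
    simp only at h1 h2 h3
    exact ⟨by simp only; linarith, h3⟩
  have m2 : Set.MapsTo (fun q : ℝ × ℝ => q.2) R (Set.Icc 0 ℓ) := by
    rintro ⟨q₁, q₂⟩ ⟨h1, h2, h3⟩
    simp only at h1 h2 h3
    exact ⟨h2, by simp only; linarith⟩
  have cF : ContinuousOn F R :=
    ((H₁.cont_φ.comp (by fun_prop) m1).sub (H₂.cont_φ.comp (by fun_prop) m2)).inf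
      ((H₁.cont_ψ.comp (by fun_prop) m1).sub (H₂.cont_ψ.comp (by fun_prop) m2))
  have cT : IsCompact (R ∩ F ⁻¹' Set.Iic 0) :=
    cR.of_isClosed_subset (cF.preimage_isClosed_of_isClosed cR.isClosed isClosed_Iic)
      Set.inter_subset_left
  have hT : (R ∩ F ⁻¹' Set.Iic 0).Nonempty := by
    refine ⟨(s, x), ⟨le_rfl, hx, hxs⟩, ?_⟩
    rw [not_and_or, not_le, not_le] at hcon
    rcases hcon with h | h
    · exact (min_le_left _ _).trans (sub_nonpos.2 h.le)
    · exact (min_le_right _ _).trans (sub_nonpos.2 h.le)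
  -- σ is the largest shift at which the order is not strict. Larger shifts preserve the order,
  -- hence so does σ by continuity, and z is a contact point.
  obtain ⟨⟨σ, z⟩, ⟨⟨hσ, hz0, hzσ⟩, hFz⟩, hmax⟩ := cT.exists_isMaxOn hT continuous_fst.continuousOn
  simp only at hσ hz0 hzσ
  have hσ0 : 0 < σ := hs.trans_le hσ
  have hσℓ : σ < ℓ := by
    refine lt_of_le_of_ne (by linarith) fun e => ?_
    have hz : z = 0 := by linarith
    subst hz
    subst e
    simp [hF, H₁.φ_right, H₁.ψ_right, H₂.φ_zero, H₂.ψ_zero] at hFz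
    linarith
  have later : ∀ σ' y, σ < σ' → 0 ≤ y → y + σ' ≤ ℓ →
      0 ≤ φ₁ (y + σ') - φ₂ y ∧ 0 ≤ ψ₁ (y + σ') - ψ₂ y := by
    intro σ' y h1 h2 h3
    rw [← le_min_iff]
    by_contra hneg
    push Not at hneg
    have := hmax (a := (σ', y)) ⟨⟨by simp only; linarith, h2, h3⟩, hneg.le⟩
    simp only [Set.mem_ofPred_eq] at this
    linarith
  have now : ∀ y, 0 ≤ y → y < ℓ - σ → 0 ≤ φ₁ (y + σ) - φ₂ y ∧ 0 ≤ ψ₁ (y + σ) - ψ₂ y := by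
    intro y h1 h2
    have hmem : y + σ ∈ Set.Ioo 0 ℓ := ⟨by linarith, by linarith⟩
    have ht : Tendsto (fun σ' => y + σ') (𝓝[>] σ) (𝓝 (y + σ)) :=
      ((continuous_const.add continuous_id).tendsto σ).mono_left nhdsWithin_le_nhds
    have hev : ∀ᶠ σ' in 𝓝[>] σ, σ < σ' ∧ y + σ' ≤ ℓ := by
      filter_upwards [self_mem_nhdsWithin, ht.eventually (gt_mem_nhds hmem.2)] with σ' h3 h4
      exact ⟨h3, h4.le⟩
    exact ⟨ge_of_tendsto (((H₁.dφ _ hmem).continuousAt.tendsto.comp ht).sub_const _)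
      (hev.mono fun σ' h => (later σ' y h.1 h1 h.2).1),
      ge_of_tendsto (((H₁.dψ _ hmem).continuousAt.tendsto.comp ht).sub_const _)
      (hev.mono fun σ' h => (later σ' y h.1 h1 h.2).2)⟩
  have pos_φ₁ := H₁.pos_φ hr hℓ
  have pos_ψ₁ := H₁.pos_ψ hb hℓ
  -- The contact is interior: at either end of the overlap one solution has a boundary value and the
  -- other a strictly interior one.
  have hz1 : 0 < z := by
    refine lt_of_le_of_ne hz0 fun e => ?_
    subst e
    have h1 := pos_φ₁ σ ⟨hσ0, hσℓ.le⟩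
    have h2 := pos_ψ₁ σ ⟨hσ0, hσℓ.le⟩
    simp only [hF, Set.mem_preimage, Set.mem_Iic, zero_add, H₂.φ_zero, H₂.ψ_zero, sub_zero] at hFz
    linarith [lt_min h1 h2]
  have hz2 : z < ℓ - σ := by
    refine lt_of_le_of_ne (by linarith) fun e => ?_
    have h1 := H₂.φ_lt_one hr hℓ z ⟨hz0, by linarith⟩
    have h2 := H₂.ψ_lt_one hb hℓ z ⟨hz0, by linarith⟩
    have e' : z + σ = ℓ := by linarith
    simp only [hF, Set.mem_preimage, Set.mem_Iic, e', H₁.φ_right, H₁.ψ_right] at hFz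
    linarith [lt_min (sub_pos.2 h1) (sub_pos.2 h2)]
  have mem₁ : ∀ y ∈ Set.Ioo 0 (ℓ - σ), y + σ ∈ Set.Ioo 0 ℓ := fun y hy =>
    ⟨by linarith [hy.1], by linarith [hy.2]⟩
  have mem₂ : ∀ y ∈ Set.Ioo 0 (ℓ - σ), y ∈ Set.Ioo 0 ℓ := fun y hy =>
    ⟨hy.1, by linarith [hy.2]⟩
  have mc₁ : Set.MapsTo (fun y => y + σ) (Set.Icc 0 (ℓ - σ)) (Set.Icc 0 ℓ) := fun y hy =>
    ⟨by simp only; linarith [hy.1], by simp only; linarith [hy.2]⟩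
  have mc₂ : Set.Icc 0 (ℓ - σ) ⊆ Set.Icc 0 ℓ := Set.Icc_subset_Icc_right (by linarith)
  have hnow : ∀ y ∈ Set.Ioo 0 (ℓ - σ), 0 ≤ φ₁ (y + σ) - φ₂ y ∧ 0 ≤ ψ₁ (y + σ) - ψ₂ y :=
    fun y hy => now y hy.1.le hy.2
  -- The component in contact would coincide on the whole overlap, contrary to its strict order at
  -- the left end.
  rcases min_le_iff.1 (show min (φ₁ (z + σ) - φ₂ z) (ψ₁ (z + σ) - ψ₂ z) ≤ 0 from hFz) with h0 | h0
  · have := eqOn_zero_of_nonneg_of_touch isOpen_Ioo (convex_Ioo 0 (ℓ - σ)) (k := r + 1) (c := c)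
      (by linarith)
      (fun y hy => ((H₁.dφ _ (mem₁ y hy)).comp_add_const y σ).sub (H₂.dφ _ (mem₂ y hy)))
      (fun y hy => ((H₁.dφ' _ (mem₁ y hy)).comp_add_const y σ).sub (H₂.dφ' _ (mem₂ y hy)))
      (fun y hy => (hnow y hy).1) (fun y hy => by
        have a1 := H₁.mem_φ _ (Set.Ioo_subset_Icc_self (mem₁ y hy))
        have a2 := H₁.mem_ψ _ (Set.Ioo_subset_Icc_self (mem₁ y hy))
        have a3 := H₂.mem_φ _ (Set.Ioo_subset_Icc_self (mem₂ y hy))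
        obtain ⟨b1, b2⟩ := hnow y hy
        have h1 : 0 ≤ (φ₁ (y + σ) - φ₂ y) * ((1 - φ₁ (y + σ)) + (1 - φ₂ y) + r * ψ₁ (y + σ)) :=
          mul_nonneg b1 (by have := mul_nonneg hr a2.1; linarith [a1.2, a3.2])
        have h2 : 0 ≤ φ₂ y * (r * (ψ₁ (y + σ) - ψ₂ y)) := mul_nonneg a3.1 (mul_nonneg hr b2)
        simp only [Pi.sub_apply]
        linarith) ⟨hz1, hz2⟩ (le_antisymm h0 (now z hz0 hz2).1)
    have h := eqOn_Icc_of_eqOn_Ioo (by linarith) ((H₁.cont_φ.comp (by fun_prop) mc₁).sub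
      (H₂.cont_φ.mono mc₂)) (continuousOn_const (c := 0)) this 0 ⟨le_rfl, by linarith⟩
    have h1 := pos_φ₁ σ ⟨hσ0, hσℓ.le⟩
    simp [H₂.φ_zero] at h
    linarith
  · have := eqOn_zero_of_nonneg_of_touch isOpen_Ioo (convex_Ioo 0 (ℓ - σ)) (k := b) (c := c) hb
      (fun y hy => ((H₁.dψ _ (mem₁ y hy)).comp_add_const y σ).sub (H₂.dψ _ (mem₂ y hy)))
      (fun y hy => ((H₁.dψ' _ (mem₁ y hy)).comp_add_const y σ).sub (H₂.dψ' _ (mem₂ y hy)))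
      (fun y hy => (hnow y hy).2) (fun y hy => by
        have a2 := H₁.mem_ψ _ (Set.Ioo_subset_Icc_self (mem₁ y hy))
        have a3 := H₂.mem_φ _ (Set.Ioo_subset_Icc_self (mem₂ y hy))
        obtain ⟨b1, b2⟩ := hnow y hy
        have h1 : 0 ≤ b * (φ₁ (y + σ) - φ₂ y) * (1 - ψ₁ (y + σ)) :=
          mul_nonneg (mul_nonneg hb b1) (by linarith [a2.2])
        have h2 : 0 ≤ b * (1 - φ₂ y) * (ψ₁ (y + σ) - ψ₂ y) :=
          mul_nonneg (mul_nonneg hb (by linarith [a3.2])) b2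
        simp only [Pi.sub_apply]
        linarith) ⟨hz1, hz2⟩ (le_antisymm h0 (now z hz0 hz2).2)
    have h := eqOn_Icc_of_eqOn_Ioo (by linarith) ((H₁.cont_ψ.comp (by fun_prop) mc₁).sub
      (H₂.cont_ψ.mono mc₂)) (continuousOn_const (c := 0)) this 0 ⟨le_rfl, by linarith⟩
    have h1 := pos_ψ₁ σ ⟨hσ0, hσℓ.le⟩
    simp [H₂.ψ_zero] at h
    linarith

/-- The solution is compared with its own shifts. -/
lemma monotoneOn (H : IsDirichletSolution r b c ℓ φ φ' ψ ψ') (hr : 0 ≤ r) (hb : 0 ≤ b)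
    (hℓ : 0 < ℓ) : MonotoneOn φ (Set.Icc 0 ℓ) ∧ MonotoneOn ψ (Set.Icc 0 ℓ) := by
  have key : ∀ x ∈ Set.Icc 0 ℓ, ∀ y ∈ Set.Icc 0 ℓ, x ≤ y → φ x ≤ φ y ∧ ψ x ≤ ψ y := by
    intro x hx y hy hxy
    rcases hxy.eq_or_lt with rfl | hlt
    · exact ⟨le_rfl, le_rfl⟩
    · have := H.le_shift H hr hb hℓ (sub_pos.2 hlt) hx.1 (by linarith [hy.2])
      rwa [add_sub_cancel] at this
  exact ⟨fun x hx y hy hxy => (key x hx y hy hxy).1, fun x hx y hy hxy => (key x hx y hy hxy).2⟩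

lemma φ_le (H₁ : IsDirichletSolution r b c ℓ φ₁ φ₁' ψ₁ ψ₁')
    (H₂ : IsDirichletSolution r b c ℓ φ₂ φ₂' ψ₂ ψ₂') (hr : 0 ≤ r) (hb : 0 ≤ b) (hℓ : 0 < ℓ) :
    ∀ x ∈ Set.Ioo 0 ℓ, φ₂ x ≤ φ₁ x := by
  intro x hx
  have ht : Tendsto (fun s => x + s) (𝓝[>] 0) (𝓝 x) := by
    have := ((continuous_const.add continuous_id).tendsto (0 : ℝ)).mono_left
      (nhdsWithin_le_nhds (s := Set.Ioi 0)) (f := fun s => x + s)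
    simpa using this
  refine ge_of_tendsto ((H₁.dφ x hx).continuousAt.tendsto.comp ht) ?_
  filter_upwards [self_mem_nhdsWithin, ht.eventually (gt_mem_nhds hx.2)] with s h1 h2
  exact (H₁.le_shift H₂ hr hb hℓ h1 hx.1.le h2.le).1

lemma φ_unique (H₁ : IsDirichletSolution r b c ℓ φ₁ φ₁' ψ₁ ψ₁')
    (H₂ : IsDirichletSolution r b c ℓ φ₂ φ₂' ψ₂ ψ₂') (hr : 0 ≤ r) (hb : 0 ≤ b) (hℓ : 0 < ℓ) :
    ∀ x ∈ Set.Ioo 0 ℓ, φ₁ x = φ₂ x := fun x hx =>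
  le_antisymm (H₂.φ_le H₁ hr hb hℓ x hx) (H₁.φ_le H₂ hr hb hℓ x hx)

lemma deriv_nonneg (H : IsDirichletSolution r b c ℓ φ φ' ψ ψ') (hr : 0 ≤ r) (hb : 0 ≤ b)
    (hℓ : 0 < ℓ) : ∀ x ∈ Set.Ioo 0 ℓ, 0 ≤ φ' x ∧ 0 ≤ ψ' x := by
  intro x hx
  obtain ⟨m1, m2⟩ := H.monotoneOn hr hb hℓ
  have hacc : AccPt x (𝓟 (Set.Icc 0 ℓ)) :=
    (uniqueDiffOn_Icc hℓ x (Set.Ioo_subset_Icc_self hx)).accPt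
  exact ⟨(H.dφ x hx).hasDerivWithinAt.nonneg_of_monotoneOn hacc m1,
    (H.dψ x hx).hasDerivWithinAt.nonneg_of_monotoneOn hacc m2⟩

end IsDirichletSolution

end DirichletProperties

/-! ### Convergence of trajectories of an autonomous ODE. -/

section LimitsOfTrajectories

variable {E : Type*} [NormedAddCommGroup E] [NormedSpace ℝ E]

/-- Two trajectories in a set where the vector field is Lipschitz. -/
lemma dist_le_of_trajectories {V : E → E} {K : NNReal} {B : Set E} (hV : LipschitzOnWith K V B)
    {a b t₀ : ℝ} (ht₀ : t₀ ∈ Set.Ioo a b) {f g : ℝ → E}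
    (hf : ∀ t ∈ Set.Ioo a b, HasDerivAt f (V (f t)) t ∧ f t ∈ B)
    (hg : ∀ t ∈ Set.Ioo a b, HasDerivAt g (V (g t)) t ∧ g t ∈ B) :
    ∀ t ∈ Set.Ioo a b, dist (f t) (g t) ≤ dist (f t₀) (g t₀) * Real.exp (K * (b - a)) := by
  have mono : ∀ s : ℝ, s ≤ b - a →
      dist (f t₀) (g t₀) * Real.exp (K * s) ≤ dist (f t₀) (g t₀) * Real.exp (K * (b - a)) :=
    fun s hs => mul_le_mul_of_nonneg_left (Real.exp_le_exp.2
      (mul_le_mul_of_nonneg_left hs K.coe_nonneg)) dist_nonneg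
  intro t ht
  rcases le_total t₀ t with h | h
  · have hsub : Set.Icc t₀ t ⊆ Set.Ioo a b := Set.Icc_subset_Ioo ht₀.1 ht.2
    have hsub' : Set.Ico t₀ t ⊆ Set.Ioo a b := Set.Ico_subset_Icc_self.trans hsub
    refine (dist_le_of_trajectories_ODE_of_mem (v := fun _ => V) (s := fun _ => B) (K := K)
      (fun _ _ => hV)
      (fun s hs => (hf s (hsub hs)).1.continuousAt.continuousWithinAt)
      (fun s hs => (hf s (hsub' hs)).1.hasDerivWithinAt) (fun s hs => (hf s (hsub' hs)).2)
      (fun s hs => (hg s (hsub hs)).1.continuousAt.continuousWithinAt)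
      (fun s hs => (hg s (hsub' hs)).1.hasDerivWithinAt) (fun s hs => (hg s (hsub' hs)).2)
      le_rfl t ⟨h, le_rfl⟩).trans (mono _ (by linarith [ht₀.1, ht.2]))
  -- Backward in time: Grönwall for the reversed trajectories.
  · have hsub : ∀ s ∈ Set.Icc (-t₀) (-t), -s ∈ Set.Ioo a b := fun s hs =>
      ⟨by linarith [hs.2, ht.1], by linarith [hs.1, ht₀.2]⟩
    have hsub' : ∀ s ∈ Set.Ico (-t₀) (-t), -s ∈ Set.Ioo a b := fun s hs =>
      hsub s (Set.Ico_subset_Icc_self hs)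
    have rev : ∀ {f : ℝ → E}, (∀ t ∈ Set.Ioo a b, HasDerivAt f (V (f t)) t ∧ f t ∈ B) →
        ∀ s, -s ∈ Set.Ioo a b → HasDerivAt (fun s => f (-s)) (-V (f (-s))) s := fun hf s hs => by
      have := (hf _ hs).1.scomp s (hasDerivAt_neg s)
      rwa [neg_one_smul] at this
    have := dist_le_of_trajectories_ODE_of_mem (v := fun _ x => -V x) (s := fun _ => B) (K := K)
      (f := fun s => f (-s)) (g := fun s => g (-s)) (δ := dist (f t₀) (g t₀))
      (fun _ _ => hV.neg)
      (fun s hs => (rev hf s (hsub s hs)).continuousAt.continuousWithinAt)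
      (fun s hs => (rev hf s (hsub' s hs)).hasDerivWithinAt) (fun s hs => (hf _ (hsub' s hs)).2)
      (fun s hs => (rev hg s (hsub s hs)).continuousAt.continuousWithinAt)
      (fun s hs => (rev hg s (hsub' s hs)).hasDerivWithinAt) (fun s hs => (hg _ (hsub' s hs)).2)
      (by simp) (-t) ⟨by linarith, le_rfl⟩
    simp only [neg_neg] at this
    exact this.trans (mono _ (by linarith [ht₀.2, ht.1]))

/-- Trajectories in a compact set converge, once they do so at a point, and the limit is a
trajectory. -/
lemma exists_tendsto_trajectories [CompleteSpace E] {V : E → E} {K : NNReal} {B : Set E}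
    (hV : LipschitzOnWith K V B) (hB : IsClosed B) {w₀ : E} {t₀ : ℝ} {W : ℕ → ℝ → E}
    (h₀ : Tendsto (fun n => W n t₀) atTop (𝓝 w₀)) {I : Set ℝ} (hI : IsOpen I)
    (hconv : Convex ℝ I) (ht₀ : t₀ ∈ I)
    (hW : ∀ a b, t₀ ∈ Set.Ioo a b → Set.Icc a b ⊆ I →
      ∀ᶠ n in atTop, ∀ t ∈ Set.Ioo a b, HasDerivAt (W n) (V (W n t)) t ∧ W n t ∈ B) :
    ∃ w : ℝ → E, ∀ t ∈ I, Tendsto (fun n => W n t) atTop (𝓝 (w t)) ∧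
      HasDerivAt w (V (w t)) t ∧ w t ∈ B := by
  have hab : ∀ t ∈ I, ∃ a b, t₀ ∈ Set.Ioo a b ∧ t ∈ Set.Ioo a b ∧ Set.Icc a b ⊆ I := by
    intro t ht
    obtain ⟨ε, hε, h1⟩ := Metric.isOpen_iff.1 hI _ ht₀
    obtain ⟨δ, hδ, h2⟩ := Metric.isOpen_iff.1 hI _ ht
    set m := min ε δ / 2 with hm
    have hm0 : 0 < m := by positivity
    have hm1 : m < ε := by have := min_le_left ε δ; have := lt_min hε hδ; linarith
    have hm2 : m < δ := by have := min_le_right ε δ; have := lt_min hε hδ; linarith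
    have e1 : t₀ - m ∈ I := h1 (by simp [abs_of_pos hm0, hm1])
    have e2 : t₀ + m ∈ I := h1 (by simp [abs_of_pos hm0, hm1])
    have e3 : t - m ∈ I := h2 (by simp [abs_of_pos hm0, hm2])
    have e4 : t + m ∈ I := h2 (by simp [abs_of_pos hm0, hm2])
    have hoc := hconv.ordConnected
    rcases le_total t₀ t with h | h
    · exact ⟨t₀ - m, t + m, ⟨by linarith, by linarith⟩, ⟨by linarith, by linarith⟩,
        hoc.out e1 e4⟩
    · exact ⟨t - m, t₀ + m, ⟨by linarith, by linarith⟩, ⟨by linarith, by linarith⟩,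
        hoc.out e3 e2⟩
  have hlim : ∀ t, ∃ p, t ∈ I → Tendsto (fun n => W n t) atTop (𝓝 p) := by
    intro t
    by_cases ht : t ∈ I
    · obtain ⟨a, b, h1, h2, h3⟩ := hab t ht
      have hc : CauchySeq fun n => W n t := by
        rw [Metric.cauchySeq_iff]
        intro ε hε
        have h0 := Metric.cauchySeq_iff.1 h₀.cauchySeq (ε / Real.exp (K * (b - a)))
          (by positivity)
        obtain ⟨N, hN⟩ := h0
        obtain ⟨N', hN'⟩ := eventually_atTop.1 (hW a b h1 h3)
        refine ⟨max N N', fun m hm n hn => ?_⟩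
        have h4 := dist_le_of_trajectories hV h1 (hN' m ((le_max_right _ _).trans hm))
          (hN' n ((le_max_right _ _).trans hn)) t h2
        have h5 := hN m ((le_max_left _ _).trans hm) n ((le_max_left _ _).trans hn)
        rw [lt_div_iff₀ (Real.exp_pos _)] at h5
        exact h4.trans_lt h5
      obtain ⟨p, hp⟩ := cauchySeq_tendsto_of_complete hc
      exact ⟨p, fun _ => hp⟩
    · exact ⟨0, fun h => absurd h ht⟩
  choose w hw using hlim
  have hmem : ∀ t ∈ I, w t ∈ B := by
    intro t ht
    obtain ⟨a, b, h1, h2, h3⟩ := hab t ht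
    exact hB.mem_of_tendsto (hw t ht) ((hW a b h1 h3).mono fun n hn => (hn t h2).2)
  refine ⟨w, fun t ht => ⟨hw t ht, ?_, hmem t ht⟩⟩
  obtain ⟨a, b, h1, h2, h3⟩ := hab t ht
  have hsub : Set.Ioo a b ⊆ I := Set.Ioo_subset_Icc_self.trans h3
  have hev := hW a b h1 h3
  -- The Grönwall bound is uniform on (a, b), so the derivatives V(W n) converge uniformly.
  refine hasDerivAt_of_tendstoUniformlyOn (l := atTop) (f := W) (f' := fun n t => V (W n t))
    (g' := fun t => V (w t)) isOpen_Ioo ?_ (hev.mono fun n hn x hx => (hn x hx).1)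
    (fun x hx => hw x (hsub hx)) h2
  rw [Metric.tendstoUniformlyOn_iff]
  intro ε hε
  set L := Real.exp (K * (b - a)) with hL
  have hL0 : 0 < L := Real.exp_pos _
  have e0 : w₀ = w t₀ := tendsto_nhds_unique h₀ (hw t₀ ht₀)
  have hd : Tendsto (fun n => K * (dist (W n t₀) w₀ * L)) atTop (𝓝 (K * (dist w₀ w₀ * L))) :=
    ((h₀.dist tendsto_const_nhds).mul_const L).const_mul _
  rw [dist_self, zero_mul, mul_zero] at hd
  filter_upwards [hev, hd.eventually (gt_mem_nhds hε)] with n hn hnε x hx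
  have h4 : dist (W n x) (w x) ≤ dist (W n t₀) w₀ * L := by
    refine le_of_tendsto_of_tendsto (tendsto_const_nhds.dist (hw x (hsub hx)))
      ((tendsto_const_nhds.dist h₀).mul_const L) ?_
    filter_upwards [hev] with m hm
    exact dist_le_of_trajectories hV h1 hn hm x hx
  have h5 := hV.dist_le_mul _ (hn x hx).2 _ (hmem x (hsub hx))
  rw [dist_comm]
  exact (h5.trans (mul_le_mul_of_nonneg_left h4 K.coe_nonneg)).trans_lt hnε

end LimitsOfTrajectories

/-! ### Compactness of solutions and continuity in the speed. -/

section ProfileTrajectories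

/-- The profile equations without delay hold at `t`, and the values and the derivatives are in
`[0, 1]` and `[0, L]`. -/
structure IsProfileAt (r b L c : ℝ) (φ φ' ψ ψ' : ℝ → ℝ) (t : ℝ) : Prop where
  dφ : HasDerivAt φ (φ' t) t
  dφ' : HasDerivAt φ' (c * φ' t - φ t * (1 - r - φ t + r * ψ t)) t
  dψ : HasDerivAt ψ (ψ' t) t
  dψ' : HasDerivAt ψ' (c * ψ' t - b * φ t * (1 - ψ t)) t
  mem_φ : φ t ∈ Set.Icc 0 1
  mem_φ' : φ' t ∈ Set.Icc 0 L
  mem_ψ : ψ t ∈ Set.Icc 0 1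
  mem_ψ' : ψ' t ∈ Set.Icc 0 L

/-- The vector field of the profile equations, the speed being a coordinate. -/
def profileField (r b : ℝ) (w : ℝ × ℝ × ℝ × ℝ × ℝ) : ℝ × ℝ × ℝ × ℝ × ℝ :=
  (0, w.2.2.1, w.1 * w.2.2.1 - w.2.1 * (1 - r - w.2.1 + r * w.2.2.2.1), w.2.2.2.2,
    w.1 * w.2.2.2.2 - b * w.2.1 * (1 - w.2.2.2.1))

variable {r b L : ℝ}

lemma contDiff_profileField : ContDiff ℝ 1 (profileField r b) := by
  unfold profileField; fun_prop

lemma IsProfileAt.hasDerivAt {c : ℝ} {φ φ' ψ ψ' : ℝ → ℝ} {t : ℝ}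
    (H : IsProfileAt r b L c φ φ' ψ ψ' t) :
    HasDerivAt (fun t => (c, φ t, φ' t, ψ t, ψ' t))
      (profileField r b (c, φ t, φ' t, ψ t, ψ' t)) t :=
  (hasDerivAt_const t c).prodMk (H.dφ.prodMk (H.dφ'.prodMk (H.dψ.prodMk H.dψ')))

/-- A sequence of solutions of the profile equations has a subsequence which converges to a
solution. -/
lemma exists_subseq_tendsto_profile {c : ℕ → ℝ} {φ φ' ψ ψ' : ℕ → ℝ → ℝ}
    (hc : ∀ n, c n ∈ Set.Icc 0 2) {I : Set ℝ} (hI : IsOpen I) (hconv : Convex ℝ I) {t₀ : ℝ}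
    (ht₀ : t₀ ∈ I)
    (hW : ∀ a b', t₀ ∈ Set.Ioo a b' → Set.Icc a b' ⊆ I → ∀ᶠ n in atTop, ∀ t ∈ Set.Ioo a b',
      IsProfileAt r b L (c n) (φ n) (φ' n) (ψ n) (ψ' n) t) :
    ∃ (ns : ℕ → ℕ) (c₀ : ℝ) (f f' g g' : ℝ → ℝ), StrictMono ns ∧ c₀ ∈ Set.Icc 0 2 ∧
      Tendsto (fun n => c (ns n)) atTop (𝓝 c₀) ∧ ∀ t ∈ I, IsProfileAt r b L c₀ f f' g g' t ∧
      Tendsto (fun n => φ (ns n) t) atTop (𝓝 (f t)) ∧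
      Tendsto (fun n => φ' (ns n) t) atTop (𝓝 (f' t)) ∧
      Tendsto (fun n => ψ (ns n) t) atTop (𝓝 (g t)) ∧
      Tendsto (fun n => ψ' (ns n) t) atTop (𝓝 (g' t)) := by
  -- With the speed as a coordinate, a single vector field with a single Lipschitz constant on B
  -- serves all n.
  set B : Set (ℝ × ℝ × ℝ × ℝ × ℝ) := Set.Icc (0, 0, 0, 0, 0) (2, 1, L, 1, L) with hB
  have cB : IsCompact B := isCompact_Icc
  obtain ⟨K, hK⟩ := (contDiff_profileField (r := r)
    (b := b)).locallyLipschitz.locallyLipschitzOn.exists_lipschitzOnWith_of_compact cB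
  set W : ℕ → ℝ → ℝ × ℝ × ℝ × ℝ × ℝ := fun n t => (c n, φ n t, φ' n t, ψ n t, ψ' n t) with hWdef
  have hWB : ∀ n t, IsProfileAt r b L (c n) (φ n) (φ' n) (ψ n) (ψ' n) t → W n t ∈ B := fun n t h =>
    ⟨⟨(hc n).1, h.mem_φ.1, h.mem_φ'.1, h.mem_ψ.1, h.mem_ψ'.1⟩,
      ⟨(hc n).2, h.mem_φ.2, h.mem_φ'.2, h.mem_ψ.2, h.mem_ψ'.2⟩⟩
  obtain ⟨ε, hε, hball⟩ := Metric.isOpen_iff.1 hI _ ht₀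
  have hev := hW (t₀ - ε / 2) (t₀ + ε / 2) ⟨by linarith, by linarith⟩ (fun t ht => hball (by
    rw [Metric.mem_ball, Real.dist_eq, abs_lt]
    exact ⟨by linarith [ht.1], by linarith [ht.2]⟩))
  obtain ⟨N, hN⟩ := eventually_atTop.1 hev
  obtain ⟨w₀, -, ms, hms, hlim⟩ := cB.tendsto_subseq (x := fun n => W (n + N) t₀)
    (fun n => hWB _ _ (hN _ (Nat.le_add_left _ _) t₀ ⟨by linarith, by linarith⟩))
  set ns : ℕ → ℕ := fun n => ms n + N with hns
  have hns_mono : StrictMono ns := fun i j hij => Nat.add_lt_add_right (hms hij) N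
  obtain ⟨w, hw⟩ := exists_tendsto_trajectories hK cB.isClosed (W := fun n => W (ns n)) hlim hI
    hconv ht₀ (fun a b' h1 h2 => by
      filter_upwards [hns_mono.tendsto_atTop.eventually (hW a b' h1 h2)] with n hn t ht
      exact ⟨(hn t ht).hasDerivAt, hWB _ _ (hn t ht)⟩)
  have l0 : ∀ t ∈ I, Tendsto (fun n => c (ns n)) atTop (𝓝 (w t).1) := fun t ht =>
    (hw t ht).1.fst_nhds
  have e0 : ∀ t ∈ I, (w t).1 = (w t₀).1 := fun t ht =>
    tendsto_nhds_unique (l0 t ht) (l0 t₀ ht₀)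
  refine ⟨ns, (w t₀).1, fun t => (w t).2.1, fun t => (w t).2.2.1, fun t => (w t).2.2.2.1,
    fun t => (w t).2.2.2.2, hns_mono, ?_, l0 t₀ ht₀, fun t ht => ?_⟩
  · have := (hw t₀ ht₀).2.2
    exact ⟨this.1.1, this.2.1⟩
  · obtain ⟨h1, h2, h3, h4⟩ := hw t ht
    have d1 := hasDerivAt_iff_hasFDerivAt.1 h2
    have s1 := d1.snd
    have s2 := s1.snd
    have s3 := s2.snd
    have f1 := s1.fst.hasDerivAt
    have f2 := s2.fst.hasDerivAt
    have f3 := s3.fst.hasDerivAt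
    have f4 := s3.snd.hasDerivAt
    refine ⟨⟨?_, ?_, ?_, ?_, ?_, ?_, ?_, ?_⟩, h1.snd_nhds.fst_nhds,
      h1.snd_nhds.snd_nhds.fst_nhds, h1.snd_nhds.snd_nhds.snd_nhds.fst_nhds,
      h1.snd_nhds.snd_nhds.snd_nhds.snd_nhds⟩
    · exact f1.congr_deriv (by simp [profileField])
    · exact f2.congr_deriv (by simp [profileField, e0 t ht])
    · exact f3.congr_deriv (by simp [profileField])
    · exact f4.congr_deriv (by simp [profileField, e0 t ht])
    · exact ⟨h3.2.1, h4.2.1⟩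
    · exact ⟨h3.2.2.1, h4.2.2.1⟩
    · exact ⟨h3.2.2.2.1, h4.2.2.2.1⟩
    · exact ⟨h3.2.2.2.2, h4.2.2.2.2⟩

/-- A bound of the derivative of a bounded monotone function by means of the second derivative. -/
lemma deriv_le_of_deriv_deriv_le {ℓ M : ℝ} (hℓ : 2 ≤ ℓ) (hM : 0 ≤ M) {f f' f'' : ℝ → ℝ}
    (hf : ContinuousOn f (Set.Icc 0 ℓ)) (hmem : ∀ x ∈ Set.Icc 0 ℓ, f x ∈ Set.Icc 0 1)
    (h1 : ∀ x ∈ Set.Ioo 0 ℓ, HasDerivAt f (f' x) x)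
    (h2 : ∀ x ∈ Set.Ioo 0 ℓ, HasDerivAt f' (f'' x) x)
    (hle : ∀ x ∈ Set.Ioo 0 ℓ, f'' x ≤ 2 * f' x + M) (hge : ∀ x ∈ Set.Ioo 0 ℓ, -M ≤ f'' x) :
    ∀ x ∈ Set.Ioo 0 ℓ, f' x ≤ (1 + M) * Real.exp 2 := by
  intro x hx
  have slope : ∀ z ∈ Set.Icc 0 (ℓ - 1), ∃ y ∈ Set.Ioo z (z + 1), f' y ≤ 1 := by
    intro z hz
    obtain ⟨y, hy, e⟩ := exists_hasDerivAt_eq_slope f f' (a := z) (b := z + 1) (by linarith)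
      (hf.mono (Set.Icc_subset_Icc hz.1 (by linarith [hz.2])))
      (fun y hy => h1 y ⟨by linarith [hy.1, hz.1], by linarith [hy.2, hz.2]⟩)
    refine ⟨y, hy, ?_⟩
    have a1 := (hmem z ⟨hz.1, by linarith [hz.2]⟩).1
    have a2 := (hmem (z + 1) ⟨by linarith [hz.1], by linarith [hz.2]⟩).2
    rw [e, add_sub_cancel_left, div_one]
    linarith
  have hexp : 1 ≤ Real.exp 2 := Real.one_le_exp (by norm_num)
  -- A nearby point y with slope at most 1 lies to the right of x or to the left; from the right the
  -- lower bound of f'' carries the estimate to x, from the left the upper one does, with e² from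
  -- the integrating factor.
  rcases le_total x 1 with h | h
  · obtain ⟨y, hy, hy1⟩ := slope x ⟨hx.1.le, by linarith⟩
    have hmono := monotoneOn_of_hasDerivAt_nonneg (convex_Ioo 0 ℓ) (f := fun x => f' x + M * x)
      (f' := fun x => f'' x + M * 1) (fun x hx => (h2 x hx).add ((hasDerivAt_id x).const_mul M))
      (fun x hx => by have := hge x hx; linarith)
    have h3 := hmono hx ⟨by linarith [hy.1, hx.1], by linarith [hy.2]⟩ hy.1.le
    simp only at h3
    have h4 : M * y ≤ M * (x + 1) := mul_le_mul_of_nonneg_left hy.2.le hM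
    nlinarith
  · obtain ⟨y, hy, hy1⟩ := slope (x - 1) ⟨by linarith, by linarith [hx.2]⟩
    rw [sub_add_cancel] at hy
    have hanti := antitoneOn_mul_exp_of_deriv_le (convex_Ioo 0 ℓ) (Q := fun x => f' x + M / 2)
      (q := f'') (l := 2) (fun x hx => (h2 x hx).add_const _)
      (fun x hx => by have := hle x hx; linarith)
    have h3 := hanti (a := y) (b := x) ⟨by linarith [hy.1], by linarith [hy.2, hx.2]⟩ hx hy.2.le
    simp only at h3
    have e : f' x + M / 2 = (f' x + M / 2) * Real.exp (-(2 * x)) * Real.exp (2 * x) := by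
      rw [mul_assoc, ← Real.exp_add]; simp
    have h4 : (f' y + M / 2) * Real.exp (-(2 * y)) * Real.exp (2 * x) ≤
        (1 + M / 2) * Real.exp 2 := by
      rw [mul_assoc, ← Real.exp_add]
      refine (mul_le_mul_of_nonneg_right (by linarith) (Real.exp_pos _).le).trans
        (mul_le_mul_of_nonneg_left (Real.exp_le_exp.2 (by linarith [hy.1])) (by linarith))
    have h5 := mul_le_mul_of_nonneg_right h3 (Real.exp_pos (2 * x)).le
    rw [← e] at h5
    nlinarith

/-- The bound of the derivatives of the profiles. -/
noncomputable def derivBound (r b : ℝ) : ℝ := (1 + (r + 1 + b)) * Real.exp 2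

namespace IsDirichletSolution

variable {c ℓ : ℝ} {φ φ' ψ ψ' : ℝ → ℝ}

lemma isProfileAt (H : IsDirichletSolution r b c ℓ φ φ' ψ ψ') (hr : 0 ≤ r) (hb : 0 ≤ b)
    (hℓ : 2 ≤ ℓ) (hc : c ∈ Set.Icc 0 2) :
    ∀ x ∈ Set.Ioo 0 ℓ, IsProfileAt r b (derivBound r b) c φ φ' ψ ψ' x := by
  have hℓ0 : 0 < ℓ := by linarith
  have hd := H.deriv_nonneg hr hb hℓ0
  have key : ∀ x ∈ Set.Ioo 0 ℓ, 0 ≤ φ x * (1 - φ x) ∧ φ x * (1 - φ x) ≤ 1 ∧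
      0 ≤ r * (φ x * (1 - ψ x)) ∧ r * (φ x * (1 - ψ x)) ≤ r ∧ 0 ≤ b * (φ x * (1 - ψ x)) ∧
      b * (φ x * (1 - ψ x)) ≤ b := by
    intro x hx
    have h1 := H.mem_φ x (Set.Ioo_subset_Icc_self hx)
    have h2 := H.mem_ψ x (Set.Ioo_subset_Icc_self hx)
    have h3 : 0 ≤ φ x * (1 - ψ x) := mul_nonneg h1.1 (by linarith [h2.2])
    have h4 : φ x * (1 - ψ x) ≤ 1 := mul_le_one₀ h1.2 (by linarith [h2.2]) (by linarith [h2.1])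
    exact ⟨mul_nonneg h1.1 (by linarith [h1.2]),
      mul_le_one₀ h1.2 (by linarith [h1.2]) (by linarith [h1.1]), mul_nonneg hr h3,
      mul_le_of_le_one_right hr h4, mul_nonneg hb h3, mul_le_of_le_one_right hb h4⟩
  have hcd : ∀ {z : ℝ}, 0 ≤ z → 0 ≤ c * z ∧ c * z ≤ 2 * z := fun hz =>
    ⟨mul_nonneg hc.1 hz, mul_le_mul_of_nonneg_right hc.2 hz⟩
  have b1 := deriv_le_of_deriv_deriv_le (M := r + 1 + b) hℓ (by linarith) H.cont_φ H.mem_φ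
    H.dφ H.dφ' (fun x hx => by
      obtain ⟨a1, a2, a3, a4, a5, a6⟩ := key x hx
      linarith [(hcd (hd x hx).1).2]) (fun x hx => by
      obtain ⟨a1, a2, a3, a4, a5, a6⟩ := key x hx
      linarith [(hcd (hd x hx).1).1])
  have b2 := deriv_le_of_deriv_deriv_le (M := r + 1 + b) hℓ (by linarith) H.cont_ψ H.mem_ψ
    H.dψ H.dψ' (fun x hx => by
      obtain ⟨a1, a2, a3, a4, a5, a6⟩ := key x hx
      linarith [(hcd (hd x hx).2).2]) (fun x hx => by
      obtain ⟨a1, a2, a3, a4, a5, a6⟩ := key x hx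
      linarith [(hcd (hd x hx).2).1])
  intro x hx
  exact ⟨H.dφ x hx, H.dφ' x hx, H.dψ x hx, H.dψ' x hx, H.mem_φ x (Set.Ioo_subset_Icc_self hx),
    ⟨(hd x hx).1, b1 x hx⟩, H.mem_ψ x (Set.Ioo_subset_Icc_self hx), ⟨(hd x hx).2, b2 x hx⟩⟩

end IsDirichletSolution

lemma sub_le_mul_of_deriv_le {ℓ L : ℝ} {f f' : ℝ → ℝ} (hf : ContinuousOn f (Set.Icc 0 ℓ))
    (h1 : ∀ x ∈ Set.Ioo 0 ℓ, HasDerivAt f (f' x) x)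
    (h2 : ∀ x ∈ Set.Ioo 0 ℓ, f' x ∈ Set.Icc 0 L) {x y : ℝ} (hx : 0 ≤ x) (hxy : x ≤ y)
    (hy : y ≤ ℓ) : 0 ≤ f y - f x ∧ f y - f x ≤ L * (y - x) := by
  rcases hxy.eq_or_lt with rfl | hlt
  · simp
  obtain ⟨z, hz, e⟩ := exists_hasDerivAt_eq_slope f f' hlt (hf.mono (Set.Icc_subset_Icc hx hy))
    (fun z hz => h1 z ⟨hx.trans_lt hz.1, hz.2.trans_le hy⟩)
  rw [eq_div_iff (by linarith)] at e
  obtain ⟨b1, b2⟩ := h2 z ⟨hx.trans_lt hz.1, hz.2.trans_le hy⟩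
  rw [← e]
  exact ⟨mul_nonneg b1 (by linarith), mul_le_mul_of_nonneg_right b2 (by linarith)⟩

/-- Extension to the boundary of the limit of a sequence of functions with bounded derivatives. -/
lemma exists_extension_limit {ℓ L : ℝ} (hℓ : 0 < ℓ) (hL : 0 ≤ L) {f f' : ℕ → ℝ → ℝ} {g : ℝ → ℝ}
    (hf : ∀ n, ContinuousOn (f n) (Set.Icc 0 ℓ))
    (h1 : ∀ n, ∀ x ∈ Set.Ioo 0 ℓ, HasDerivAt (f n) (f' n x) x)
    (h2 : ∀ n, ∀ x ∈ Set.Ioo 0 ℓ, f' n x ∈ Set.Icc 0 L)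
    (h0 : ∀ n, f n 0 = 0) (hr : ∀ n, f n ℓ = 1)
    (hg : ∀ x ∈ Set.Ioo 0 ℓ, Tendsto (fun n => f n x) atTop (𝓝 (g x))) :
    ∃ G : ℝ → ℝ, ContinuousOn G (Set.Icc 0 ℓ) ∧ G 0 = 0 ∧ G ℓ = 1 ∧
      ∀ x ∈ Set.Ioo 0 ℓ, G x = g x := by
  set G : ℝ → ℝ := fun x => if x ≤ 0 then 0 else if ℓ ≤ x then 1 else g x with hG
  have lim : ∀ x ∈ Set.Icc 0 ℓ, Tendsto (fun n => f n x) atTop (𝓝 (G x)) := by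
    intro x hx
    simp only [hG]
    split_ifs with h3 h4
    · have : x = 0 := le_antisymm h3 hx.1
      simp [this, h0]
    · have : x = ℓ := le_antisymm hx.2 h4
      simp [this, hr]
    · exact hg x ⟨not_le.1 h3, not_le.1 h4⟩
  refine ⟨G, ?_, by simp [hG], by simp [hG, hℓ.not_ge], fun x hx => by
    simp [hG, hx.1.not_ge, hx.2.not_ge]⟩
  refine (LipschitzOnWith.of_dist_le_mul (K := ⟨L, hL⟩) fun x hx y hy => ?_).continuousOn
  refine le_of_tendsto' ((lim x hx).dist (lim y hy)) fun n => ?_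
  rw [Real.dist_eq, Real.dist_eq]
  change _ ≤ L * |x - y|
  rcases le_total x y with h | h
  · have := sub_le_mul_of_deriv_le (hf n) (h1 n) (h2 n) hx.1 h hy.2
    rw [abs_sub_comm, abs_sub_comm x y, abs_of_nonneg this.1, abs_of_nonneg (by linarith)]
    exact this.2
  · have := sub_le_mul_of_deriv_le (hf n) (h1 n) (h2 n) hy.1 h hx.2
    rw [abs_of_nonneg this.1, abs_of_nonneg (by linarith)]
    exact this.2

/-- The solutions of the Dirichlet problem depend continuously on the speed. -/
theorem continuous_dirichletSolution (hr : 0 ≤ r) (hb : 0 ≤ b) {ℓ : ℝ} (hℓ : 2 ≤ ℓ)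
    {φ φ' ψ ψ' : Set.Icc (0 : ℝ) 2 → ℝ → ℝ}
    (H : ∀ c : Set.Icc (0 : ℝ) 2, IsDirichletSolution r b c ℓ (φ c) (φ' c) (ψ c) (ψ' c)) {x₀ : ℝ}
    (hx₀ : x₀ ∈ Set.Ioo 0 ℓ) : Continuous fun c => φ c x₀ := by
  have hℓ0 : 0 < ℓ := by linarith
  have hP := fun c : Set.Icc (0 : ℝ) 2 => (H c).isProfileAt hr hb hℓ c.2
  have hL : 0 ≤ derivBound r b := by unfold derivBound; positivity
  -- Every subsequence has a further one converging to a solution for the limit speed; uniqueness of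
  -- φ identifies the limit.
  rw [continuous_iff_seqContinuous]
  intro u c hu
  refine tendsto_of_subseq_tendsto fun ms hms => ?_
  obtain ⟨ns, c₀, f, f', g, g', hns, hc₀, hlimc, hlim⟩ := exists_subseq_tendsto_profile
    (c := fun n => (u (ms n) : ℝ)) (φ := fun n => φ (u (ms n))) (φ' := fun n => φ' (u (ms n)))
    (ψ := fun n => ψ (u (ms n))) (ψ' := fun n => ψ' (u (ms n))) (fun n => (u (ms n)).2)
    isOpen_Ioo (convex_Ioo 0 ℓ) hx₀ (fun a b' h1 h2 => Eventually.of_forall fun n t ht =>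
      hP _ t (h2 (Set.Ioo_subset_Icc_self ht)))
  refine ⟨ns, ?_⟩
  have ec : c₀ = c := tendsto_nhds_unique hlimc
    ((continuous_subtype_val.tendsto c).comp (hu.comp (hms.comp hns.tendsto_atTop)))
  subst ec
  obtain ⟨F, cF, F0, Fℓ, eF⟩ := exists_extension_limit hℓ0 hL
    (fun n => (H (u (ms (ns n)))).cont_φ) (fun n => (H (u (ms (ns n)))).dφ)
    (fun n x hx => (hP (u (ms (ns n))) x hx).mem_φ') (fun n => (H _).φ_zero)
    (fun n => (H _).φ_right) (fun x hx => (hlim x hx).2.1)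
  obtain ⟨G, cG, G0, Gℓ, eG⟩ := exists_extension_limit hℓ0 hL
    (fun n => (H (u (ms (ns n)))).cont_ψ) (fun n => (H (u (ms (ns n)))).dψ)
    (fun n x hx => (hP (u (ms (ns n))) x hx).mem_ψ') (fun n => (H _).ψ_zero)
    (fun n => (H _).ψ_right) (fun x hx => (hlim x hx).2.2.2.1)
  have nF : ∀ x ∈ Set.Ioo 0 ℓ, F =ᶠ[𝓝 x] f := fun x hx => by
    filter_upwards [Ioo_mem_nhds hx.1 hx.2] with y hy using eF y hy
  have nG : ∀ x ∈ Set.Ioo 0 ℓ, G =ᶠ[𝓝 x] g := fun x hx => by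
    filter_upwards [Ioo_mem_nhds hx.1 hx.2] with y hy using eG y hy
  have mem : ∀ {F f : ℝ → ℝ}, F 0 = 0 → F ℓ = 1 → (∀ x ∈ Set.Ioo 0 ℓ, F x = f x) →
      (∀ x ∈ Set.Ioo 0 ℓ, f x ∈ Set.Icc 0 1) → ∀ x ∈ Set.Icc 0 ℓ, F x ∈ Set.Icc 0 1 := by
    intro F f h0 h1 h2 h3 x hx
    rcases hx.1.eq_or_lt with rfl | h4
    · rw [h0]; exact ⟨le_rfl, zero_le_one⟩
    rcases hx.2.eq_or_lt with rfl | h5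
    · rw [h1]; exact ⟨zero_le_one, le_rfl⟩
    rw [h2 x ⟨h4, h5⟩]
    exact h3 x ⟨h4, h5⟩
  have HF : IsDirichletSolution r b c ℓ F f' G g' :=
    { cont_φ := cF
      cont_ψ := cG
      dφ := fun x hx => (hlim x hx).1.dφ.congr_of_eventuallyEq (nF x hx)
      dφ' := fun x hx => by rw [eF x hx, eG x hx]; exact (hlim x hx).1.dφ'
      dψ := fun x hx => (hlim x hx).1.dψ.congr_of_eventuallyEq (nG x hx)
      dψ' := fun x hx => by rw [eF x hx, eG x hx]; exact (hlim x hx).1.dψ'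
      φ_zero := F0
      ψ_zero := G0
      φ_right := Fℓ
      ψ_right := Gℓ
      mem_φ := mem F0 Fℓ eF fun x hx => (hlim x hx).1.mem_φ
      mem_ψ := mem G0 Gℓ eG fun x hx => (hlim x hx).1.mem_ψ }
  have h := (hlim x₀ hx₀).2.1
  rwa [← eF x₀ hx₀, HF.φ_unique (H c) hr hb hℓ0 x₀ hx₀] at h

end ProfileTrajectories

/-! ### Choice of the speed by the intermediate value theorem. -/

section Normalization

lemma chord_le_of_antitoneOn_deriv {ℓ : ℝ} {f f' : ℝ → ℝ} (hf : ContinuousOn f (Set.Icc 0 ℓ))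
    (h1 : ∀ x ∈ Set.Ioo 0 ℓ, HasDerivAt f (f' x) x) (h2 : AntitoneOn f' (Set.Ioo 0 ℓ)) {x : ℝ}
    (hx : x ∈ Set.Ioo 0 ℓ) : x * f ℓ + (ℓ - x) * f 0 ≤ ℓ * f x := by
  obtain ⟨y, hy, ey⟩ := exists_hasDerivAt_eq_slope f f' hx.1
    (hf.mono (Set.Icc_subset_Icc_right hx.2.le)) (fun z hz => h1 z ⟨hz.1, hz.2.trans hx.2⟩)
  obtain ⟨z, hz, ez⟩ := exists_hasDerivAt_eq_slope f f' hx.2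
    (hf.mono (Set.Icc_subset_Icc_left hx.1.le)) (fun z hz => h1 z ⟨hx.1.trans hz.1, hz.2⟩)
  have h := h2 ⟨hy.1, hy.2.trans hx.2⟩ ⟨hx.1.trans hz.1, hz.2⟩ (hy.2.trans hz.1).le
  rw [ey, ez, div_le_div_iff₀ (by linarith [hx.2]) (by linarith [hx.1])] at h
  linarith

namespace IsDirichletSolution

variable {r b c ℓ : ℝ} {φ φ' ψ ψ' : ℝ → ℝ}

/-- For c = 0 the function ψ is concave, so ψ ≥ x/ℓ. If the value were at most 1/4, then φ'' ≤ -φ/4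
on [ℓ - 2N, ℓ - N]. From φ' ≥ 0 at the right end, the slope on the left half is at least mN/8, with
m the value at the midpoint; the increase there is at least mN²/16 ≥ m, against φ > 0. -/
lemma quarter_lt_of_speed_zero (H : IsDirichletSolution r b 0 ℓ φ φ' ψ ψ') (hr : 1 < r)
    (hb : 0 < b) (hℓ : 16 * r ≤ ℓ) : 1 / 4 < φ (ℓ - ℓ / (4 * r)) := by
  have hr0 : 0 < r := by linarith
  have hℓ0 : 0 < ℓ := by linarith
  set N := ℓ / (4 * r) with hN
  have hNℓ : 4 * r * N = ℓ := by rw [hN]; field_simp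
  have hN4 : 4 ≤ N := by rw [hN, le_div_iff₀ (by linarith)]; linarith
  have hN1 : 4 * N < ℓ := by rw [← hNℓ]; nlinarith
  by_contra hcon
  push Not at hcon
  obtain ⟨mφ, -⟩ := H.monotoneOn hr0.le hb.le hℓ0
  have hd := H.deriv_nonneg hr0.le hb.le hℓ0
  have hψ : ∀ x ∈ Set.Ioo 0 ℓ, x ≤ ℓ * ψ x := by
    intro x hx
    have := chord_le_of_antitoneOn_deriv H.cont_ψ H.dψ
      (antitoneOn_of_hasDerivAt_nonpos (convex_Ioo 0 ℓ) H.dψ' fun y hy => by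
        have h1 := H.mem_φ y (Set.Ioo_subset_Icc_self hy)
        have h2 := H.mem_ψ y (Set.Ioo_subset_Icc_self hy)
        have := mul_nonneg (mul_nonneg hb.le h1.1) (sub_nonneg.2 h2.2)
        linarith) hx
    rw [H.ψ_zero, H.ψ_right] at this
    linarith
  set p := ℓ - 2 * N with hp
  set q := ℓ - 3 / 2 * N with hq
  have sub : Set.Icc p (ℓ - N) ⊆ Set.Ioo 0 ℓ := Set.Icc_subset_Ioo (by linarith) (by linarith)
  have hφ4 : ∀ x ∈ Set.Icc p (ℓ - N), 0 * φ' x - φ x * (1 - r - φ x + r * ψ x) ≤ -(φ x / 4) := by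
    intro x hx
    have hx' := sub hx
    have h1 := mφ (Set.Ioo_subset_Icc_self hx') ⟨by linarith, by linarith⟩ hx.2
    have h2 := (H.mem_φ x (Set.Ioo_subset_Icc_self hx')).1
    have h3 : r - 1 / 2 ≤ r * ψ x := by
      have h4 := hψ x hx'
      have h5 := hx.1
      rw [hp] at h5
      have h6 : 4 * N * (r - 1 / 2) ≤ 4 * N * (r * ψ x) := by
        have e : 4 * N * (r * ψ x) = ℓ * ψ x := by rw [← hNℓ]; ring
        rw [e]
        linarith
      exact le_of_mul_le_mul_left h6 (by linarith)
    nlinarith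
  set m := φ q with hm
  have hm0 : 0 < m := H.pos_φ hr0.le hℓ0 q ⟨by linarith, by linarith⟩
  have sub₁ : Set.Icc q (ℓ - N) ⊆ Set.Icc p (ℓ - N) := Set.Icc_subset_Icc_left (by linarith)
  have sub₂ : Set.Icc p q ⊆ Set.Icc p (ℓ - N) := Set.Icc_subset_Icc_right (by linarith)
  have s1 : m * N / 8 ≤ φ' q := by
    have hanti := antitoneOn_of_hasDerivAt_nonpos (convex_Icc q (ℓ - N))
      (f := fun x => φ' x + m / 4 * x)
      (fun x hx => (H.dφ' x (sub (sub₁ hx))).add ((hasDerivAt_id x).const_mul (m / 4)))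
      (fun x hx => by
        have h1 := hφ4 x (sub₁ hx)
        have h2 : m ≤ φ x := mφ ⟨by linarith, by linarith⟩
          (Set.Ioo_subset_Icc_self (sub (sub₁ hx))) hx.1
        linarith)
    have h1 := hanti (a := q) (b := ℓ - N) ⟨le_rfl, by linarith⟩ ⟨by linarith, le_rfl⟩
      (by linarith)
    simp only at h1
    have h2 := (hd (ℓ - N) ⟨by linarith, by linarith⟩).1
    rw [hq] at h1 ⊢
    linarith
  have s2 : ∀ x ∈ Set.Icc p q, m * N / 8 ≤ φ' x := by
    intro x hx
    have hanti := antitoneOn_of_hasDerivAt_nonpos (convex_Icc p q)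
      (fun x hx => H.dφ' x (sub (sub₂ hx))) (fun x hx => by
        have h1 := hφ4 x (sub₂ hx)
        have h2 := (H.mem_φ x (Set.Ioo_subset_Icc_self (sub (sub₂ hx)))).1
        linarith)
    exact s1.trans (hanti hx ⟨by linarith, le_rfl⟩ hx.2)
  have hmono := monotoneOn_of_hasDerivAt_nonneg (convex_Icc p q)
    (f := fun x => φ x - m * N / 8 * x)
    (fun x hx => (H.dφ x (sub (sub₂ hx))).sub ((hasDerivAt_id x).const_mul (m * N / 8)))
    (fun x hx => by linarith [s2 x hx])
  have h1 := hmono (a := p) (b := q) ⟨le_rfl, by linarith⟩ ⟨by linarith, le_rfl⟩ (by linarith)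
  simp only at h1
  have h2 := H.pos_φ hr0.le hℓ0 p ⟨by linarith, by linarith⟩
  have e : m * N / 8 * q - m * N / 8 * p = m * (N ^ 2 / 16) := by rw [hp, hq]; ring
  have h3 : m * 1 ≤ m * (N ^ 2 / 16) := mul_le_mul_of_nonneg_left (by nlinarith) hm0.le
  rw [← hm] at h1
  linarith

/-- For c = 2 the function φ e^{-x} is convex, since φ'' - 2φ' + φ = φ(φ + r(1 - ψ)) ≥ 0, and hence
lies below its chord. -/
lemma φ_le_exp_of_speed_two (H : IsDirichletSolution r b 2 ℓ φ φ' ψ ψ') (hr : 0 ≤ r)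
    (hℓ : 0 < ℓ) {x : ℝ} (hx : x ∈ Set.Ioo 0 ℓ) : φ x ≤ Real.exp (x - ℓ) := by
  have de : ∀ x : ℝ, HasDerivAt (fun x => Real.exp (-x)) (-Real.exp (-x)) x := fun x => by
    simpa using (hasDerivAt_neg x).exp
  have hmono : AntitoneOn (fun x => -((φ' x - φ x) * Real.exp (-x))) (Set.Ioo 0 ℓ) := by
    refine antitoneOn_of_hasDerivAt_nonpos (convex_Ioo 0 ℓ) (fun x hx =>
      (((H.dφ' x hx).sub (H.dφ x hx)).mul (de x)).neg) (fun x hx => ?_)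
    have h1 := H.mem_φ x (Set.Ioo_subset_Icc_self hx)
    have h2 := H.mem_ψ x (Set.Ioo_subset_Icc_self hx)
    have h3 : 0 ≤ φ x * (φ x + r * (1 - ψ x)) * Real.exp (-x) :=
      mul_nonneg (mul_nonneg h1.1 (add_nonneg h1.1 (mul_nonneg hr (by linarith [h2.2]))))
        (Real.exp_pos _).le
    simp only [Pi.sub_apply]
    linarith
  have h := chord_le_of_antitoneOn_deriv (f := fun x => -(φ x * Real.exp (-x)))
    (H.cont_φ.mul (by fun_prop)).neg
    (fun x hx => ((H.dφ x hx).mul (de x)).neg.congr_deriv (by ring)) hmono hx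
  simp only [H.φ_right, H.φ_zero, zero_mul, neg_zero, mul_zero, add_zero, one_mul] at h
  have h4 : ℓ * (φ x * Real.exp (-x)) ≤ ℓ * Real.exp (-ℓ) := by
    have := mul_le_mul_of_nonneg_right hx.2.le (Real.exp_pos (-ℓ)).le
    linarith
  have h5 := mul_le_mul_of_nonneg_right (le_of_mul_le_mul_left h4 hℓ) (Real.exp_pos x).le
  rw [mul_assoc, ← Real.exp_add, ← Real.exp_add, neg_add_cancel, Real.exp_zero, mul_one] at h5
  rwa [show x - ℓ = -ℓ + x by ring]

end IsDirichletSolution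

/-- A speed for which the solution of the Dirichlet problem takes the value `1 / 4` at a given
point. -/
theorem exists_normalized_dirichletSolution {r b ℓ : ℝ} (hr : 1 < r) (hb : 0 < b)
    (hℓ : 16 * r ≤ ℓ) : ∃ c ∈ Set.Icc (0 : ℝ) 2, ∃ φ φ' ψ ψ',
      IsDirichletSolution r b c ℓ φ φ' ψ ψ' ∧ φ (ℓ - ℓ / (4 * r)) = 1 / 4 := by
  have hr0 : 0 < r := by linarith
  have hℓ0 : 0 < ℓ := by linarith
  have hN4 : 4 ≤ ℓ / (4 * r) := by rw [le_div_iff₀ (by linarith)]; linarith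
  have hN1 : ℓ / (4 * r) < ℓ := div_lt_self hℓ0 (by linarith)
  choose φ φ' ψ ψ' H using fun c : Set.Icc (0 : ℝ) 2 =>
    exists_isDirichletSolution hr0.le hb.le (c : ℝ) hℓ0
  have hx₀ : ℓ - ℓ / (4 * r) ∈ Set.Ioo 0 ℓ := ⟨by linarith, by linarith⟩
  have hc := continuous_dirichletSolution hr0.le hb.le (by linarith) H hx₀
  have h0 := (H ⟨0, by norm_num⟩).quarter_lt_of_speed_zero hr hb hℓ
  have h2 : φ ⟨2, by norm_num⟩ (ℓ - ℓ / (4 * r)) ≤ 1 / 4 := by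
    refine ((H ⟨2, by norm_num⟩).φ_le_exp_of_speed_two hr0.le hℓ0 hx₀).trans ?_
    rw [sub_sub_cancel_left, Real.exp_neg, ← one_div]
    exact one_div_le_one_div_of_le (by norm_num)
      (by linarith [Real.add_one_le_exp (ℓ / (4 * r))])
  have : PreconnectedSpace (Set.Icc (0 : ℝ) 2) := Subtype.preconnectedSpace isPreconnected_Icc
  obtain ⟨c, hc'⟩ := mem_range_of_exists_le_of_exists_ge hc ⟨_, h2⟩ ⟨_, h0.le⟩
  exact ⟨c, c.2, _, _, _, _, H c, hc'⟩

end Normalization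

/-! ### Control of ψ where φ is small, uniformly in the interval. -/

section LeftTail

namespace IsDirichletSolution

variable {r b c ℓ : ℝ} {φ φ' ψ ψ' : ℝ → ℝ}

/-- Where `ψ` is small, the combined flux of the two components is nonnegative. -/
lemma flux_nonneg (H : IsDirichletSolution r b c ℓ φ φ' ψ ψ') (hr : 1 < r) (hb : 0 < b)
    {x : ℝ} (hx : x ∈ Set.Ioo 0 ℓ) (hψ : ψ x ≤ (r - 1) / (2 * r)) :
    0 ≤ ψ' x - c * ψ x + 2 * b / (r - 1) * (φ' x - c * φ x) := by
  have hr0 : 0 < r := by linarith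
  have hr1 : 0 < r - 1 := by linarith
  have hℓ0 : 0 < ℓ := hx.1.trans hx.2
  set C := 2 * b / (r - 1) with hC
  have hC0 : 0 < C := by positivity
  have hCb : C * ((r - 1) / 2) = b := by rw [hC]; field_simp
  obtain ⟨-, mψ⟩ := H.monotoneOn hr0.le hb.le hℓ0
  have hd := H.deriv_nonneg hr0.le hb.le hℓ0
  have sub : Set.Ioc 0 x ⊆ Set.Ioo 0 ℓ := fun y hy => ⟨hy.1, hy.2.trans_lt hx.2⟩
  -- Where r ψ ≤ (r - 1)/2, the loss b φ of the ψ-flux is compensated by C (r - 1)/2 · φ = b φ. So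
  -- the combined flux is non-decreasing, and near 0 it is bounded below by -c(ψ + C φ) → 0.
  have hmono := monotoneOn_of_hasDerivAt_nonneg (convex_Ioc 0 x)
    (f := fun x => ψ' x - c * ψ x + C * (φ' x - c * φ x))
    (fun y hy => ((H.dψ' y (sub hy)).sub ((H.dψ y (sub hy)).const_mul c)).add
      (((H.dφ' y (sub hy)).sub ((H.dφ y (sub hy)).const_mul c)).const_mul C))
    (fun y hy => by
      have hy' := Set.Ioo_subset_Icc_self (sub hy)
      have h1 := H.mem_φ y hy'
      have h2 := H.mem_ψ y hy'
      have h3 : ψ y ≤ (r - 1) / (2 * r) := (mψ hy' (Set.Ioo_subset_Icc_self hx) hy.2).trans hψ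
      rw [le_div_iff₀ (by linarith)] at h3
      have h4 : 0 ≤ C * (φ y * ((r - 1) / 2 + φ y - r * ψ y)) :=
        mul_nonneg hC0.le (mul_nonneg h1.1 (by linarith [h1.1]))
      have h5 : 0 ≤ C * (φ y * ((r - 1) / 2 + φ y - r * ψ y)) + b * (φ y * ψ y) :=
        add_nonneg h4 (mul_nonneg hb.le (mul_nonneg h1.1 h2.1))
      have h6 : C * (φ y * ((r - 1) / 2)) = b * φ y := by rw [← hCb]; ring
      linarith)
  have e : 𝓝[Set.Ioo 0 ℓ] (0 : ℝ) = 𝓝[>] 0 := nhdsWithin_Ioo_eq_nhdsGT hℓ0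
  have t1 : Tendsto φ (𝓝[>] 0) (𝓝 0) := by
    have := (H.cont_φ 0 ⟨le_rfl, hℓ0.le⟩).mono_left (nhdsWithin_mono _ Set.Ioo_subset_Icc_self)
    rwa [e, H.φ_zero] at this
  have t2 : Tendsto ψ (𝓝[>] 0) (𝓝 0) := by
    have := (H.cont_ψ 0 ⟨le_rfl, hℓ0.le⟩).mono_left (nhdsWithin_mono _ Set.Ioo_subset_Icc_self)
    rwa [e, H.ψ_zero] at this
  have t3 : Tendsto (fun y => -(c * (ψ y + C * φ y))) (𝓝[>] 0) (𝓝 (-(c * (0 + C * 0)))) :=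
    ((t2.add (t1.const_mul C)).const_mul c).neg
  rw [mul_zero, add_zero, mul_zero, neg_zero] at t3
  refine le_of_tendsto t3 ?_
  rw [← nhdsWithin_Ioo_eq_nhdsGT hx.1]
  filter_upwards [self_mem_nhdsWithin] with y hy
  have h1 := hmono ⟨hy.1, hy.2.le⟩ ⟨hx.1, le_rfl⟩ hy.2.le
  simp only at h1
  have h2 := hd y ⟨hy.1, hy.2.trans hx.2⟩
  have h3 := mul_nonneg hC0.le h2.1
  linarith [h2.2]

/-- The second component is small at a bounded distance to the left of a point where the first
one is small. -/
lemma ψ_le_of_φ_le (H : IsDirichletSolution r b c ℓ φ φ' ψ ψ') (hr : 1 < r) (hb : 0 < b)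
    (hc : 0 < c) {ε N x : ℝ} (hε₁ : 2 * b / (r - 1) * (2 * ε) ≤ c * ((r - 1) / (2 * r)) / 2)
    (hε₂ : b * ε ≤ c * (c * ((r - 1) / (2 * r)) / 2)) (hN0 : 0 < N)
    (hN : 1 < c * ((r - 1) / (2 * r)) / 2 * N) (hx : x < ℓ) (hxN : 0 < x - 1 - N)
    (hφ : φ x ≤ ε) : ψ (x - 1 - N) ≤ (r - 1) / (2 * r) := by
  have hr0 : 0 < r := by linarith
  have hr1 : 0 < r - 1 := by linarith
  have hℓ0 : 0 < ℓ := by linarith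
  set δ := (r - 1) / (2 * r) with hδ
  have hδ0 : 0 < δ := by positivity
  set m := c * δ / 2 with hm
  have hm0 : 0 < m := by positivity
  set C := 2 * b / (r - 1) with hC
  have hC0 : 0 < C := by positivity
  obtain ⟨mφ, mψ⟩ := H.monotoneOn hr0.le hb.le hℓ0
  have hd := H.deriv_nonneg hr0.le hb.le hℓ0
  by_contra hcon
  push Not at hcon
  -- At the point y where ψ = δ, the flux inequality and a small φ' force ψ' ≥ m = cδ/2. As φ ≤ ε up
  -- to x, this slope persists, and ψ would grow by more than 1.
  obtain ⟨y, hy, ey⟩ := intermediate_value_Icc hxN.le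
    (H.cont_ψ.mono (Set.Icc_subset_Icc_right (by linarith)))
    (⟨by rw [H.ψ_zero]; exact hδ0.le, hcon.le⟩ : δ ∈ Set.Icc (ψ 0) (ψ (x - 1 - N)))
  have hy0 : 0 < y := lt_of_le_of_ne hy.1 fun e => by
    rw [← e, H.ψ_zero] at ey
    linarith
  have hyx := hy.2
  have sub : Set.Icc y x ⊆ Set.Ioo 0 ℓ := Set.Icc_subset_Ioo hy0 hx
  have hyI : y ∈ Set.Ioo 0 ℓ := sub ⟨le_rfl, by linarith⟩
  have hφε : ∀ z ∈ Set.Icc y x, φ z ≤ ε := fun z hz =>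
    (mφ (Set.Ioo_subset_Icc_self (sub hz)) ⟨by linarith, hx.le⟩ hz.2).trans hφ
  have hε0 : 0 ≤ ε := (H.mem_φ x ⟨by linarith, hx.le⟩).1.trans hφ
  have hφ' : φ' y ≤ 2 * ε := by
    obtain ⟨z, hz, ez⟩ := exists_hasDerivAt_eq_slope φ φ' (by linarith : y < y + 1)
      (fun z hz => (H.dφ z (sub ⟨hz.1, by linarith [hz.2]⟩)).continuousAt.continuousWithinAt)
      (fun z hz => H.dφ z (sub ⟨hz.1.le, by linarith [hz.2]⟩))
    rw [add_sub_cancel_left, div_one] at ez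
    have h1 := hφε (y + 1) ⟨by linarith, by linarith⟩
    have h2 := (H.mem_φ y (Set.Ioo_subset_Icc_self hyI)).1
    have hmono := monotoneOn_of_hasDerivAt_nonneg (convex_Icc y x) (f := fun x => φ' x + ε * x)
      (fun z hz => (H.dφ' z (sub hz)).add ((hasDerivAt_id z).const_mul ε)) (fun z hz => by
        have h3 := H.mem_φ z (Set.Ioo_subset_Icc_self (sub hz))
        have h4 := H.mem_ψ z (Set.Ioo_subset_Icc_self (sub hz))
        have h5 := hφε z hz
        have h6 := mul_nonneg hc.le (hd z (sub hz)).1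
        have h7 : 0 ≤ φ z * (φ z + r * (1 - ψ z)) :=
          mul_nonneg h3.1 (add_nonneg h3.1 (mul_nonneg hr0.le (by linarith [h4.2])))
        linarith)
    have h3 := hmono (a := y) (b := z) ⟨le_rfl, by linarith⟩ ⟨hz.1.le, by linarith [hz.2]⟩ hz.1.le
    simp only at h3
    have h4 : ε * z ≤ ε * (y + 1) := mul_le_mul_of_nonneg_left hz.2.le hε0
    linarith
  have hψ'y : m ≤ ψ' y := by
    have h1 := H.flux_nonneg hr hb hyI ey.le
    rw [← hC, ey] at h1
    have h2 := mul_le_mul_of_nonneg_left hφ' hC0.le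
    have h3 := mul_nonneg hC0.le (mul_nonneg hc.le (H.mem_φ y (Set.Ioo_subset_Icc_self hyI)).1)
    have h4 : c * δ = m + m := by rw [hm]; ring
    linarith
  have hq : b * ε / c ≤ m := by rw [div_le_iff₀ hc]; linarith
  have hψ' : ∀ z ∈ Set.Icc y x, m ≤ ψ' z := by
    intro z hz
    have hmono := monotoneOn_mul_exp_of_le_deriv (convex_Icc y x) (Q := fun x => ψ' x - b * ε / c)
      (l := c) (fun z hz => (H.dψ' z (sub hz)).sub_const _) (fun z hz => by
        have h3 := H.mem_φ z (Set.Ioo_subset_Icc_self (sub hz))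
        have h4 := H.mem_ψ z (Set.Ioo_subset_Icc_self (sub hz))
        have h5 : φ z * (1 - ψ z) ≤ ε * 1 :=
          mul_le_mul (hφε z hz) (by linarith [h4.1]) (by linarith [h4.2]) hε0
        have h6 := mul_le_mul_of_nonneg_left h5 hb.le
        have h7 : c * (b * ε / c) = b * ε := by field_simp
        linarith)
    have h1 := hmono (a := y) (b := z) ⟨le_rfl, by linarith⟩ hz hz.1
    simp only at h1
    have h2 := mul_le_mul_of_nonneg_right h1 (Real.exp_pos (c * z)).le
    rw [mul_assoc, mul_assoc, ← Real.exp_add, ← Real.exp_add, neg_add_cancel, Real.exp_zero,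
      mul_one] at h2
    have h3 : 1 ≤ Real.exp (-(c * y) + c * z) := Real.one_le_exp (by
      have := mul_le_mul_of_nonneg_left hz.1 hc.le
      linarith)
    have h4 : (ψ' y - b * ε / c) * 1 ≤ (ψ' y - b * ε / c) * Real.exp (-(c * y) + c * z) :=
      mul_le_mul_of_nonneg_left h3 (by linarith)
    linarith
  have hmono := monotoneOn_of_hasDerivAt_nonneg (convex_Icc y x) (f := fun x => ψ x - m * x)
    (fun z hz => (H.dψ z (sub hz)).sub ((hasDerivAt_id z).const_mul m))
    (fun z hz => by linarith [hψ' z hz])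
  have h1 := hmono (a := y) (b := x) ⟨le_rfl, by linarith⟩ ⟨by linarith, le_rfl⟩ (by linarith)
  simp only at h1
  rw [ey] at h1
  have h2 := (H.mem_ψ x ⟨by linarith, hx.le⟩).2
  have h3 : m * N ≤ m * (x - y) := mul_le_mul_of_nonneg_left (by linarith) hm0.le
  linarith

end IsDirichletSolution

/-- The source is the derivative of the bounded function c u - u', so it cannot stay away from 0.
Hence limits of a profile are equilibria. -/
lemma eq_zero_of_tendsto_source_atTop {c e M : ℝ} {u u' E : ℝ → ℝ}
    (d : ∀ x, HasDerivAt u (u' x) x) (d' : ∀ x, HasDerivAt u' (c * u' x - E x) x)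
    (hM : ∀ x, |u' x - c * u x| ≤ M) (hE : Tendsto E atTop (𝓝 e)) : e = 0 := by
  have dF : ∀ x, HasDerivAt (fun x => c * u x - u' x) (E x) x := fun x =>
    (((d x).const_mul c).sub (d' x)).congr_deriv (by ring)
  rcases lt_trichotomy e 0 with h | h | h
  · obtain ⟨X, hX⟩ := eventually_atTop.1 (hE.eventually (gt_mem_nhds (by linarith : e < e / 2)))
    exact (false_of_deriv_ge_atTop (ε := -(e / 2)) (by linarith) (fun x _ => (dF x).neg)
      (fun x hx => by linarith [hX x hx]) (B := M)
      (fun x _ => by have := (abs_le.1 (hM x)).2; simp only [Pi.neg_apply]; linarith)).elim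
  · exact h
  · obtain ⟨X, hX⟩ := eventually_atTop.1 (hE.eventually (lt_mem_nhds (by linarith : e / 2 < e)))
    exact (false_of_deriv_ge_atTop (ε := e / 2) (by linarith) (fun x _ => dF x)
      (fun x hx => (hX x hx).le) (B := M)
      (fun x _ => by have := (abs_le.1 (hM x)).1; linarith)).elim

lemma eq_zero_of_tendsto_source_atBot {c e M : ℝ} {u u' E : ℝ → ℝ}
    (d : ∀ x, HasDerivAt u (u' x) x) (d' : ∀ x, HasDerivAt u' (c * u' x - E x) x)
    (hM : ∀ x, |u' x - c * u x| ≤ M) (hE : Tendsto E atBot (𝓝 e)) : e = 0 := by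
  refine eq_zero_of_tendsto_source_atTop (c := -c) (u := fun x => u (-x)) (u' := fun x => -u' (-x))
    (E := fun x => E (-x)) (M := M) (fun x => ?_) (fun x => ?_) (fun x => ?_)
    (hE.comp tendsto_neg_atTop_atBot)
  · exact ((d (-x)).comp x (hasDerivAt_neg x)).congr_deriv (by ring)
  · exact ((d' (-x)).comp x (hasDerivAt_neg x)).neg.congr_deriv (by ring)
  · have := hM (-x)
    rw [abs_le] at this ⊢
    constructor <;> linarith

end LeftTail

/-! ### Passage to the limit ℓ → ∞ without delay. -/

section Existence

variable {r b L c : ℝ} {φ φ' ψ ψ' : ℝ → ℝ}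

/-- A solution on the whole line is not a standing wave. -/
lemma false_of_isProfileAt_speed_zero (hb : 0 < b)
    (H : ∀ x, IsProfileAt r b L 0 φ φ' ψ ψ' x) (h0 : φ 0 = 1 / 4) : False := by
  have mφ : Monotone φ := fun x y hxy =>
    monotoneOn_of_hasDerivAt_nonneg convex_univ (fun x _ => (H x).dφ)
      (fun x _ => (H x).mem_φ'.1) (Set.mem_univ x) (Set.mem_univ y) hxy
  -- A non-decreasing concave function bounded on the line is constant. For c = 0 this applies to ψ,
  -- giving ψ = 1, and then to φ, giving φ(1 - φ) = 0.
  have key : ∀ {u u' u'' : ℝ → ℝ}, (∀ x, HasDerivAt u (u' x) x) → (∀ x, HasDerivAt u' (u'' x) x) →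
      (∀ x, u x ∈ Set.Icc (0 : ℝ) 1) → (∀ x, 0 ≤ u' x) → (∀ x, u'' x ≤ 0) →
      ∀ x, u' x = 0 ∧ u'' x = 0 := by
    intro u u' u'' d d' hu hu' hu''
    have hz : ∀ x, u' x = 0 := fun x => by
      by_contra hne
      have hpos := lt_of_le_of_ne (hu' x) (Ne.symm hne)
      refine false_of_deriv_ge_atBot (M := x) (B := 0) hpos (fun y _ => d y) (fun y hy => ?_)
        (fun y _ => (hu y).1)
      exact antitoneOn_of_hasDerivAt_nonpos convex_univ (fun x _ => d' x) (fun x _ => hu'' x)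
        (Set.mem_univ y) (Set.mem_univ x) hy
    refine fun x => ⟨hz x, ?_⟩
    have e : u' = fun _ => 0 := funext hz
    have h1 := d' x
    rw [e] at h1
    exact h1.unique (hasDerivAt_const x 0)
  have hψ := key (fun x => (H x).dψ) (fun x => (H x).dψ') (fun x => (H x).mem_ψ)
    (fun x => (H x).mem_ψ'.1) (fun x => by
      have := mul_nonneg (mul_nonneg hb.le (H x).mem_φ.1) (sub_nonneg.2 (H x).mem_ψ.2)
      linarith)
  have hψ1 : ∀ x, ψ x = 1 := by
    have h1 : ψ 0 = 1 := by
      have h2 := (hψ 0).2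
      rw [h0] at h2
      have h3 : b * (1 - ψ 0) = 0 := by linarith
      rcases mul_eq_zero.1 h3 with h | h <;> linarith
    intro x
    rw [← h1]
    exact is_const_of_deriv_eq_zero (fun x => (H x).dψ.differentiableAt)
      (fun x => by rw [(H x).dψ.deriv, (hψ x).1]) x 0
  have hφ := (key (fun x => (H x).dφ) (fun x => (H x).dφ') (fun x => (H x).mem_φ)
    (fun x => (H x).mem_φ'.1) (fun x => by
      have := mul_nonneg (H x).mem_φ.1 (sub_nonneg.2 (H x).mem_φ.2)
      rw [hψ1]
      linarith) 0).2
  rw [hψ1, h0] at hφ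
  linarith

/-- Existence of a wave without delay. -/
theorem IsProfile.exists_of_no_delay (hr : 1 < r) (hb : 0 < b) :
    ∃ (c : ℝ) (φ φ' ψ ψ' : ℝ → ℝ), IsProfile r b c 0 φ φ' ψ ψ' := by
  have hr0 : 0 < r := by linarith
  have hr1 : 0 < r - 1 := by linarith
  set ℓ : ℕ → ℝ := fun n => 16 * r + n with hℓdef
  have hℓ : ∀ n, 16 * r ≤ ℓ n := fun n => by
    have : (0 : ℝ) ≤ n := n.cast_nonneg
    simp only [hℓdef]; linarith
  have hℓ2 : ∀ n, 2 ≤ ℓ n := fun n => by linarith [hℓ n]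
  choose c hc φ φ' ψ ψ' H hφ using fun n => exists_normalized_dirichletSolution hr hb (hℓ n)
  set N : ℕ → ℝ := fun n => ℓ n / (4 * r) with hN
  set x₀ : ℕ → ℝ := fun n => ℓ n - ℓ n / (4 * r) with hx₀
  have tℓ : Tendsto ℓ atTop atTop :=
    tendsto_atTop_add_const_left _ _ tendsto_natCast_atTop_atTop
  have tN : Tendsto N atTop atTop := tℓ.atTop_div_const (by linarith)
  have tx : Tendsto x₀ atTop atTop := by
    have e : x₀ = fun n => (1 - 1 / (4 * r)) * ℓ n := by
      funext n
      simp only [hx₀]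
      ring
    rw [e]
    refine Tendsto.const_mul_atTop ?_ tℓ
    rw [sub_pos, div_lt_one (by linarith)]
    linarith
  -- The normalization point recedes from both ends, so the recentred intervals exhaust the line.
  have hdom : ∀ t : ℝ, ∀ᶠ n in atTop, t + x₀ n ∈ Set.Ioo 0 (ℓ n) := by
    intro t
    filter_upwards [tx.eventually_gt_atTop (-t), tN.eventually_gt_atTop t] with n h1 h2
    simp only [hN] at h2
    simp only [hx₀] at h1 ⊢
    exact ⟨by linarith, by linarith⟩
  have hP : ∀ n t, t + x₀ n ∈ Set.Ioo 0 (ℓ n) → IsProfileAt r b (derivBound r b) (c n)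
      (fun t => φ n (t + x₀ n)) (fun t => φ' n (t + x₀ n)) (fun t => ψ n (t + x₀ n))
      (fun t => ψ' n (t + x₀ n)) t := fun n t ht => by
    have h := (H n).isProfileAt hr0.le hb.le (hℓ2 n) (hc n) _ ht
    exact ⟨h.dφ.comp_add_const t _, h.dφ'.comp_add_const t _, h.dψ.comp_add_const t _,
      h.dψ'.comp_add_const t _, h.mem_φ, h.mem_φ', h.mem_ψ, h.mem_ψ'⟩
  obtain ⟨ns, c₀, f, f', g, g', hns, hc₀, hlimc, hlim⟩ := exists_subseq_tendsto_profile hc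
    isOpen_univ convex_univ (Set.mem_univ (0 : ℝ)) (fun a b' _ _ => by
      filter_upwards [hdom a, hdom b'] with n h1 h2 t ht
      exact hP n t ⟨by linarith [h1.1, ht.1], by linarith [h2.2, ht.2]⟩)
  have hf : ∀ t, Tendsto (fun n => φ (ns n) (t + x₀ (ns n))) atTop (𝓝 (f t)) := fun t =>
    (hlim t (Set.mem_univ t)).2.1
  have hf' : ∀ t, Tendsto (fun n => φ' (ns n) (t + x₀ (ns n))) atTop (𝓝 (f' t)) := fun t =>
    (hlim t (Set.mem_univ t)).2.2.1
  have hg : ∀ t, Tendsto (fun n => ψ (ns n) (t + x₀ (ns n))) atTop (𝓝 (g t)) := fun t =>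
    (hlim t (Set.mem_univ t)).2.2.2.1
  have hg' : ∀ t, Tendsto (fun n => ψ' (ns n) (t + x₀ (ns n))) atTop (𝓝 (g' t)) := fun t =>
    (hlim t (Set.mem_univ t)).2.2.2.2
  have P : ∀ t, IsProfileAt r b (derivBound r b) c₀ f f' g g' t := fun t =>
    (hlim t (Set.mem_univ t)).1
  have hdom' : ∀ t : ℝ, ∀ᶠ n in atTop, t + x₀ (ns n) ∈ Set.Ioo 0 (ℓ (ns n)) := fun t =>
    hns.tendsto_atTop.eventually (hdom t)
  have f0 : f 0 = 1 / 4 := by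
    refine tendsto_nhds_unique (hf 0) ?_
    simp only [zero_add, hx₀, hφ]
    exact tendsto_const_nhds
  have hc0 : 0 < c₀ := lt_of_le_of_ne hc₀.1 fun e =>
    false_of_isProfileAt_speed_zero hb (e ▸ P) f0
  have mf : Monotone f := fun x y hxy =>
    monotoneOn_of_hasDerivAt_nonneg convex_univ (fun x _ => (P x).dφ)
      (fun x _ => (P x).mem_φ'.1) (Set.mem_univ x) (Set.mem_univ y) hxy
  have mg : Monotone g := fun x y hxy =>
    monotoneOn_of_hasDerivAt_nonneg convex_univ (fun x _ => (P x).dψ)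
      (fun x _ => (P x).mem_ψ'.1) (Set.mem_univ x) (Set.mem_univ y) hxy
  have bdd : ∀ {u u' : ℝ → ℝ}, (∀ x, u x ∈ Set.Icc (0 : ℝ) 1) →
      (∀ x, u' x ∈ Set.Icc 0 (derivBound r b)) →
      ∀ x, |u' x - c₀ * u x| ≤ derivBound r b + c₀ := by
    intro u u' h1 h2 x
    have h3 := mul_nonneg hc0.le (h1 x).1
    have h4 := mul_le_of_le_one_right hc0.le (h1 x).2
    rw [abs_le]
    constructor <;> linarith [(h2 x).1, (h2 x).2, (h2 x).1.trans (h2 x).2]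
  have bf := bdd (fun x => (P x).mem_φ) fun x => (P x).mem_φ'
  have bg := bdd (fun x => (P x).mem_ψ) fun x => (P x).mem_ψ'
  have limTop : ∀ {u : ℝ → ℝ}, Monotone u → (∀ x, u x ∈ Set.Icc (0 : ℝ) 1) →
      ∃ a, Tendsto u atTop (𝓝 a) ∧ ∀ x, u x ≤ a := fun hm hu =>
    ⟨_, tendsto_atTop_ciSup hm ⟨1, by rintro _ ⟨x, rfl⟩; exact (hu x).2⟩,
      le_ciSup ⟨1, by rintro _ ⟨x, rfl⟩; exact (hu x).2⟩⟩
  have limBot : ∀ {u : ℝ → ℝ}, Monotone u → (∀ x, u x ∈ Set.Icc (0 : ℝ) 1) →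
      ∃ a, Tendsto u atBot (𝓝 a) ∧ ∀ x, a ≤ u x := fun hm hu =>
    ⟨_, tendsto_atBot_ciInf hm ⟨0, by rintro _ ⟨x, rfl⟩; exact (hu x).1⟩,
      ciInf_le ⟨0, by rintro _ ⟨x, rfl⟩; exact (hu x).1⟩⟩
  have source : ∀ {l : Filter ℝ} {a k : ℝ}, Tendsto f l (𝓝 a) → Tendsto g l (𝓝 k) →
      Tendsto (fun x => f x * (1 - r - f x + r * g x)) l (𝓝 (a * (1 - r - a + r * k))) ∧
      Tendsto (fun x => b * f x * (1 - g x)) l (𝓝 (b * a * (1 - k))) := fun h1 h2 =>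
    ⟨h1.mul ((h1.const_sub (1 - r)).add (h2.const_mul r)),
      (h1.const_mul b).mul (h2.const_sub 1)⟩
  have equil : ∀ {a k : ℝ}, a * (1 - r - a + r * k) = 0 → b * a * (1 - k) = 0 → a ≠ 0 →
      a = 1 ∧ k = 1 := by
    intro a k h1 h2 ha
    have hk : k = 1 := by
      rcases mul_eq_zero.1 h2 with h | h
      · exact absurd h (mul_ne_zero hb.ne' ha)
      · linarith
    subst hk
    rcases mul_eq_zero.1 h1 with h | h
    · exact absurd h ha
    · exact ⟨by linarith, rfl⟩
  obtain ⟨a₁, hfT, hfT'⟩ := limTop mf fun x => (P x).mem_φ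
  obtain ⟨k₁, hgT, -⟩ := limTop mg fun x => (P x).mem_ψ
  obtain ⟨a₂, hfB, hfB'⟩ := limBot mf fun x => (P x).mem_φ
  obtain ⟨k₂, hgB, hgB'⟩ := limBot mg fun x => (P x).mem_ψ
  have top := equil
    (eq_zero_of_tendsto_source_atTop (fun x => (P x).dφ) (fun x => (P x).dφ') bf
      (source hfT hgT).1)
    (eq_zero_of_tendsto_source_atTop (fun x => (P x).dψ) (fun x => (P x).dψ') bg
      (source hfT hgT).2) (by have := hfT' 0; linarith)
  have hfB0 : a₂ = 0 := by
    by_contra hne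
    have := (equil
      (eq_zero_of_tendsto_source_atBot (fun x => (P x).dφ) (fun x => (P x).dφ') bf
        (source hfB hgB).1)
      (eq_zero_of_tendsto_source_atBot (fun x => (P x).dψ) (fun x => (P x).dψ') bg
        (source hfB hgB).2) hne).1
    linarith [hfB' 0]
  subst hfB0
  have hk₂0 : 0 ≤ k₂ := ge_of_tendsto' hgB fun x => (P x).mem_ψ.1
  -- The equations do not decide this: every (0, k) is an equilibrium. Since c(ns n) > s = c₀/2
  -- eventually, the tail estimates hold with constants independent of n and pass to the limit as a
  -- flux inequality on a half-line; k₂ > 0 would then give g + C f a slope of at least c₀ k₂ there.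
  have hk₂ : k₂ = 0 := by
    set δ := (r - 1) / (2 * r) with hδ
    have hδ0 : 0 < δ := by positivity
    set C := 2 * b / (r - 1) with hC
    have hC0 : 0 < C := by positivity
    set s := c₀ / 2 with hs
    have hs0 : 0 < s := by positivity
    set K := 2 / (s * δ / 2) with hK
    have hK0 : 0 < K := by positivity
    have hKs : s * δ / 2 * K = 2 := by rw [hK]; field_simp
    set ε := min (s * δ / 2 / (2 * C)) (s * (s * δ / 2) / b) with hε
    have hε0 : 0 < ε := by positivity
    have hε₁ : C * (2 * ε) ≤ s * δ / 2 := by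
      have : ε ≤ s * δ / 2 / (2 * C) := min_le_left _ _
      rw [le_div_iff₀ (by positivity)] at this
      linarith
    have hε₂ : b * ε ≤ s * (s * δ / 2) := by
      have : ε ≤ s * (s * δ / 2) / b := min_le_right _ _
      rw [le_div_iff₀ hb] at this
      linarith
    obtain ⟨x₁, hx₁⟩ := (hfB.eventually (gt_mem_nhds hε0)).exists
    have small : ∀ᶠ n in atTop, ψ (ns n) (x₁ - 1 - K + x₀ (ns n)) ≤ δ := by
      filter_upwards [(hf x₁).eventually (gt_mem_nhds hx₁), hdom' x₁, hdom' (x₁ - 1 - K),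
        hlimc.eventually (lt_mem_nhds (by linarith : s < c₀))] with n h1 h2 h3 h4
      have h5 : s * δ / 2 ≤ c (ns n) * δ / 2 := by
        have := mul_le_mul_of_nonneg_right h4.le hδ0.le
        linarith
      have h6 : s * (s * δ / 2) ≤ c (ns n) * (c (ns n) * δ / 2) :=
        mul_le_mul h4.le h5 (by positivity) (by linarith)
      have h7 := mul_le_mul_of_nonneg_right h5 hK0.le
      have e : x₁ - 1 - K + x₀ (ns n) = x₁ + x₀ (ns n) - 1 - K := by ring
      rw [e] at h3 ⊢
      exact (H (ns n)).ψ_le_of_φ_le hr hb (by linarith) (hε₁.trans h5) (hε₂.trans h6) hK0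
        (by linarith) h2.2 h3.1 h1.le
    have flux : ∀ x ≤ x₁ - 1 - K, 0 ≤ g' x - c₀ * g x + C * (f' x - c₀ * f x) := by
      intro x hx
      refine ge_of_tendsto (((hg' x).sub (hlimc.mul (hg x))).add
        (((hf' x).sub (hlimc.mul (hf x))).const_mul C)) ?_
      filter_upwards [small, hdom' x, hdom' (x₁ - 1 - K)] with n h1 h2 h3
      refine (H (ns n)).flux_nonneg hr hb h2 ?_
      exact (((H (ns n)).monotoneOn hr0.le hb.le (by linarith [hℓ2 (ns n)])).2
        (Set.Ioo_subset_Icc_self h2) (Set.Ioo_subset_Icc_self h3) (by linarith)).trans h1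
    by_contra hne
    have hpos := lt_of_le_of_ne hk₂0 (Ne.symm hne)
    refine false_of_deriv_ge_atBot (M := x₁ - 1 - K) (ε := c₀ * k₂) (B := 0) (by positivity)
      (fun x _ => (P x).dψ.add ((P x).dφ.const_mul C)) (fun x hx => ?_) (fun x _ => ?_)
    · have h1 := flux x hx
      have h2 := mul_le_mul_of_nonneg_left (hgB' x) hc0.le
      have h3 := mul_nonneg hC0.le (mul_nonneg hc0.le (P x).mem_φ.1)
      linarith
    · exact add_nonneg (P x).mem_ψ.1 (mul_nonneg hC0.le (P x).mem_φ.1)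
  subst hk₂
  have hpos : ∀ x, 0 < f x := fun x => by
    refine lt_of_le_of_ne (P x).mem_φ.1 fun e => ?_
    have := eqOn_zero_of_nonneg_of_touch isOpen_univ convex_univ (c := c₀) hr0.le
      (fun y _ => (P y).dφ) (fun y _ => (P y).dφ') (fun y _ => (P y).mem_φ.1) (fun y _ => by
        have h3 : 0 ≤ f y * (1 - f y + r * g y) := mul_nonneg (P y).mem_φ.1
          (add_nonneg (by linarith [(P y).mem_φ.2]) (mul_nonneg hr0.le (P y).mem_ψ.1))
        linarith) (Set.mem_univ x) e.symm 0 (Set.mem_univ 0)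
    linarith
  have hlt : ∀ x, g x < 1 := fun x => by
    refine lt_of_le_of_ne (P x).mem_ψ.2 fun e => ?_
    have := eqOn_zero_of_nonneg_of_touch isOpen_univ convex_univ (c := c₀) hb.le
      (fun y _ => (P y).dψ.const_sub 1) (fun y _ => (P y).dψ'.neg)
      (fun y _ => sub_nonneg.2 (P y).mem_ψ.2) (fun y _ => by
        have h3 : 0 ≤ b * (1 - f y) * (1 - g y) :=
          mul_nonneg (mul_nonneg hb.le (by linarith [(P y).mem_φ.2])) (by linarith [(P y).mem_ψ.2])
        linarith) (Set.mem_univ x) (by rw [e]; ring)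
    have e1 : g = fun _ => 1 := funext fun y => by linarith [this y (Set.mem_univ y)]
    rw [e1] at hgB
    exact one_ne_zero (tendsto_nhds_unique tendsto_const_nhds hgB)
  exact ⟨c₀, f, f', g, g',
    { dφ := fun x => (P x).dφ
      dφ' := fun x => by rw [sub_zero]; exact (P x).dφ'
      dψ := fun x => (P x).dψ
      dψ' := fun x => (P x).dψ'
      pos_φ := hpos
      lt_ψ := hlt
      mono_φ := mf
      mono_ψ := mg
      φ_bot := hfB
      ψ_bot := hgB
      φ_top := by rw [← top.1]; exact hfT
      ψ_top := by rw [← top.2]; exact hgT }⟩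

end Existence

theorem theorem9 (n : ℕ) (r b : ℝ) (hr : 1 < r) (hb : 0 < b) :
    -- at most one wavefront (up to translation of the profile), and one speed, for each delay
    (∀ h : ℝ, 0 ≤ h → ∀ (ν₁ ν₂ : EuclideanSpace ℝ (Fin n)) (c₁ c₂ : ℝ) (φ₁ θ₁ φ₂ θ₂ : ℝ → ℝ),
      IsMonotoneWavefront r b h ν₁ c₁ φ₁ θ₁ → IsMonotoneWavefront r b h ν₂ c₂ φ₂ θ₂ →
      c₁ = c₂ ∧ ∃ s : ℝ, ∀ t : ℝ, φ₂ t = φ₁ (t + s) ∧ θ₂ t = θ₁ (t + s)) ∧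
    -- without delay a wavefront exists, in each direction
    (∀ ν : EuclideanSpace ℝ (Fin n), ‖ν‖ = 1 →
      ∃ (c : ℝ) (φ θ : ℝ → ℝ), IsMonotoneWavefront r b 0 ν c φ θ) ∧
    -- the upper bounds for the speed are well defined, and they hold
    (∀ h : ℝ, 0 ≤ h → ∃ cs co : ℝ,
      (∀ x : ℝ, IsCSharp r b h x ↔ x = cs) ∧ (∀ x : ℝ, IsCO r b h x ↔ x = co) ∧
      ∀ (ν : EuclideanSpace ℝ (Fin n)) (c : ℝ) (φ θ : ℝ → ℝ),
        IsMonotoneWavefront r b h ν c φ θ → c ≤ min cs co) ∧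
    -- the speed is non-increasing in the delay
    (∀ h₁ h₂ : ℝ, 0 ≤ h₁ → h₁ ≤ h₂ →
      ∀ (ν₁ ν₂ : EuclideanSpace ℝ (Fin n)) (c₁ c₂ : ℝ) (φ₁ θ₁ φ₂ θ₂ : ℝ → ℝ),
        IsMonotoneWavefront r b h₁ ν₁ c₁ φ₁ θ₁ → IsMonotoneWavefront r b h₂ ν₂ c₂ φ₂ θ₂ →
        c₂ ≤ c₁) := by
  refine ⟨?_, ?_, ?_, ?_⟩
  · intro h hh ν₁ ν₂ c₁ c₂ φ₁ θ₁ φ₂ θ₂ W₁ W₂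
    rcases le_total c₁ c₂ with hc | hc
    · obtain ⟨e, s, hs⟩ := W₁.isProfile.eq_shift_of_le hr hb W₂.isProfile hh le_rfl hc
      exact ⟨e, s, fun t => ⟨(hs t).1, by linarith [(hs t).2]⟩⟩
    · obtain ⟨e, s, hs⟩ := W₂.isProfile.eq_shift_of_le hr hb W₁.isProfile hh le_rfl hc
      refine ⟨e.symm, -s, fun t => ?_⟩
      have h1 := hs (t + -s)
      simp only [neg_add_cancel_right] at h1
      exact ⟨h1.1.symm, by linarith [h1.2]⟩
  · intro ν hν
    obtain ⟨c, φ, φ', ψ, ψ', H⟩ := IsProfile.exists_of_no_delay hr hb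
    exact ⟨c, φ, _, H.isMonotoneWavefront hν⟩
  · intro h hh
    obtain ⟨cs, hcs⟩ := existsUnique_isCSharp hr hb hh
    obtain ⟨co, hco⟩ := existsUnique_isCO hr hb hh
    refine ⟨cs, co, hcs, hco, fun ν c φ θ W => le_min ?_ ?_⟩
    · have h1 := (isCSharp_iff hr hb).1 ((hcs cs).2 rfl)
      exact W.isProfile.speed_le_of_isCSharp hr hb hh h1.1 h1.2
    · exact W.isProfile.speed_le_of_isCO hr hb hh ((hco co).2 rfl)
  · intro h₁ h₂ hh₁ hh ν₁ ν₂ c₁ c₂ φ₁ θ₁ φ₂ θ₂ W₁ W₂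
    -- If the wave with the larger delay were at least as fast, the comparison would force equal
    -- speeds.
    rcases le_total c₁ c₂ with hc | hc
    · exact (W₁.isProfile.eq_shift_of_le hr hb W₂.isProfile hh₁ hh hc).1.ge
    · exact hc
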